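/- **Conventions.** Let $k$ be a commutative ring with unit. A 3-term complex is a chain complex $(L,d)=(L_0\xleftarrow{d}L_1\xleftarrow{d}L_2)$ of $k$-modules. A degree-$r$ map $\mu:L^{\otimes n}\to L'$ (written $L^{\otimes n}\to L'[r]$) has differential $\partial\mu=d'\mu-(-1)^{r}\mu\, d_{L^{\otimes n}}$. All signs follow the Koszul rule: $\mu^\sigma(v_1,\dots,v_n)=\varepsilon(\sigma;v)\,\mu(v_{\sigma^{-1}(1)},\dots,v_{\sigma^{-1}(n)})$ with the Koszul sign $\varepsilon$, extended linearly to the group ring ($\mu^{1-(12)}=\mu-\mu^{(12)}$); $(\mu\circ_i\nu)(v_1,\dots)=(-1)^{|\nu|(|v_1|+\dots+|v_{i-1}|)}\mu(v_1,\dots,v_{i-1},\nu(v_i,\dots),\dots)$; and $\mu\circ(\nu_1,\dots,\nu_m)=\mu\,(\nu_1\otimes\dots\otimes\nu_m)$. **Weak Lie 3-algebras.** A weak Lie 3-algebra $(L,d,\lambda)$ is a 3-term complex with $k$-linear maps $\lambda_2:L^{\otimes2}\to L$, $\lambda_{2;1}:L^{\otimes2}\to L[1]$, $\lambda_{2;1,1}:L^{\otimes2}\to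 L[2]$, $\lambda_3:L^{\otimes3}\to L[1]$, $\lambda_{3;1},\lambda_{3;2}:L^{\otimes3}\to L[2]$, $\lambda_4:L^{\otimes4}\to L[2]$ such that (Leibniz 3-algebra) $$\partial\lambda_2=0,\qquad \partial\lambda_3=(\lambda_2\circ_2\lambda_2)^{1-(12)}-\lambda_2\circ_1\lambda_2,$$ $$\partial\lambda_4=\lambda_2\circ_1\lambda_3+(\lambda_2\circ_2\lambda_3)^{1-(12)+(123)}-\lambda_3\circ_1\lambda_2+(\lambda_3\circ_2\lambda_2)^{1-(12)}-(\lambda_3\circ_3\lambda_2)^{1-(23)+(132)},$$ $$\begin{aligned}0={}&\lambda_2\circ_1\lambda_4-(\lambda_2\circ_2\lambda_4)^{1-(12)+(123)-(1234)}+\lambda_3\circ_1\lambda_3+(\lambda_3\circ_2\lambda_3)^{1-(12)+(123)}\\&+(\lambda_3\circ_3\lambda_3)^{1-(23)+(132)+(234)-(1342)+(13)(24)}+\lambda_4\circ_1\lambda_2-(\lambda_4\circ_2\lambda_2)^{1-(12)}\\&+(\lambda_4\circ_3\lambda_2)^{1-(23)+(132)}-(\lambda_4\circ_4\lambda_2)^{1-(34)+(243)-(1432)},\end{aligned}$$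 and $$\partial\lambda_{2;1}=\lambda_2+\lambda_2^{(12)},\quad \partial\lambda_{2;1,1}=\lambda_{2;1}-\lambda_{2;1}^{(12)},\quad \partial\lambda_{3;1}=\lambda_3+\lambda_3^{(12)}+\lambda_2\circ_1\lambda_{2;1},$$ $$\partial\lambda_{3;2}=\lambda_3+\lambda_3^{(23)}-\lambda_2\circ_2\lambda_{2;1}+\lambda_{2;1}\circ_1\lambda_2+(\lambda_{2;1}\circ_2\lambda_2)^{(12)},$$ $$\lambda_{2;1,1}+\lambda_{2;1,1}^{(12)}=0,\qquad \lambda_{3;1}-\lambda_{3;1}^{(12)}=\lambda_2\circ_1\lambda_{2;1,1},$$ $$\lambda_{3;1}^{1+(23)+(132)}-\lambda_{3;2}^{1+(12)+(123)}=(\lambda_{2;1}\circ_2\lambda_{2;1})^{1+(12)}+\lambda_{2;1}\circ_1\lambda_{2;1}+(\lambda_{2;1,1}\circ_2\lambda_2)^{(132)},$$ $$\lambda_{3;2}-\lambda_{3;2}^{(23)}=-\lambda_2\circ_2\lambda_{2;1,1}+\lambda_{2;1,1}\circ_1\lambda_2+(\lambda_{2;1,1}\circ_2\lambda_2)^{(12)},$$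 $$\lambda_4+\lambda_4^{(12)}=\lambda_2\circ_1\lambda_{3;1}-\lambda_{3;1}\circ_3\lambda_2+(\lambda_2\circ_2\lambda_{3;1})^{(123)}+\lambda_3\circ_1\lambda_{2;1},$$ $$\lambda_4+\lambda_4^{(23)}=\lambda_2\circ_1\lambda_{3;2}-\lambda_3\circ_2\lambda_{2;1}+\lambda_2\circ_2\lambda_{3;1}-\lambda_{3;1}\circ_1\lambda_2-(\lambda_{3;1}\circ_2\lambda_2)^{(12)}-(\lambda_{3;1}\circ_3\lambda_2)^{(132)},$$ $$\begin{aligned}\lambda_4+\lambda_4^{(34)}={}&\lambda_{2;1}\circ_1\lambda_3-\lambda_{3;2}\circ_1\lambda_2+(\lambda_{3;2}\circ_2\lambda_2)^{1-(12)}+\lambda_3\circ_3\lambda_{2;1}\\&+(\lambda_{3;2}\circ_3\lambda_2)^{(23)-(132)}+(\lambda_2\circ_2\lambda_{3;2})^{1-(12)}+(\lambda_{2;1}\circ_2\lambda_3)^{(123)}.\end{aligned}$$ **Weak morphisms.** A weak morphism $f:(L,d,\lambda)\to(L',d',\lambda')$ consists of $k$-linear maps $f_1:L\to L'$, $f_2:L^{\otimes2}\to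 L'[1]$, $f_3:L^{\otimes3}\to L'[2]$, $f_{2;1}:L^{\otimes2}\to L'[2]$ with $$\partial f_1=0,\qquad \partial f_2=f_1\circ\lambda_2-\lambda_2'\circ(f_1,f_1),$$ $$\begin{aligned}\partial f_3={}&f_1\circ\lambda_3-(f_2\circ_2\lambda_2)^{1-(12)}+f_2\circ_1\lambda_2\\&-\lambda_3'\circ(f_1,f_1,f_1)-\lambda_2'\circ(f_1,f_2)^{1-(12)}+\lambda_2'\circ(f_2,f_1),\end{aligned}$$ $$\begin{aligned}f_1\circ\lambda_4-\lambda_4'\circ(f_1,f_1,f_1,f_1)={}&f_2\circ_1\lambda_3+(f_2\circ_2\lambda_3)^{1-(12)+(123)}-f_3\circ_1\lambda_2+(f_3\circ_2\lambda_2)^{1-(12)}\\&-(f_3\circ_3\lambda_2)^{1-(23)+(132)}+\lambda_2'\circ(f_3,f_1)+\lambda_2'\circ(f_1,f_3)^{1-(12)+(123)}\\&-\lambda_2'\circ(f_2,f_2)^{1-(23)+(132)}+\lambda_3'\circ(f_2,f_1,f_1)\\&-\lambda_3'\circ(f_1,f_2,f_1)^{1-(12)}+\lambda_3'\circ(f_1,f_1,f_2)^{1-(23)+(132)},\end{aligned}$$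 $$\partial f_{2;1}=-f_2-f_2^{(12)}+f_1\circ\lambda_{2;1}-\lambda_{2;1}'\circ(f_1,f_1),$$ $$f_1\circ\lambda_{2;1,1}-\lambda_{2;1,1}'\circ(f_1,f_1)=f_{2;1}-f_{2;1}^{(12)},$$ $$f_1\circ\lambda_{3;1}-\lambda_{3;1}'\circ(f_1,f_1,f_1)=f_3+f_3^{(12)}+f_2\circ_1\lambda_{2;1}+\lambda_2'\circ(f_{2;1},f_1),$$ $$\begin{aligned}f_1\circ\lambda_{3;2}-\lambda_{3;2}'\circ(f_1,f_1,f_1)={}&f_3+f_3^{(23)}-f_2\circ_2\lambda_{2;1}+f_{2;1}\circ_1\lambda_2+(f_{2;1}\circ_2\lambda_2)^{(12)}\\&-\lambda_2'\circ(f_1,f_{2;1})-\lambda_{2;1}'\circ(f_2,f_1)-\lambda_{2;1}'\circ(f_1,f_2)^{(12)}.\end{aligned}$$ **Proposition (homotopy transfer).** Let $(L,d,\lambda)$ be a weak Lie 3-algebra and let the 3-term complex $(L',d')$ be a deformation retract of $(L,d)$: there are given chain maps $p:L\to L'$, $i:L'\to L$ and a degree-$1$ map $h:L\to L$ with $\mathrm{id}_L-ip=[d,h]=dh+hd$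 and $pi=\mathrm{id}_{L'}$. Then the maps $$\lambda_2'=p\,\lambda_2(i,i),\quad \lambda_{2;1}'=p\,\lambda_{2;1}(i,i),\quad \lambda_{2;1,1}'=p\,\lambda_{2;1,1}(i,i),\quad \lambda_3'=p\,\theta_3\,(i,i,i),$$ $$\lambda_{3;1}'=p\,\big(\lambda_{3;1}-\lambda_2\circ_1(h\lambda_{2;1})\big)(i,i,i),$$ $$\lambda_{3;2}'=p\,\big(\lambda_{3;2}+\lambda_{2;1}\circ_1(h\lambda_2)+\lambda_2\circ_2(h\lambda_{2;1})+(\lambda_{2;1}\circ_2(h\lambda_2))^{(12)}\big)(i,i,i),$$ $$\lambda_4'=p\,(\lambda_4-\alpha-\beta)(i,i,i,i),$$ where $$\theta_3=\lambda_3+\lambda_2\circ_1(h\lambda_2)-(\lambda_2\circ_2(h\lambda_2))^{1-(12)},$$ $$\begin{aligned}\alpha={}&\lambda_2\circ_1(h\lambda_3)+(\lambda_2\circ_2(h\lambda_3))^{1-(12)+(123)}+\lambda_3\circ_1(h\lambda_2)\\&-(\lambda_3\circ_2(h\lambda_2))^{1-(12)}+(\lambda_3\circ_3(h\lambda_2))^{1-(23)+(132)},\end{aligned}$$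 $$\begin{aligned}\beta={}&(\lambda_2\circ_1(h\lambda_2))\circ_1(h\lambda_2)-\big((\lambda_2\circ_1(h\lambda_2))\circ_2(h\lambda_2)\big)^{1-(12)}+\lambda_2\circ(h\lambda_2,h\lambda_2)^{1-(23)+(132)}\\&+\big((\lambda_2\circ_2(h\lambda_2))\circ_2(h\lambda_2)\big)^{1-(12)+(123)}-\big((\lambda_2\circ_2(h\lambda_2))\circ_3(h\lambda_2)\big)^{1-(12)+(123)-(23)+(132)-(13)},\end{aligned}$$ make $(L',d',\lambda')$ a weak Lie 3-algebra, and $i$ extends to a weak morphism of weak Lie 3-algebras $(L',d',\lambda')\to(L,d,\lambda)$ with components $$i_1=i,\qquad i_2=-h\,\lambda_2(i,i),\qquad i_3=-h\,\theta_3\,(i,i,i),\qquad i_{2;1}=-h\,\lambda_{2;1}(i,i).$$ -/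

import Mathlib

/-- A `3`-term chain complex `L₀ ← L₁ ← L₂` of `k`-modules, written as an internally `ℤ`-graded
`k`-module `L` concentrated in degrees `0, 1, 2` with a differential of degree `-1`. -/
structure ThreeTermComplex (k : Type*) [CommRing k] (L : Type*) [AddCommGroup L] [Module k L] where
  gr : ℤ → Submodule k L
  isInternal : DirectSum.IsInternal gr
  gr_eq_bot : ∀ n : ℤ, n < 0 ∨ 2 < n → gr n = ⊥
  d : L →ₗ[k] L
  d_mem : ∀ (n : ℤ) (x : L), x ∈ gr n → d x ∈ gr (n - 1)
  d_d : ∀ x : L, d (d x) = 0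

/-- An operation `L^{⊗ n} → L'` of degree `r`, given by its values on tuples of homogeneous
elements. An argument is a pair `(a, v)`, to be read as a vector `v` of degree `a`; the degrees
are needed for the Koszul signs. Inputs are numbered `0, …, n - 1`. -/
def Op (L L' : Type*) (n : ℕ) (_r : ℤ) : Type _ := (Fin n → ℤ × L) → L'

/-- Apply a map (of degree `0`) to all arguments. -/
def mapArgs {L L' : Type*} (f : L → L') {n : ℕ} (x : Fin n → ℤ × L) : Fin n → ℤ × L' :=
  fun j => ((x j).1, f (x j).2)

/-- The total degree of a tuple of arguments. -/
def totalDeg {L : Type*} {n : ℕ} (x : Fin n → ℤ × L) : ℤ := ∑ j, (x j).1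

namespace Op

variable {L L' L'' : Type*}

section linear

variable {k : Type*} [CommRing k] [AddCommGroup L] [Module k L] [AddCommGroup L'] [Module k L']

/-- A linear map as a unary operation of degree `r`. -/
def lin1 (r : ℤ) (f : L →ₗ[k] L') : Op L L' 1 r := fun x => f (x 0).2

/-- A bilinear map as a binary operation of degree `r`. -/
def lin2 (r : ℤ) (f : L →ₗ[k] L →ₗ[k] L') : Op L L' 2 r := fun x => f (x 0).2 (x 1).2

/-- A trilinear map as a ternary operation of degree `r`. -/
def lin3 (r : ℤ) (f : L →ₗ[k] L →ₗ[k] L →ₗ[k] L') : Op L L' 3 r :=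
  fun x => f (x 0).2 (x 1).2 (x 2).2

/-- A quadrilinear map as a quaternary operation of degree `r`. -/
def lin4 (r : ℤ) (f : L →ₗ[k] L →ₗ[k] L →ₗ[k] L →ₗ[k] L') : Op L L' 4 r :=
  fun x => f (x 0).2 (x 1).2 (x 2).2 (x 3).2

end linear

variable [AddCommGroup L] [AddCommGroup L'] [AddCommGroup L'']

/-- The composite `g ∘ μ` with a map `g` of degree `s`. -/
def post {n : ℕ} {r : ℤ} (s : ℤ) (g : L' → L'') (μ : Op L L' n r) : Op L L'' n (s + r) :=
  fun x => g (μ x)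

/-- The partial composition that inserts `ν` into the `i`-th input of `μ` (counted from `0`):
`(-1)^(|ν| (|v₀| + ⋯ + |vᵢ₋₁|)) μ (v₀, …, vᵢ₋₁, ν (vᵢ, …, vᵢ₊ₙ₋₁), vᵢ₊ₙ, …)`. -/
def circ {m n : ℕ} {r s : ℤ} (μ : Op L L' m r) (i : Fin m) (ν : Op L L n s) :
    Op L L' (m + n - 1) (r + s) := fun x =>
  let inner : Fin n → ℤ × L := fun l => x ⟨i + l, by omega⟩
  (s * ∑ j : Fin i, (x ⟨j, by omega⟩).1).negOnePow •
    μ fun j =>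
      if hlt : j < i then x ⟨j, by omega⟩
      else if heq : j = i then (totalDeg inner + s, ν inner)
      else x ⟨j + n - 1, by omega⟩

/-- The full composition `μ ∘ (ν₁, ν₂)`. -/
def comp2 {a b : ℕ} {r s₁ s₂ : ℤ} (μ : Op L' L'' 2 r) (ν₁ : Op L L' a s₁) (ν₂ : Op L L' b s₂) :
    Op L L'' (a + b) (r + s₁ + s₂) := fun x =>
  let x₁ : Fin a → ℤ × L := fun l => x ⟨l, by omega⟩
  let x₂ : Fin b → ℤ × L := fun l => x ⟨a + l, by omega⟩
  (s₂ * totalDeg x₁).negOnePow •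
    μ ![(totalDeg x₁ + s₁, ν₁ x₁), (totalDeg x₂ + s₂, ν₂ x₂)]

/-- The full composition `μ ∘ (ν₁, ν₂, ν₃)`. -/
def comp3 {a b c : ℕ} {r s₁ s₂ s₃ : ℤ} (μ : Op L' L'' 3 r)
    (ν₁ : Op L L' a s₁) (ν₂ : Op L L' b s₂) (ν₃ : Op L L' c s₃) :
    Op L L'' (a + b + c) (r + s₁ + s₂ + s₃) := fun x =>
  let x₁ : Fin a → ℤ × L := fun l => x ⟨l, by omega⟩
  let x₂ : Fin b → ℤ × L := fun l => x ⟨a + l, by omega⟩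
  let x₃ : Fin c → ℤ × L := fun l => x ⟨a + b + l, by omega⟩
  (s₂ * totalDeg x₁ + s₃ * (totalDeg x₁ + totalDeg x₂)).negOnePow •
    μ ![(totalDeg x₁ + s₁, ν₁ x₁), (totalDeg x₂ + s₂, ν₂ x₂), (totalDeg x₃ + s₃, ν₃ x₃)]

/-- The right action `μ^σ (v₀, …, vₙ₋₁) = ε(σ; v) μ (v_{σ⁻¹ 0}, …, v_{σ⁻¹ (n-1)})` of the symmetric
group, where `ε` is the Koszul sign: one factor `(-1)^(|vᵢ| |vⱼ|)` for every pair that `σ`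
puts out of order. -/
def perm {n : ℕ} {r : ℤ} (μ : Op L L' n r) (σ : Equiv.Perm (Fin n)) : Op L L' n r := fun x =>
  (∏ i, ∏ j, if i < j ∧ σ j < σ i then ((x i).1 * (x j).1).negOnePow else 1) •
    μ (fun j => x (σ.symm j))

/-- The action of a single cycle: `μ.cyc [i₁, i₂, …, iₗ] = μ^(i₁ i₂ … iₗ)`, the cycle
`i₁ ↦ i₂ ↦ ⋯ ↦ iₗ ↦ i₁`, with inputs counted from `0`. -/
def cyc {n : ℕ} {r : ℤ} (μ : Op L L' n r) (c : List (Fin n)) : Op L L' n r := μ.perm c.formPerm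

end Op

namespace ThreeTermComplex

variable {k : Type*} [CommRing k] {L L' : Type*} [AddCommGroup L] [Module k L]
  [AddCommGroup L'] [Module k L']

/-- Every argument is homogeneous of the degree attached to it. -/
def Homog (C : ThreeTermComplex k L) {n : ℕ} (x : Fin n → ℤ × L) : Prop :=
  ∀ j, (x j).2 ∈ C.gr (x j).1

/-- The operation `μ` is homogeneous of degree `r`. -/
def HasDegree (C : ThreeTermComplex k L) (C' : ThreeTermComplex k L') {n : ℕ} {r : ℤ}
    (μ : Op L L' n r) : Prop :=
  ∀ x, C.Homog x → μ x ∈ C'.gr (totalDeg x + r)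

/-- The differential `∂ μ = d' ∘ μ - (-1)^|μ| μ ∘ d_{L^{⊗ n}}` of the complex of operations. -/
def bdry (C : ThreeTermComplex k L) (C' : ThreeTermComplex k L') {n : ℕ} {r : ℤ}
    (μ : Op L L' n r) : Op L L' n (r - 1) := fun x =>
  C'.d (μ x) - r.negOnePow • ∑ j : Fin n,
    (∑ l : Fin j, (x ⟨l, by omega⟩).1).negOnePow •
      μ (Function.update x j ((x j).1 - 1, C.d (x j).2))

end ThreeTermComplex

/-- The structure maps `λ₂, λ₃, λ₄` (Leibniz part) and `λ_{2;1}, λ_{2;1,1}, λ_{3;1}, λ_{3;2}`,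
without any condition. -/
structure Lie3Maps (k : Type*) [CommRing k] (L : Type*) [AddCommGroup L] [Module k L] where
  l2 : L →ₗ[k] L →ₗ[k] L
  l3 : L →ₗ[k] L →ₗ[k] L →ₗ[k] L
  l4 : L →ₗ[k] L →ₗ[k] L →ₗ[k] L →ₗ[k] L
  l21 : L →ₗ[k] L →ₗ[k] L
  l211 : L →ₗ[k] L →ₗ[k] L
  l31 : L →ₗ[k] L →ₗ[k] L →ₗ[k] L
  l32 : L →ₗ[k] L →ₗ[k] L →ₗ[k] L

namespace Lie3Maps

variable {k : Type*} [CommRing k] {L : Type*} [AddCommGroup L] [Module k L] (A : Lie3Maps k L)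

def o2 : Op L L 2 0 := Op.lin2 0 A.l2
def o3 : Op L L 3 1 := Op.lin3 1 A.l3
def o4 : Op L L 4 2 := Op.lin4 2 A.l4
def o21 : Op L L 2 1 := Op.lin2 1 A.l21
def o211 : Op L L 2 2 := Op.lin2 2 A.l211
def o31 : Op L L 3 2 := Op.lin3 2 A.l31
def o32 : Op L L 3 2 := Op.lin3 2 A.l32

/-- `(L, d, λ₂, λ₃, λ₄)` is a Leibniz `3`-algebra. -/
structure IsLeibniz3 (C : ThreeTermComplex k L) : Prop where
  deg2 : C.HasDegree C A.o2
  deg3 : C.HasDegree C A.o3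
  deg4 : C.HasDegree C A.o4
  eq2 : ∀ x, C.Homog x → C.bdry C A.o2 x = 0
  eq3 : ∀ x, C.Homog x → C.bdry C A.o3 x =
    A.o2.circ 1 A.o2 x - A.o2.circ 0 A.o2 x - (A.o2.circ 1 A.o2).cyc [0, 1] x
  eq4 : ∀ x, C.Homog x → C.bdry C A.o4 x =
    A.o2.circ 0 A.o3 x + A.o2.circ 1 A.o3 x - (A.o2.circ 1 A.o3).cyc [0, 1] x
      + (A.o2.circ 1 A.o3).cyc [0, 1, 2] x - A.o3.circ 0 A.o2 x
      + A.o3.circ 1 A.o2 x - (A.o3.circ 1 A.o2).cyc [0, 1] x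
      - A.o3.circ 2 A.o2 x + (A.o3.circ 2 A.o2).cyc [1, 2] x
      - (A.o3.circ 2 A.o2).cyc [0, 2, 1] x
  eq5 : ∀ x, C.Homog x → 0 =
    A.o2.circ 0 A.o4 x - A.o2.circ 1 A.o4 x + (A.o2.circ 1 A.o4).cyc [0, 1] x
      - (A.o2.circ 1 A.o4).cyc [0, 1, 2] x + (A.o2.circ 1 A.o4).cyc [0, 1, 2, 3] x
      + A.o3.circ 0 A.o3 x + A.o3.circ 1 A.o3 x - (A.o3.circ 1 A.o3).cyc [0, 1] x
      + (A.o3.circ 1 A.o3).cyc [0, 1, 2] x + A.o3.circ 2 A.o3 x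
      - (A.o3.circ 2 A.o3).cyc [1, 2] x + (A.o3.circ 2 A.o3).cyc [0, 2, 1] x
      + (A.o3.circ 2 A.o3).cyc [1, 2, 3] x - (A.o3.circ 2 A.o3).cyc [0, 2, 3, 1] x
      + (A.o3.circ 2 A.o3).perm (Equiv.swap 0 2 * Equiv.swap 1 3) x
      + A.o4.circ 0 A.o2 x - A.o4.circ 1 A.o2 x + (A.o4.circ 1 A.o2).cyc [0, 1] x
      + A.o4.circ 2 A.o2 x - (A.o4.circ 2 A.o2).cyc [1, 2] x
      + (A.o4.circ 2 A.o2).cyc [0, 2, 1] x - A.o4.circ 3 A.o2 x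
      + (A.o4.circ 3 A.o2).cyc [2, 3] x - (A.o4.circ 3 A.o2).cyc [1, 3, 2] x
      + (A.o4.circ 3 A.o2).cyc [0, 3, 2, 1] x

/-- `(L, d, λ)` is a weak Lie `3`-algebra. -/
structure IsWeakLie3 (C : ThreeTermComplex k L) : Prop extends A.IsLeibniz3 C where
  deg21 : C.HasDegree C A.o21
  deg211 : C.HasDegree C A.o211
  deg31 : C.HasDegree C A.o31
  deg32 : C.HasDegree C A.o32
  eq21 : ∀ x, C.Homog x → C.bdry C A.o21 x = A.o2 x + A.o2.cyc [0, 1] x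
  eq211 : ∀ x, C.Homog x → C.bdry C A.o211 x = A.o21 x - A.o21.cyc [0, 1] x
  eq31 : ∀ x, C.Homog x → C.bdry C A.o31 x =
    A.o3 x + A.o3.cyc [0, 1] x + A.o2.circ 0 A.o21 x
  eq32 : ∀ x, C.Homog x → C.bdry C A.o32 x =
    A.o3 x + A.o3.cyc [1, 2] x - A.o2.circ 1 A.o21 x
      + A.o21.circ 0 A.o2 x + (A.o21.circ 1 A.o2).cyc [0, 1] x
  eq2111 : ∀ x, C.Homog x → A.o211 x + A.o211.cyc [0, 1] x = 0
  eq311 : ∀ x, C.Homog x → A.o31 x - A.o31.cyc [0, 1] x = A.o2.circ 0 A.o211 x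
  eq312 : ∀ x, C.Homog x →
    A.o31 x - A.o32.cyc [0, 1] x + A.o31.cyc [0, 2, 1] x
      - A.o32 x + A.o31.cyc [1, 2] x - A.o32.cyc [0, 1, 2] x =
    A.o21.circ 1 A.o21 x + A.o21.circ 0 A.o21 x
      + (A.o21.circ 1 A.o21).cyc [0, 1] x + (A.o211.circ 1 A.o2).cyc [0, 2, 1] x
  eq322 : ∀ x, C.Homog x → A.o32 x - A.o32.cyc [1, 2] x =
    - A.o2.circ 1 A.o211 x + A.o211.circ 0 A.o2 x + (A.o211.circ 1 A.o2).cyc [0, 1] x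
  eq41 : ∀ x, C.Homog x → A.o4 x + A.o4.cyc [0, 1] x =
    A.o2.circ 0 A.o31 x - A.o31.circ 2 A.o2 x
      + (A.o2.circ 1 A.o31).cyc [0, 1, 2] x + A.o3.circ 0 A.o21 x
  eq42 : ∀ x, C.Homog x → A.o4 x + A.o4.cyc [1, 2] x =
    A.o2.circ 0 A.o32 x - A.o3.circ 1 A.o21 x + A.o2.circ 1 A.o31 x
      - A.o31.circ 0 A.o2 x - (A.o31.circ 1 A.o2).cyc [0, 1] x
      - (A.o31.circ 2 A.o2).cyc [0, 2, 1] x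
  eq43 : ∀ x, C.Homog x → A.o4 x + A.o4.cyc [2, 3] x =
    A.o21.circ 0 A.o3 x - A.o32.circ 0 A.o2 x
      + A.o32.circ 1 A.o2 x - (A.o32.circ 1 A.o2).cyc [0, 1] x
      + A.o3.circ 2 A.o21 x + (A.o32.circ 2 A.o2).cyc [1, 2] x
      - (A.o32.circ 2 A.o2).cyc [0, 2, 1] x
      + A.o2.circ 1 A.o32 x - (A.o2.circ 1 A.o32).cyc [0, 1] x
      + (A.o21.circ 1 A.o3).cyc [0, 1, 2] x

end Lie3Maps

/-- A weak Lie `3`-algebra structure on the complex `C`. -/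
structure WeakLie3Algebra {k : Type*} [CommRing k] {L : Type*} [AddCommGroup L] [Module k L]
    (C : ThreeTermComplex k L) extends Lie3Maps k L where
  isWeakLie3 : toLie3Maps.IsWeakLie3 C

/-- The components `f₁, f₂, f₃, f_{2;1}` of a weak morphism, without any condition. -/
structure Lie3MorMaps (k : Type*) [CommRing k] (L L' : Type*) [AddCommGroup L] [Module k L]
    [AddCommGroup L'] [Module k L'] where
  f1 : L →ₗ[k] L'
  f2 : L →ₗ[k] L →ₗ[k] L'
  f3 : L →ₗ[k] L →ₗ[k] L →ₗ[k] L'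
  f21 : L →ₗ[k] L →ₗ[k] L'

namespace Lie3MorMaps

variable {k : Type*} [CommRing k] {L L' : Type*} [AddCommGroup L] [Module k L]
  [AddCommGroup L'] [Module k L'] (f : Lie3MorMaps k L L')

def o1 : Op L L' 1 0 := Op.lin1 0 f.f1
def o2 : Op L L' 2 1 := Op.lin2 1 f.f2
def o3 : Op L L' 3 2 := Op.lin3 2 f.f3
def o21 : Op L L' 2 2 := Op.lin2 2 f.f21

/-- `(f₁, f₂, f₃)` is a weak morphism of Leibniz `3`-algebras `(L, d, λ) → (L', d', λ')`. -/
structure IsLeibniz3Mor (C : ThreeTermComplex k L) (C' : ThreeTermComplex k L')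
    (A : Lie3Maps k L) (A' : Lie3Maps k L') : Prop where
  deg1 : C.HasDegree C' f.o1
  deg2 : C.HasDegree C' f.o2
  deg3 : C.HasDegree C' f.o3
  eq1 : ∀ x, C.Homog x → C.bdry C' f.o1 x = 0
  eq2 : ∀ x, C.Homog x → C.bdry C' f.o2 x = f.f1 (A.o2 x) - A'.o2 (mapArgs f.f1 x)
  eq3 : ∀ x, C.Homog x → C.bdry C' f.o3 x =
    f.f1 (A.o3 x) - f.o2.circ 1 A.o2 x + f.o2.circ 0 A.o2 x + (f.o2.circ 1 A.o2).cyc [0, 1] x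
      - A'.o3 (mapArgs f.f1 x) - A'.o2.comp2 f.o1 f.o2 x + A'.o2.comp2 f.o2 f.o1 x
      + (A'.o2.comp2 f.o1 f.o2).cyc [0, 1] x
  eq4 : ∀ x, C.Homog x → f.f1 (A.o4 x) - A'.o4 (mapArgs f.f1 x) =
    f.o2.circ 0 A.o3 x + f.o2.circ 1 A.o3 x - (f.o2.circ 1 A.o3).cyc [0, 1] x
      + (f.o2.circ 1 A.o3).cyc [0, 1, 2] x - f.o3.circ 0 A.o2 x
      + f.o3.circ 1 A.o2 x - (f.o3.circ 1 A.o2).cyc [0, 1] x - f.o3.circ 2 A.o2 x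
      + (f.o3.circ 2 A.o2).cyc [1, 2] x - (f.o3.circ 2 A.o2).cyc [0, 2, 1] x
      + A'.o2.comp2 f.o3 f.o1 x + A'.o2.comp2 f.o1 f.o3 x
      - (A'.o2.comp2 f.o1 f.o3).cyc [0, 1] x + (A'.o2.comp2 f.o1 f.o3).cyc [0, 1, 2] x
      - A'.o2.comp2 f.o2 f.o2 x + (A'.o2.comp2 f.o2 f.o2).cyc [1, 2] x
      - (A'.o2.comp2 f.o2 f.o2).cyc [0, 2, 1] x
      + A'.o3.comp3 f.o2 f.o1 f.o1 x
      - A'.o3.comp3 f.o1 f.o2 f.o1 x + (A'.o3.comp3 f.o1 f.o2 f.o1).cyc [0, 1] x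
      + A'.o3.comp3 f.o1 f.o1 f.o2 x
      - (A'.o3.comp3 f.o1 f.o1 f.o2).cyc [1, 2] x
      + (A'.o3.comp3 f.o1 f.o1 f.o2).cyc [0, 2, 1] x

/-- `f` is a weak morphism of weak Lie `3`-algebras `(L, d, λ) → (L', d', λ')`. -/
structure IsWeakLie3Mor (C : ThreeTermComplex k L) (C' : ThreeTermComplex k L')
    (A : Lie3Maps k L) (A' : Lie3Maps k L') : Prop extends f.IsLeibniz3Mor C C' A A' where
  deg21 : C.HasDegree C' f.o21
  eq21 : ∀ x, C.Homog x → C.bdry C' f.o21 x =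
    - f.o2 x - f.o2.cyc [0, 1] x + f.f1 (A.o21 x) - A'.o21 (mapArgs f.f1 x)
  eq211 : ∀ x, C.Homog x → f.f1 (A.o211 x) - A'.o211 (mapArgs f.f1 x) =
    f.o21 x - f.o21.cyc [0, 1] x
  eq31 : ∀ x, C.Homog x → f.f1 (A.o31 x) - A'.o31 (mapArgs f.f1 x) =
    f.o3 x + f.o3.cyc [0, 1] x + f.o2.circ 0 A.o21 x + A'.o2.comp2 f.o21 f.o1 x
  eq32 : ∀ x, C.Homog x → f.f1 (A.o32 x) - A'.o32 (mapArgs f.f1 x) =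
    f.o3 x + f.o3.cyc [1, 2] x - f.o2.circ 1 A.o21 x
      + f.o21.circ 0 A.o2 x + (f.o21.circ 1 A.o2).cyc [0, 1] x
      - A'.o2.comp2 f.o1 f.o21 x - A'.o21.comp2 f.o2 f.o1 x
      - (A'.o21.comp2 f.o1 f.o2).cyc [0, 1] x

end Lie3MorMaps

/-- A weak morphism of weak Lie `3`-algebras. -/
structure WeakLie3Mor {k : Type*} [CommRing k] {L L' : Type*} [AddCommGroup L] [Module k L]
    [AddCommGroup L'] [Module k L'] {C : ThreeTermComplex k L} {C' : ThreeTermComplex k L'}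
    (A : WeakLie3Algebra C) (A' : WeakLie3Algebra C') extends Lie3MorMaps k L L' where
  isWeakLie3Mor : toLie3MorMaps.IsWeakLie3Mor C C' A.toLie3Maps A'.toLie3Maps

/-- A deformation retract of `3`-term complexes: chain maps `p : L → L'`, `i : L' → L` and a map
`h : L → L` of degree `1` with `id - i p = [d, h] = d h + h d` and `p i = id`. -/
structure DeformationRetract {k : Type*} [CommRing k] {L L' : Type*} [AddCommGroup L] [Module k L]
    [AddCommGroup L'] [Module k L'] (C : ThreeTermComplex k L) (C' : ThreeTermComplex k L') where
  p : L →ₗ[k] L'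
  i : L' →ₗ[k] L
  h : L →ₗ[k] L
  p_mem : ∀ (n : ℤ) (x : L), x ∈ C.gr n → p x ∈ C'.gr n
  i_mem : ∀ (n : ℤ) (x : L'), x ∈ C'.gr n → i x ∈ C.gr n
  h_mem : ∀ (n : ℤ) (x : L), x ∈ C.gr n → h x ∈ C.gr (n + 1)
  p_d : ∀ x : L, p (C.d x) = C'.d (p x)
  i_d : ∀ x : L', i (C'.d x) = C.d (i x)
  homotopy : ∀ x : L, x - i (p x) = C.d (h x) + h (C.d x)
  p_i : ∀ x : L', p (i x) = x

namespace DeformationRetract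

variable {k : Type*} [CommRing k] {L L' : Type*} [AddCommGroup L] [Module k L]
  [AddCommGroup L'] [Module k L'] {C : ThreeTermComplex k L} {C' : ThreeTermComplex k L'}
  (R : DeformationRetract C C') (A : Lie3Maps k L)

/-- `h ∘ λ₂`. -/
def h2 : Op L L 2 1 := A.o2.post 1 R.h
/-- `h ∘ λ₃`. -/
def h3 : Op L L 3 2 := A.o3.post 1 R.h
/-- `h ∘ λ_{2;1}`. -/
def h21 : Op L L 2 2 := A.o21.post 1 R.h

/-- `λ₃ + λ₂ ∘₁ hλ₂ - (λ₂ ∘₂ hλ₂)^(1 - (12))`. -/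
def t3 : Op L L 3 1 := fun x =>
  A.o3 x + (A.o2.circ 0 (R.h2 A) x
    - (A.o2.circ 1 (R.h2 A) x - (A.o2.circ 1 (R.h2 A)).cyc [0, 1] x))

/-- The operation on `L` from which `λ₄'` is obtained. -/
def t4 : Op L L 4 2 := fun x =>
  A.o4 x
    - (A.o2.circ 0 (R.h3 A) x
      + (A.o2.circ 1 (R.h3 A) x - (A.o2.circ 1 (R.h3 A)).cyc [0, 1] x
        + (A.o2.circ 1 (R.h3 A)).cyc [0, 1, 2] x)
      + A.o3.circ 0 (R.h2 A) x
      - (A.o3.circ 1 (R.h2 A) x - (A.o3.circ 1 (R.h2 A)).cyc [0, 1] x)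
      + (A.o3.circ 2 (R.h2 A) x - (A.o3.circ 2 (R.h2 A)).cyc [1, 2] x
        + (A.o3.circ 2 (R.h2 A)).cyc [0, 2, 1] x))
    - ((A.o2.circ 0 (R.h2 A)).circ 0 (R.h2 A) x
      - ((A.o2.circ 0 (R.h2 A)).circ 1 (R.h2 A) x
        - ((A.o2.circ 0 (R.h2 A)).circ 1 (R.h2 A)).cyc [0, 1] x)
      + (A.o2.comp2 (R.h2 A) (R.h2 A) x
        - (A.o2.comp2 (R.h2 A) (R.h2 A)).cyc [1, 2] x
        + (A.o2.comp2 (R.h2 A) (R.h2 A)).cyc [0, 2, 1] x)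
      + ((A.o2.circ 1 (R.h2 A)).circ 1 (R.h2 A) x
        - ((A.o2.circ 1 (R.h2 A)).circ 1 (R.h2 A)).cyc [0, 1] x
        + ((A.o2.circ 1 (R.h2 A)).circ 1 (R.h2 A)).cyc [0, 1, 2] x)
      - ((A.o2.circ 1 (R.h2 A)).circ 2 (R.h2 A) x
        - ((A.o2.circ 1 (R.h2 A)).circ 2 (R.h2 A)).cyc [0, 1] x
        + ((A.o2.circ 1 (R.h2 A)).circ 2 (R.h2 A)).cyc [0, 1, 2] x
        - ((A.o2.circ 1 (R.h2 A)).circ 2 (R.h2 A)).cyc [1, 2] x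
        + ((A.o2.circ 1 (R.h2 A)).circ 2 (R.h2 A)).cyc [0, 2, 1] x
        - ((A.o2.circ 1 (R.h2 A)).circ 2 (R.h2 A)).cyc [0, 2] x))

/-- `λ_{3;1} - λ₂ ∘₁ hλ_{2;1}`. -/
def t31 : Op L L 3 2 := fun x => A.o31 x - A.o2.circ 0 (R.h21 A) x

/-- `λ_{3;2} + λ_{2;1} ∘₁ hλ₂ + λ₂ ∘₂ hλ_{2;1} + (λ_{2;1} ∘₂ hλ₂)^(12)`. -/
def t32 : Op L L 3 2 := fun x =>
  A.o32 x + (A.o21.circ 0 (R.h2 A) x + A.o2.circ 1 (R.h21 A) x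
    + (A.o21.circ 1 (R.h2 A)).cyc [0, 1] x)

/-- The structure maps `A'` on `L'` are the ones transferred from `A` along `R`, that is
`λ' = p ∘ t ∘ (i, …, i)` for the operations `t` above. -/
structure IsTransferred (A' : Lie3Maps k L') : Prop where
  l2 : ∀ x, C'.Homog x → A'.o2 x = R.p (A.o2 (mapArgs R.i x))
  l3 : ∀ x, C'.Homog x → A'.o3 x = R.p (R.t3 A (mapArgs R.i x))
  l4 : ∀ x, C'.Homog x → A'.o4 x = R.p (R.t4 A (mapArgs R.i x))
  l21 : ∀ x, C'.Homog x → A'.o21 x = R.p (A.o21 (mapArgs R.i x))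
  l211 : ∀ x, C'.Homog x → A'.o211 x = R.p (A.o211 (mapArgs R.i x))
  l31 : ∀ x, C'.Homog x → A'.o31 x = R.p (R.t31 A (mapArgs R.i x))
  l32 : ∀ x, C'.Homog x → A'.o32 x = R.p (R.t32 A (mapArgs R.i x))

/-- The components `f` are the standard extension of the inclusion `i` along `R`. -/
structure IsExtendedInclusion (f : Lie3MorMaps k L' L) : Prop where
  f1 : f.f1 = R.i
  f2 : ∀ x, C'.Homog x → f.o2 x = - R.h (A.o2 (mapArgs R.i x))
  f3 : ∀ x, C'.Homog x → f.o3 x = - R.h (R.t3 A (mapArgs R.i x))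
  f21 : ∀ x, C'.Homog x → f.o21 x = - R.h (A.o21 (mapArgs R.i x))

end DeformationRetract

/-!
The transferred operations are sums over rooted trees whose vertices carry the operations of `L`,
whose internal edges carry the homotopy `h`, with `i` at the leaves and `p` at the root. Cutting an
internal edge means replacing `h` by `[d, h] = id - ip`. Hence the boundary of a sum of trees is the
sum of all ways of cutting one edge, and the `id`-terms cancel by the identities in `L`, leaving
`ip` on the edges, which are precisely the compositions of transferred operations.

An operation of degree at least `3` vanishes on a `3`-term complex. So a boundary formula for a sum
of trees of degree `3` is an identity between operations of degree `2`: in this way every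
identity of degree `2` for the transferred operations is obtained from the one in `L`, and the
boundary formulas for `h t` with `t` a sum of trees, `[d, h] t = t - i p t`, give the identities
of the morphism extending `i`.
-/

theorem exists_eq_vec_three {M : Type*} (x : Fin 3 → M) : ∃ a b c, x = ![a, b, c] :=
  ⟨x 0, x 1, x 2, by funext j; fin_cases j <;> rfl⟩

theorem exists_eq_vec_four {M : Type*} (x : Fin 4 → M) : ∃ a b c d, x = ![a, b, c, d] :=
  ⟨x 0, x 1, x 2, x 3, by funext j; fin_cases j <;> rfl⟩

theorem exists_eq_vec_five {M : Type*} (x : Fin 5 → M) : ∃ a b c d e, x = ![a, b, c, d, e] :=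
  ⟨x 0, x 1, x 2, x 3, x 4, by funext j; fin_cases j <;> rfl⟩

theorem exists_eq_vec_three_of_degree_zero {M : Type*} (x : Fin 3 → ℤ × M) (h : ∀ j, (x j).1 = 0) :
    ∃ a b c, x = ![(0, a), (0, b), (0, c)] := by
  obtain ⟨⟨_, a⟩, ⟨_, b⟩, ⟨_, c⟩, rfl⟩ := exists_eq_vec_three x
  obtain ⟨rfl, rfl, rfl⟩ := And.intro (h 0) (And.intro (h 1) (h 2))
  exact ⟨a, b, c, rfl⟩

theorem exists_eq_vec_four_of_degree_zero {M : Type*} (x : Fin 4 → ℤ × M) (h : ∀ j, (x j).1 = 0) :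
    ∃ a b c d, x = ![(0, a), (0, b), (0, c), (0, d)] := by
  obtain ⟨⟨_, a⟩, ⟨_, b⟩, ⟨_, c⟩, ⟨_, d⟩, rfl⟩ := exists_eq_vec_four x
  obtain ⟨rfl, rfl, rfl, rfl⟩ := And.intro (h 0) (And.intro (h 1) (And.intro (h 2) (h 3)))
  exact ⟨a, b, c, d, rfl⟩

theorem exists_eq_vec_five_of_degree_zero {M : Type*} (x : Fin 5 → ℤ × M) (h : ∀ j, (x j).1 = 0) :
    ∃ a b c d e, x = ![(0, a), (0, b), (0, c), (0, d), (0, e)] := by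
  obtain ⟨⟨_, a⟩, ⟨_, b⟩, ⟨_, c⟩, ⟨_, d⟩, ⟨_, e⟩, rfl⟩ := exists_eq_vec_five x
  obtain ⟨rfl, rfl, rfl, rfl, rfl⟩ :=
    And.intro (h 0) (And.intro (h 1) (And.intro (h 2) (And.intro (h 3) (h 4))))
  exact ⟨a, b, c, d, e, rfl⟩

theorem exists_eq_vec_three_of_totalDeg_le_one {M : Type*} (x : Fin 3 → ℤ × M)
    (h0 : ∀ j, 0 ≤ (x j).1) (h1 : totalDeg x ≤ 1) : ∃ a b c, x = ![(0, a), (0, b), (0, c)] ∨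
      x = ![(1, a), (0, b), (0, c)] ∨ x = ![(0, a), (1, b), (0, c)] ∨
      x = ![(0, a), (0, b), (1, c)] := by
  obtain ⟨⟨p, a⟩, ⟨q, b⟩, ⟨r, c⟩, rfl⟩ := exists_eq_vec_three x
  have hp : 0 ≤ p := h0 0
  have hq : 0 ≤ q := h0 1
  have hr : 0 ≤ r := h0 2
  have hsum : p + q + r ≤ 1 := by simpa [totalDeg, Fin.sum_univ_three] using h1
  obtain ⟨rfl, rfl, rfl⟩ | ⟨rfl, rfl, rfl⟩ | ⟨rfl, rfl, rfl⟩ | ⟨rfl, rfl, rfl⟩ :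
    (p = 0 ∧ q = 0 ∧ r = 0) ∨ (p = 1 ∧ q = 0 ∧ r = 0) ∨ (p = 0 ∧ q = 1 ∧ r = 0) ∨
      (p = 0 ∧ q = 0 ∧ r = 1) := by omega
  all_goals exact ⟨a, b, c, by simp⟩

theorem exists_eq_vec_four_of_totalDeg_le_one {M : Type*} (x : Fin 4 → ℤ × M)
    (h0 : ∀ j, 0 ≤ (x j).1) (h1 : totalDeg x ≤ 1) : ∃ a b c d,
      x = ![(0, a), (0, b), (0, c), (0, d)] ∨
      x = ![(1, a), (0, b), (0, c), (0, d)] ∨ x = ![(0, a), (1, b), (0, c), (0, d)] ∨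
      x = ![(0, a), (0, b), (1, c), (0, d)] ∨ x = ![(0, a), (0, b), (0, c), (1, d)] := by
  obtain ⟨⟨p, a⟩, ⟨q, b⟩, ⟨r, c⟩, ⟨s, d⟩, rfl⟩ := exists_eq_vec_four x
  have hp : 0 ≤ p := h0 0
  have hq : 0 ≤ q := h0 1
  have hr : 0 ≤ r := h0 2
  have hs : 0 ≤ s := h0 3
  have hsum : p + q + r + s ≤ 1 := by simpa [totalDeg, Fin.sum_univ_four] using h1
  obtain ⟨rfl, rfl, rfl, rfl⟩ | ⟨rfl, rfl, rfl, rfl⟩ | ⟨rfl, rfl, rfl, rfl⟩ |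
      ⟨rfl, rfl, rfl, rfl⟩ | ⟨rfl, rfl, rfl, rfl⟩ :
    (p = 0 ∧ q = 0 ∧ r = 0 ∧ s = 0) ∨ (p = 1 ∧ q = 0 ∧ r = 0 ∧ s = 0) ∨
      (p = 0 ∧ q = 1 ∧ r = 0 ∧ s = 0) ∨ (p = 0 ∧ q = 0 ∧ r = 1 ∧ s = 0) ∨
      (p = 0 ∧ q = 0 ∧ r = 0 ∧ s = 1) := by omega
  all_goals exact ⟨a, b, c, d, by simp⟩

namespace Op

variable {L L' : Type*} {m n : ℕ} {r s t : ℤ}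

/-- The inputs of `ν` in `μ ∘ᵢ ν`. -/
def innerPos (i : Fin m) (l : Fin n) : Fin (m + n - 1) := ⟨i + l, by omega⟩

/-- The position in `μ ∘ᵢ ν` of the `j`-th input of `μ`, where `j ≠ i`. -/
def outerPos (n : ℕ) (i : Fin m) (j : {j : Fin m // j ≠ i}) : Fin (m + n - 1) :=
  if hlt : j.1 < i then ⟨j, by omega⟩ else ⟨j + n - 1, by have := j.2; omega⟩

/-- The arguments of `ν` in `μ ∘ᵢ ν`. -/
def innerArgs (i : Fin m) (x : Fin (m + n - 1) → ℤ × L) : Fin n → ℤ × L :=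
  fun l => x (innerPos i l)

/-- The arguments of `μ` in `μ ∘ᵢ ν`, the value of `ν` being `w`. -/
def outerArgs (i : Fin m) (x : Fin (m + n - 1) → ℤ × L) (w : ℤ × L) : Fin m → ℤ × L :=
  fun j => if h : j = i then w else x (outerPos n i ⟨j, h⟩)

theorem exists_pos (i : Fin m) (p : Fin (m + n - 1)) :
    (∃ j, outerPos n i j = p) ∨ ∃ l, innerPos i l = p := by
  by_cases h₁ : (p : ℕ) < i
  · refine .inl ⟨⟨⟨p, by omega⟩, by simp only [ne_eq, Fin.ext_iff]; omega⟩, ?_⟩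
    simp [outerPos, Fin.lt_def, h₁]
  by_cases h₂ : (p : ℕ) < i + n
  · exact .inr ⟨⟨p - i, by omega⟩, by simp only [innerPos, Fin.ext_iff]; omega⟩
  · refine .inl ⟨⟨⟨p + 1 - n, by omega⟩, by simp only [ne_eq, Fin.ext_iff]; omega⟩, ?_⟩
    have : ¬ p + 1 - n < (i : ℕ) := by omega
    simp only [outerPos, Fin.lt_def, this, dif_neg, Fin.ext_iff, not_false_eq_true]
    omega

theorem innerPos_ne_outerPos (i : Fin m) (l : Fin n) (j) : innerPos i l ≠ outerPos n i j := by
  obtain ⟨j, hj⟩ := j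
  simp only [innerPos, outerPos, Fin.lt_def, ne_eq, Fin.ext_iff] at hj ⊢
  split_ifs <;> simp only [] <;> omega

theorem innerPos_injective (i : Fin m) : Function.Injective (innerPos i : Fin n → _) := by
  intro l l' h
  simp only [innerPos, Fin.ext_iff] at h ⊢
  omega

theorem outerPos_injective (i : Fin m) : Function.Injective (outerPos n i) := by
  rintro ⟨j, hj⟩ ⟨j', hj'⟩ h
  simp only [outerPos, Fin.lt_def, ne_eq, Fin.ext_iff, Subtype.mk.injEq] at hj hj' h ⊢
  split_ifs at h <;> simp only [] at h <;> omega

theorem sum_pos {M : Type*} [AddCommMonoid M] (i : Fin m) (F : Fin (m + n - 1) → M) :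
    ∑ p, F p = ∑ j, F (outerPos n i j) + ∑ l : Fin n, F (innerPos i l) := by
  refine (Fintype.sum_bijective (Sum.elim (outerPos n i) (innerPos i)) ⟨?_, ?_⟩ _ _
    fun _ => rfl).symm.trans (Fintype.sum_sum_type _)
  · exact (outerPos_injective i).sumElim (innerPos_injective i)
      fun j l => (innerPos_ne_outerPos i l j).symm
  · intro p
    obtain ⟨j, h⟩ | ⟨l, h⟩ := exists_pos i p
    exacts [⟨.inl j, h⟩, ⟨.inr l, h⟩]

/-- The total degree of the arguments preceding the `p`-th one, the exponent of the Koszul sign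
for moving an odd operation past them. -/
def degBefore {n : ℕ} (x : Fin n → ℤ × L) (p : Fin n) : ℤ := ∑ q, if q < p then (x q).1 else 0

theorem sum_fin_eq_degBefore {n : ℕ} (x : Fin n → ℤ × L) (p : Fin n) :
    ∑ q : Fin p, (x ⟨q, by omega⟩).1 = degBefore x p := by
  rw [degBefore, ← Finset.sum_filter]
  refine Finset.sum_bij (fun q _ => ⟨q, by omega⟩) ?_ ?_ ?_ fun _ _ => rfl
  · intro q _
    simp only [Finset.mem_filter, Finset.mem_univ, true_and, Fin.lt_def]
    exact q.2
  · intro q _ q' _ h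
    simpa only [Fin.ext_iff] using h
  · intro q hq
    exact ⟨⟨q, (Finset.mem_filter.1 hq).2⟩, Finset.mem_univ _, rfl⟩

@[simp] theorem outerArgs_self (i : Fin m) (x : Fin (m + n - 1) → ℤ × L) (w : ℤ × L) :
    outerArgs i x w i = w := by
  simp [outerArgs]

@[simp] theorem outerArgs_coe (i : Fin m) (x : Fin (m + n - 1) → ℤ × L) (w : ℤ × L)
    (j : {j // j ≠ i}) : outerArgs i x w j = x (outerPos n i j) := by
  simp [outerArgs, j.2]

theorem totalDeg_outerArgs (i : Fin m) (x : Fin (m + n - 1) → ℤ × L) (v : L) :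
    totalDeg (outerArgs i x (totalDeg (innerArgs i x) + s, v)) = totalDeg x + s := by
  simp only [totalDeg, innerArgs]
  rw [Fintype.sum_eq_add_sum_subtype_ne _ i, sum_pos i]
  simp only [outerArgs_self, outerArgs_coe]
  ring

theorem outerPos_lt_outerPos_iff (i : Fin m) (j j' : {j // j ≠ i}) :
    outerPos n i j < outerPos n i j' ↔ j < j' := by
  obtain ⟨j, hj⟩ := j
  obtain ⟨j', hj'⟩ := j'
  simp only [outerPos, Fin.lt_def, ne_eq, Fin.ext_iff, Subtype.mk_lt_mk] at hj hj' ⊢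
  split_ifs <;> simp only [] <;> omega

theorem innerPos_lt_innerPos_iff (i : Fin m) (l l' : Fin n) :
    innerPos i l < innerPos i l' ↔ l < l' := by
  simp only [innerPos, Fin.lt_def, add_lt_add_iff_left]

theorem innerPos_lt_outerPos_iff (i : Fin m) (l : Fin n) (j : {j // j ≠ i}) :
    innerPos i l < outerPos n i j ↔ i < j.1 := by
  obtain ⟨j, hj⟩ := j
  simp only [innerPos, outerPos, Fin.lt_def, ne_eq, Fin.ext_iff] at hj ⊢
  split_ifs <;> simp only [] <;> omega

theorem outerPos_lt_innerPos_iff (i : Fin m) (l : Fin n) (j : {j // j ≠ i}) :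
    outerPos n i j < innerPos i l ↔ j.1 < i := by
  obtain ⟨j, hj⟩ := j
  simp only [innerPos, outerPos, Fin.lt_def, ne_eq, Fin.ext_iff] at hj ⊢
  split_ifs <;> simp only [] <;> omega

theorem degBefore_outerArgs_self (i : Fin m) (x : Fin (m + n - 1) → ℤ × L) (w : ℤ × L) :
    degBefore (outerArgs i x w) i = ∑ q : Fin i, (x ⟨q, by omega⟩).1 := by
  rw [← sum_fin_eq_degBefore]
  refine Finset.sum_congr rfl fun q _ => ?_
  have hq : (⟨q, by omega⟩ : Fin m) ≠ i := by simp only [ne_eq, Fin.ext_iff]; omega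
  simp [outerArgs, outerPos, hq, Fin.lt_def]

theorem degBefore_innerPos (i : Fin m) (x : Fin (m + n - 1) → ℤ × L) (w : ℤ × L) (l : Fin n) :
    degBefore x (innerPos i l) =
      degBefore (outerArgs i x w) i + degBefore (innerArgs i x) l := by
  simp only [degBefore]
  rw [sum_pos i, Fintype.sum_eq_add_sum_subtype_ne _ i]
  simp only [outerPos_lt_innerPos_iff, innerPos_lt_innerPos_iff, outerArgs_coe,
    innerArgs, lt_irrefl, if_false, zero_add]

theorem degBefore_outerPos (i : Fin m) (x : Fin (m + n - 1) → ℤ × L) (v : L)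
    (j : {j // j ≠ i}) :
    degBefore (outerArgs i x (totalDeg (innerArgs i x) + s, v)) j =
      degBefore x (outerPos n i j) + if i < j.1 then s else 0 := by
  simp only [degBefore]
  rw [sum_pos i, Fintype.sum_eq_add_sum_subtype_ne _ i]
  simp only [outerPos_lt_outerPos_iff, outerArgs_coe, outerArgs_self,
    innerPos_lt_outerPos_iff, totalDeg, innerArgs, Subtype.coe_lt_coe]
  split_ifs
  · ring
  · simp only [Finset.sum_const_zero, add_zero, zero_add]

theorem update_outerArgs_self (i : Fin m) (x : Fin (m + n - 1) → ℤ × L) (w w' : ℤ × L) :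
    Function.update (outerArgs i x w) i w' = outerArgs i x w' := by
  funext j
  by_cases h : j = i <;> simp [outerArgs, h]

theorem outerArgs_update_outerPos (i : Fin m) (x : Fin (m + n - 1) → ℤ × L) (w v : ℤ × L)
    (j : {j // j ≠ i}) :
    outerArgs i (Function.update x (outerPos n i j) v) w =
      Function.update (outerArgs i x w) j v := by
  funext j'
  by_cases h : j' = i
  · simp [outerArgs, h, j.2.symm]
  · have := (outerPos_injective (n := n) i).eq_iff (a := ⟨j', h⟩) (b := j)
    simp [outerArgs, h, Function.update_apply, this, Subtype.ext_iff]

theorem outerArgs_update_innerPos (i : Fin m) (x : Fin (m + n - 1) → ℤ × L) (w v : ℤ × L)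
    (l : Fin n) :
    outerArgs i (Function.update x (innerPos i l) v) w = outerArgs i x w := by
  funext j
  by_cases h : j = i <;> simp [outerArgs, h, (innerPos_ne_outerPos i l _).symm]

theorem innerArgs_update_innerPos (i : Fin m) (x : Fin (m + n - 1) → ℤ × L) (v : ℤ × L)
    (l : Fin n) : innerArgs i (Function.update x (innerPos i l) v) =
      Function.update (innerArgs i x) l v :=
  Function.update_comp_eq_of_injective x (innerPos_injective i) l v

theorem innerArgs_update_outerPos (i : Fin m) (x : Fin (m + n - 1) → ℤ × L) (v : ℤ × L)
    (j : {j // j ≠ i}) :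
    innerArgs i (Function.update x (outerPos n i j) v) = (innerArgs i x : Fin n → ℤ × L) :=
  Function.update_comp_eq_of_forall_ne x v fun l => innerPos_ne_outerPos i l j

theorem totalDeg_update {n : ℕ} (x : Fin n → ℤ × L) (j : Fin n) (w : ℤ × L) :
    totalDeg (Function.update x j w) = totalDeg x + (w.1 - (x j).1) := by
  have h : (fun q => (Function.update x j w q).1) = Function.update (fun q => (x q).1) j w.1 := by
    funext q
    by_cases hq : q = j <;> simp [hq]
  simp only [totalDeg, h]
  rw [Finset.sum_update_of_mem (Finset.mem_univ j), ← Finset.add_sum_erase _ _ (Finset.mem_univ j),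
    Finset.sdiff_singleton_eq_erase]
  ring

theorem degBefore_update {n : ℕ} (x : Fin n → ℤ × L) (j p : Fin n) (w : ℤ × L) :
    degBefore (Function.update x j w) p = degBefore x p + if j < p then w.1 - (x j).1 else 0 := by
  have h : (fun q => if q < p then (Function.update x j w q).1 else 0) =
      Function.update (fun q => if q < p then (x q).1 else 0) j (if j < p then w.1 else 0) := by
    funext q
    by_cases hq : q = j <;> simp [hq]
  simp only [degBefore, h]
  rw [Finset.sum_update_of_mem (Finset.mem_univ j), ← Finset.add_sum_erase _ _ (Finset.mem_univ j),
    Finset.sdiff_singleton_eq_erase]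
  split_ifs <;> ring

variable [AddCommGroup L']

theorem circ_apply (μ : Op L L' m r) (i : Fin m) (ν : Op L L n s) (x : Fin (m + n - 1) → ℤ × L)
    (w : ℤ × L) :
    μ.circ i ν x = (s * degBefore (outerArgs i x w) i).negOnePow •
      μ (outerArgs i x (totalDeg (innerArgs i x) + s, ν (innerArgs i x))) := by
  rw [degBefore_outerArgs_self]
  simp only [circ]
  congr 2
  funext j
  simp only [outerArgs, outerPos]
  split_ifs <;> first | rfl | omega

theorem circ_update_innerPos (μ : Op L L' m r) (i : Fin m) (ν : Op L L n s)
    (x : Fin (m + n - 1) → ℤ × L) (w v : ℤ × L) (l : Fin n) :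
    μ.circ i ν (Function.update x (innerPos i l) v) =
      (s * degBefore (outerArgs i x w) i).negOnePow •
        μ (outerArgs i x (totalDeg (Function.update (innerArgs i x) l v) + s,
          ν (Function.update (innerArgs i x) l v))) := by
  rw [circ_apply _ _ _ _ w, outerArgs_update_innerPos, outerArgs_update_innerPos,
    innerArgs_update_innerPos]

theorem circ_update_outerPos (μ : Op L L' m r) (i : Fin m) (ν : Op L L n s)
    (x : Fin (m + n - 1) → ℤ × L) (w v : ℤ × L) (j : {j // j ≠ i}) :
    μ.circ i ν (Function.update x (outerPos n i j) v) =
      (s * degBefore (Function.update (outerArgs i x w) j v) i).negOnePow •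
        μ (Function.update
          (outerArgs i x (totalDeg (innerArgs i x) + s, ν (innerArgs i x))) j v) := by
  rw [circ_apply _ _ _ _ w, innerArgs_update_outerPos, outerArgs_update_outerPos,
    outerArgs_update_outerPos]

theorem degBefore_smul_circ_update_innerPos (μ : Op L L' m r) (i : Fin m) (ν : Op L L n s)
    (x : Fin (m + n - 1) → ℤ × L) (w : ℤ × L) (l : Fin n) (v : L) :
    (degBefore x (innerPos i l)).negOnePow •
      μ.circ i ν (Function.update x (innerPos i l) ((x (innerPos i l)).1 - 1, v)) =
    (s * degBefore (outerArgs i x w) i + degBefore (outerArgs i x w) i).negOnePow •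
      (degBefore (innerArgs i x) l).negOnePow •
        μ (outerArgs i x (totalDeg (innerArgs i x) + (s - 1),
          ν (Function.update (innerArgs i x) l ((innerArgs i x l).1 - 1, v)))) := by
  have totalDeg_eq : totalDeg (innerArgs i x) +
      ((x (innerPos i l)).1 - 1 - (innerArgs i x l).1) + s =
        totalDeg (innerArgs i x) + (s - 1) := by
    simp only [innerArgs]
    ring
  rw [circ_update_innerPos _ _ _ _ w, totalDeg_update, degBefore_innerPos i x w, totalDeg_eq]
  simp only [smul_smul, ← Int.negOnePow_add]
  congr 2
  ring

theorem smul_degBefore_smul_circ_update_outerPos (μ : Op L L' m r) (i : Fin m) (ν : Op L L n s)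
    (x : Fin (m + n - 1) → ℤ × L) (j : {j // j ≠ i}) (v : L) {z : Fin m → ℤ × L}
    (hz : z = outerArgs i x (totalDeg (innerArgs i x) + s, ν (innerArgs i x))) :
    s.negOnePow • (degBefore x (outerPos n i j)).negOnePow •
      μ.circ i ν (Function.update x (outerPos n i j) ((x (outerPos n i j)).1 - 1, v)) =
    (s * degBefore z i).negOnePow • (degBefore z j).negOnePow •
      μ (Function.update z j ((z j).1 - 1, v)) := by
  rw [circ_update_outerPos _ _ _ _ (totalDeg (innerArgs i x) + s, ν (innerArgs i x)),
    degBefore_update, hz, degBefore_outerPos, outerArgs_coe]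
  simp only [smul_smul, ← Int.negOnePow_add]
  congr 1
  refine (Int.negOnePow_eq_iff _ _).2 ?_
  obtain h | h := j.2.lt_or_gt
  · simp only [h, h.not_gt, if_true, if_false]
    exact ⟨0, by ring⟩
  · simp only [h, h.not_gt, if_true, if_false]
    exact ⟨0, by ring⟩

instance : AddCommGroup (Op L L' n r) := inferInstanceAs (AddCommGroup ((Fin n → ℤ × L) → L'))

/-- The operation `μ` with another degree attached to it, so that a composite of degree `0 + r`
can be added to an operation of degree `r`. -/
def castDeg (t : ℤ) (μ : Op L L' n r) : Op L L' n t := μ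

omit [AddCommGroup L'] in
@[simp] theorem castDeg_apply (t : ℤ) (μ : Op L L' n r) (x) : μ.castDeg t x = μ x := rfl

@[simp] theorem zero_apply (x) : (0 : Op L L' n r) x = 0 := rfl

@[simp] theorem neg_apply (μ : Op L L' n r) (x) : (-μ) x = -μ x := rfl

@[simp] theorem smul_apply (u : ℤˣ) (μ : Op L L' n r) (x) : (u • μ) x = u • μ x := rfl

@[simp] theorem add_apply (μ ν : Op L L' n r) (x) : (μ + ν) x = μ x + ν x := rfl

@[simp] theorem sub_apply (μ ν : Op L L' n r) (x) : (μ - ν) x = μ x - ν x := rfl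

/-- The exponent of the Koszul sign `ε(σ; x)`. -/
def koszul (σ : Equiv.Perm (Fin n)) (x : Fin n → ℤ × L) : ℤ :=
  ∑ i, ∑ j, if i < j ∧ σ j < σ i then (x i).1 * (x j).1 else 0

theorem negOnePow_sum {ι : Type*} (s : Finset ι) (f : ι → ℤ) :
    (∑ i ∈ s, f i).negOnePow = ∏ i ∈ s, (f i).negOnePow := by
  induction s using Finset.cons_induction with
  | empty => rfl
  | cons i s hi ih => rw [Finset.sum_cons, Finset.prod_cons, Int.negOnePow_add, ih]

theorem perm_apply (μ : Op L L' n r) (σ : Equiv.Perm (Fin n)) (x : Fin n → ℤ × L) :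
    μ.perm σ x = (koszul σ x).negOnePow • μ (x ∘ σ.symm) := by
  simp only [perm, koszul, negOnePow_sum, apply_ite Int.negOnePow, Int.negOnePow_zero,
    Function.comp_def]

/-- The total degree of the arguments that `σ` moves from the left to the right of `x j`. -/
def degCrossing (σ : Equiv.Perm (Fin n)) (x : Fin n → ℤ × L) (j : Fin n) : ℤ :=
  ∑ q, if q < j ∧ σ j < σ q then (x q).1 else 0

/-- The total degree of the arguments that `σ` moves from the right to the left of `x j`. -/
def degCrossed (σ : Equiv.Perm (Fin n)) (x : Fin n → ℤ × L) (j : Fin n) : ℤ :=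
  ∑ q, if j < q ∧ σ q < σ j then (x q).1 else 0

theorem koszul_update (σ : Equiv.Perm (Fin n)) (x : Fin n → ℤ × L) (j : Fin n) (w : ℤ × L) :
    koszul σ (Function.update x j w) =
      koszul σ x + (w.1 - (x j).1) * (degCrossed σ x j + degCrossing σ x j) := by
  set δ := w.1 - (x j).1
  have hδ (p) : (Function.update x j w p).1 = (x p).1 + if p = j then δ else 0 := by
    by_cases hp : p = j <;> simp [hp, δ]
  have term (p q) : (if p < q ∧ σ q < σ p then
        (Function.update x j w p).1 * (Function.update x j w q).1 else 0) =
      (if p < q ∧ σ q < σ p then (x p).1 * (x q).1 else 0) +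
        ((if p = j then δ * (if j < q ∧ σ q < σ j then (x q).1 else 0) else 0) +
        (if q = j then δ * (if p < j ∧ σ j < σ p then (x p).1 else 0) else 0)) := by
    simp only [hδ]
    grind
  simp only [koszul, degCrossed, degCrossing, term, Finset.sum_add_distrib, Finset.sum_ite_eq',
    Finset.mem_univ, if_true, Finset.mul_sum, mul_add]
  rw [Finset.sum_comm (f := fun p q => if p = j then _ else _)]
  simp only [Finset.sum_ite_eq', Finset.mem_univ, if_true]

theorem degBefore_add_degCrossed (σ : Equiv.Perm (Fin n)) (x : Fin n → ℤ × L) (j : Fin n) :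
    degBefore x j + degCrossed σ x j = degBefore (x ∘ σ.symm) (σ j) + degCrossing σ x j := by
  have h : degBefore (x ∘ σ.symm) (σ j) = ∑ q, if σ q < σ j then (x q).1 else 0 := by
    rw [degBefore, ← Equiv.sum_comp σ]
    simp only [Function.comp_apply, Equiv.symm_apply_apply]
  rw [h]
  simp only [degBefore, degCrossed, degCrossing, ← Finset.sum_add_distrib]
  refine Finset.sum_congr rfl fun q _ => ?_
  have := σ.injective.ne_iff (x := q) (y := j)
  grind

theorem negOnePow_koszul_update (σ : Equiv.Perm (Fin n)) (x : Fin n → ℤ × L) (j : Fin n) (v : L) :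
    (degBefore x j).negOnePow * (koszul σ (Function.update x j ((x j).1 - 1, v))).negOnePow =
      (koszul σ x).negOnePow * (degBefore (x ∘ σ.symm) (σ j)).negOnePow := by
  rw [← Int.negOnePow_add, ← Int.negOnePow_add, Int.negOnePow_eq_iff, koszul_update]
  dsimp only
  exact ⟨-degCrossed σ x j, by linear_combination degBefore_add_degCrossed σ x j⟩

theorem update_comp_symm (σ : Equiv.Perm (Fin n)) (x : Fin n → ℤ × L) (j : Fin n) (w : ℤ × L) :
    Function.update x j w ∘ σ.symm = Function.update (x ∘ σ.symm) (σ j) w := by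
  funext q
  simp [Function.update_apply, Equiv.symm_apply_eq]

theorem neg_cyc (μ : Op L L' n r) (c : List (Fin n)) : (-μ).cyc c = -μ.cyc c :=
  funext fun _ => smul_neg _ _

theorem neg_circ (μ : Op L L' m r) (i : Fin m) (ν : Op L L n s) : (-μ).circ i ν = -μ.circ i ν :=
  funext fun _ => smul_neg _ _

theorem cyc_apply (μ : Op L L' n r) (c : List (Fin n)) {x y : Fin n → ℤ × L}
    (ht : (∏ i, ∏ j, if i < j ∧ c.formPerm j < c.formPerm i then ((x i).1 * (x j).1).negOnePow
      else 1) = t.negOnePow) (hy : ∀ j, x (c.formPerm.symm j) = y j) :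
    μ.cyc c x = t.negOnePow • μ y :=
  congrArg₂ (fun (u : ℤˣ) v => u • μ v) ht (funext hy)

theorem perm_of_degree_zero (μ : Op L L' n r) (σ : Equiv.Perm (Fin n)) {x y : Fin n → L}
    (hy : ∀ j, x (σ.symm j) = y j) :
    μ.perm σ (fun j => (0, x j)) = μ fun j => (0, y j) := by
  simp [perm, hy]

section eval

variable (x0 x1 x2 x3 x4 : ℤ × L)

@[simp] theorem cyc_two_zero_one (μ : Op L L' 2 r) : μ.cyc [0, 1] ![x0, x1] =
    (x0.1 * x1.1).negOnePow • μ ![x1, x0] :=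
  cyc_apply μ _ (by simp +decide [Fin.prod_univ_two]) (by intro j; fin_cases j <;> rfl)

@[simp] theorem cyc_three_zero_one (μ : Op L L' 3 r) : μ.cyc [0, 1] ![x0, x1, x2] =
    (x0.1 * x1.1).negOnePow • μ ![x1, x0, x2] :=
  cyc_apply μ _ (by simp +decide [Fin.prod_univ_three]) (by intro j; fin_cases j <;> rfl)

@[simp] theorem cyc_three_one_two (μ : Op L L' 3 r) : μ.cyc [1, 2] ![x0, x1, x2] =
    (x1.1 * x2.1).negOnePow • μ ![x0, x2, x1] :=
  cyc_apply μ _ (by simp +decide [Fin.prod_univ_three]) (by intro j; fin_cases j <;> rfl)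

@[simp] theorem cyc_three_zero_one_two (μ : Op L L' 3 r) : μ.cyc [0, 1, 2] ![x0, x1, x2] =
    (x0.1 * x2.1 + x1.1 * x2.1).negOnePow • μ ![x2, x0, x1] :=
  cyc_apply μ _ (by simp +decide [Fin.prod_univ_three, Int.negOnePow_add])
    (by intro j; fin_cases j <;> rfl)

@[simp] theorem cyc_three_zero_two_one (μ : Op L L' 3 r) : μ.cyc [0, 2, 1] ![x0, x1, x2] =
    (x0.1 * x1.1 + x0.1 * x2.1).negOnePow • μ ![x1, x2, x0] :=
  cyc_apply μ _ (by simp +decide [Fin.prod_univ_three, Int.negOnePow_add])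
    (by intro j; fin_cases j <;> rfl)

@[simp] theorem cyc_four_zero_one (μ : Op L L' 4 r) : μ.cyc [0, 1] ![x0, x1, x2, x3] =
    (x0.1 * x1.1).negOnePow • μ ![x1, x0, x2, x3] :=
  cyc_apply μ _ (by simp +decide [Fin.prod_univ_four]) (by intro j; fin_cases j <;> rfl)

@[simp] theorem cyc_four_one_two (μ : Op L L' 4 r) : μ.cyc [1, 2] ![x0, x1, x2, x3] =
    (x1.1 * x2.1).negOnePow • μ ![x0, x2, x1, x3] :=
  cyc_apply μ _ (by simp +decide [Fin.prod_univ_four]) (by intro j; fin_cases j <;> rfl)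

@[simp] theorem cyc_four_two_three (μ : Op L L' 4 r) : μ.cyc [2, 3] ![x0, x1, x2, x3] =
    (x2.1 * x3.1).negOnePow • μ ![x0, x1, x3, x2] :=
  cyc_apply μ _ (by simp +decide [Fin.prod_univ_four]) (by intro j; fin_cases j <;> rfl)

@[simp] theorem cyc_four_zero_one_two (μ : Op L L' 4 r) : μ.cyc [0, 1, 2] ![x0, x1, x2, x3] =
    (x0.1 * x2.1 + x1.1 * x2.1).negOnePow • μ ![x2, x0, x1, x3] :=
  cyc_apply μ _ (by simp +decide [Fin.prod_univ_four, Int.negOnePow_add])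
    (by intro j; fin_cases j <;> rfl)

@[simp] theorem cyc_four_zero_two_one (μ : Op L L' 4 r) : μ.cyc [0, 2, 1] ![x0, x1, x2, x3] =
    (x0.1 * x1.1 + x0.1 * x2.1).negOnePow • μ ![x1, x2, x0, x3] :=
  cyc_apply μ _ (by simp +decide [Fin.prod_univ_four, Int.negOnePow_add])
    (by intro j; fin_cases j <;> rfl)

@[simp] theorem cyc_four_zero_two (μ : Op L L' 4 r) : μ.cyc [0, 2] ![x0, x1, x2, x3] =
    (x0.1 * x1.1 + x0.1 * x2.1 + x1.1 * x2.1).negOnePow • μ ![x2, x1, x0, x3] :=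
  cyc_apply μ _ (by simp +decide [Fin.prod_univ_four, Int.negOnePow_add, mul_assoc])
    (by intro j; fin_cases j <;> rfl)

section degree_zero

variable (μ : Op L L' 5 r) (x0 x1 x2 x3 x4 : L)

theorem perm_five_apply (σ : Equiv.Perm (Fin 5)) {y0 y1 y2 y3 y4 : L}
    (h : ∀ j, ![x0, x1, x2, x3, x4] (σ.symm j) = ![y0, y1, y2, y3, y4] j) :
    μ.perm σ ![(0, x0), (0, x1), (0, x2), (0, x3), (0, x4)] =
      μ ![(0, y0), (0, y1), (0, y2), (0, y3), (0, y4)] := by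
  convert μ.perm_of_degree_zero σ h using 2 <;> (funext j; fin_cases j <;> rfl)

@[simp] theorem cyc_five_zero_one :
    μ.cyc [0, 1] ![(0, x0), (0, x1), (0, x2), (0, x3), (0, x4)] =
      μ ![(0, x1), (0, x0), (0, x2), (0, x3), (0, x4)] :=
  perm_five_apply μ _ _ _ _ _ _ (by intro j; fin_cases j <;> rfl)

@[simp] theorem cyc_five_zero_one_two :
    μ.cyc [0, 1, 2] ![(0, x0), (0, x1), (0, x2), (0, x3), (0, x4)] =
      μ ![(0, x2), (0, x0), (0, x1), (0, x3), (0, x4)] :=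
  perm_five_apply μ _ _ _ _ _ _ (by intro j; fin_cases j <;> rfl)

@[simp] theorem cyc_five_zero_one_two_three :
    μ.cyc [0, 1, 2, 3] ![(0, x0), (0, x1), (0, x2), (0, x3), (0, x4)] =
      μ ![(0, x3), (0, x0), (0, x1), (0, x2), (0, x4)] :=
  perm_five_apply μ _ _ _ _ _ _ (by intro j; fin_cases j <;> rfl)

@[simp] theorem cyc_five_one_two :
    μ.cyc [1, 2] ![(0, x0), (0, x1), (0, x2), (0, x3), (0, x4)] =
      μ ![(0, x0), (0, x2), (0, x1), (0, x3), (0, x4)] :=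
  perm_five_apply μ _ _ _ _ _ _ (by intro j; fin_cases j <;> rfl)

@[simp] theorem cyc_five_zero_two_one :
    μ.cyc [0, 2, 1] ![(0, x0), (0, x1), (0, x2), (0, x3), (0, x4)] =
      μ ![(0, x1), (0, x2), (0, x0), (0, x3), (0, x4)] :=
  perm_five_apply μ _ _ _ _ _ _ (by intro j; fin_cases j <;> rfl)

@[simp] theorem cyc_five_one_two_three :
    μ.cyc [1, 2, 3] ![(0, x0), (0, x1), (0, x2), (0, x3), (0, x4)] =
      μ ![(0, x0), (0, x3), (0, x1), (0, x2), (0, x4)] :=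
  perm_five_apply μ _ _ _ _ _ _ (by intro j; fin_cases j <;> rfl)

@[simp] theorem cyc_five_zero_two_three_one :
    μ.cyc [0, 2, 3, 1] ![(0, x0), (0, x1), (0, x2), (0, x3), (0, x4)] =
      μ ![(0, x1), (0, x3), (0, x0), (0, x2), (0, x4)] :=
  perm_five_apply μ _ _ _ _ _ _ (by intro j; fin_cases j <;> rfl)

@[simp] theorem cyc_five_two_three :
    μ.cyc [2, 3] ![(0, x0), (0, x1), (0, x2), (0, x3), (0, x4)] =
      μ ![(0, x0), (0, x1), (0, x3), (0, x2), (0, x4)] :=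
  perm_five_apply μ _ _ _ _ _ _ (by intro j; fin_cases j <;> rfl)

@[simp] theorem cyc_five_one_three_two :
    μ.cyc [1, 3, 2] ![(0, x0), (0, x1), (0, x2), (0, x3), (0, x4)] =
      μ ![(0, x0), (0, x2), (0, x3), (0, x1), (0, x4)] :=
  perm_five_apply μ _ _ _ _ _ _ (by intro j; fin_cases j <;> rfl)

@[simp] theorem cyc_five_zero_three_two_one :
    μ.cyc [0, 3, 2, 1] ![(0, x0), (0, x1), (0, x2), (0, x3), (0, x4)] =
      μ ![(0, x1), (0, x2), (0, x3), (0, x0), (0, x4)] :=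
  perm_five_apply μ _ _ _ _ _ _ (by intro j; fin_cases j <;> rfl)

@[simp] theorem perm_five_swap_mul_swap :
    μ.perm (Equiv.swap 0 2 * Equiv.swap 1 3) ![(0, x0), (0, x1), (0, x2), (0, x3), (0, x4)] =
      μ ![(0, x2), (0, x3), (0, x0), (0, x1), (0, x4)] :=
  perm_five_apply μ _ _ _ _ _ _ (by intro j; fin_cases j <;> rfl)

end degree_zero

theorem circ_eq (μ : Op L L' m r) (i : Fin m) (ν : Op L L n s)
    {x : Fin (m + n - 1) → ℤ × L} (w : Fin i → ℤ × L) (y : Fin n → ℤ × L) {z : Fin m → ℤ × L}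
    (h : (∀ j : Fin i, x ⟨j, by omega⟩ = w j) ∧ (∀ l : Fin n, x ⟨i + l, by omega⟩ = y l) ∧
      ∀ j : Fin m, (if _ : j < i then x ⟨j, by omega⟩ else
        if _ : j = i then (totalDeg y + s, ν y) else x ⟨j + n - 1, by omega⟩) = z j) :
    μ.circ i ν x = (s * totalDeg w).negOnePow • μ z := by
  obtain ⟨hw, hy, hz⟩ := h
  obtain rfl := funext hw
  obtain rfl := funext hy
  obtain rfl := funext hz
  rfl

theorem circ_zero_eq [NeZero m] (μ : Op L L' m r) (ν : Op L L n s)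
    {x : Fin (m + n - 1) → ℤ × L} (y : Fin n → ℤ × L) {z : Fin m → ℤ × L}
    (h : (∀ l : Fin n, x ⟨l, by have := NeZero.pos m; omega⟩ = y l) ∧
      ∀ j : Fin m, (if _ : j = 0 then (totalDeg y + s, ν y) else x ⟨j + n - 1, by omega⟩) = z j) :
    μ.circ 0 ν x = μ z := by
  obtain ⟨hy, hz⟩ := h
  refine (circ_eq μ 0 ν (fun j => x ⟨j, by omega⟩) y (z := z) ⟨fun _ => rfl, fun l => ?_,
    fun j => ?_⟩).trans ?_
  · simp [← hy]
  · simp [← hz]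
  · have : IsEmpty (Fin ((0 : Fin m) : ℕ)) := ⟨fun j => by simpa using j.2⟩
    rw [totalDeg, Fintype.sum_empty, mul_zero, Int.negOnePow_zero, one_smul]

@[simp] theorem circ_two_zero_two (μ : Op L L' 2 r) (ν : Op L L 2 s) :
    μ.circ 0 ν ![x0, x1, x2] =
      μ ![(totalDeg ![x0, x1] + s, ν ![x0, x1]), x2] :=
  circ_zero_eq μ ν ![x0, x1] (by refine ⟨?_, ?_⟩ <;> (intro j; fin_cases j <;> rfl))

@[simp] theorem circ_two_one_two (μ : Op L L' 2 r) (ν : Op L L 2 s) :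
    μ.circ 1 ν ![x0, x1, x2] =
      (s * totalDeg ![x0]).negOnePow • μ ![x0, (totalDeg ![x1, x2] + s, ν ![x1, x2])] :=
  circ_eq μ 1 ν ![x0] ![x1, x2]
    (by refine ⟨?_, ?_, ?_⟩ <;> (intro j; fin_cases j <;> rfl))

@[simp] theorem circ_two_zero_three (μ : Op L L' 2 r) (ν : Op L L 3 s) :
    μ.circ 0 ν ![x0, x1, x2, x3] =
      μ ![(totalDeg ![x0, x1, x2] + s, ν ![x0, x1, x2]), x3] :=
  circ_zero_eq μ ν ![x0, x1, x2] (by refine ⟨?_, ?_⟩ <;> (intro j; fin_cases j <;> rfl))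

@[simp] theorem circ_two_one_three (μ : Op L L' 2 r) (ν : Op L L 3 s) :
    μ.circ 1 ν ![x0, x1, x2, x3] =
      (s * totalDeg ![x0]).negOnePow • μ ![x0, (totalDeg ![x1, x2, x3] + s, ν ![x1, x2, x3])] :=
  circ_eq μ 1 ν ![x0] ![x1, x2, x3]
    (by refine ⟨?_, ?_, ?_⟩ <;> (intro j; fin_cases j <;> rfl))

@[simp] theorem circ_three_zero_two (μ : Op L L' 3 r) (ν : Op L L 2 s) :
    μ.circ 0 ν ![x0, x1, x2, x3] =
      μ ![(totalDeg ![x0, x1] + s, ν ![x0, x1]), x2, x3] :=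
  circ_zero_eq μ ν ![x0, x1] (by refine ⟨?_, ?_⟩ <;> (intro j; fin_cases j <;> rfl))

@[simp] theorem circ_three_one_two (μ : Op L L' 3 r) (ν : Op L L 2 s) :
    μ.circ 1 ν ![x0, x1, x2, x3] =
      (s * totalDeg ![x0]).negOnePow • μ ![x0, (totalDeg ![x1, x2] + s, ν ![x1, x2]), x3] :=
  circ_eq μ 1 ν ![x0] ![x1, x2]
    (by refine ⟨?_, ?_, ?_⟩ <;> (intro j; fin_cases j <;> rfl))

@[simp] theorem circ_three_two_two (μ : Op L L' 3 r) (ν : Op L L 2 s) :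
    μ.circ 2 ν ![x0, x1, x2, x3] =
      (s * totalDeg ![x0, x1]).negOnePow • μ ![x0, x1, (totalDeg ![x2, x3] + s, ν ![x2, x3])] :=
  circ_eq μ 2 ν ![x0, x1] ![x2, x3]
    (by refine ⟨?_, ?_, ?_⟩ <;> (intro j; fin_cases j <;> rfl))

@[simp] theorem circ_two_zero_four (μ : Op L L' 2 r) (ν : Op L L 4 s) :
    μ.circ 0 ν ![x0, x1, x2, x3, x4] =
      μ ![(totalDeg ![x0, x1, x2, x3] + s, ν ![x0, x1, x2, x3]), x4] :=
  circ_zero_eq μ ν ![x0, x1, x2, x3] (by refine ⟨?_, ?_⟩ <;> (intro j; fin_cases j <;> rfl))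

@[simp] theorem circ_two_one_four (μ : Op L L' 2 r) (ν : Op L L 4 s) :
    μ.circ 1 ν ![x0, x1, x2, x3, x4] =
      (s * totalDeg ![x0]).negOnePow •
        μ ![x0, (totalDeg ![x1, x2, x3, x4] + s, ν ![x1, x2, x3, x4])] :=
  circ_eq μ 1 ν ![x0] ![x1, x2, x3, x4]
    (by refine ⟨?_, ?_, ?_⟩ <;> (intro j; fin_cases j <;> rfl))

@[simp] theorem circ_three_zero_three (μ : Op L L' 3 r) (ν : Op L L 3 s) :
    μ.circ 0 ν ![x0, x1, x2, x3, x4] =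
      μ ![(totalDeg ![x0, x1, x2] + s, ν ![x0, x1, x2]), x3, x4] :=
  circ_zero_eq μ ν ![x0, x1, x2] (by refine ⟨?_, ?_⟩ <;> (intro j; fin_cases j <;> rfl))

@[simp] theorem circ_three_one_three (μ : Op L L' 3 r) (ν : Op L L 3 s) :
    μ.circ 1 ν ![x0, x1, x2, x3, x4] =
      (s * totalDeg ![x0]).negOnePow • μ ![x0, (totalDeg ![x1, x2, x3] + s, ν ![x1, x2, x3]), x4] :=
  circ_eq μ 1 ν ![x0] ![x1, x2, x3]
    (by refine ⟨?_, ?_, ?_⟩ <;> (intro j; fin_cases j <;> rfl))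

@[simp] theorem circ_three_two_three (μ : Op L L' 3 r) (ν : Op L L 3 s) :
    μ.circ 2 ν ![x0, x1, x2, x3, x4] =
      (s * totalDeg ![x0, x1]).negOnePow •
        μ ![x0, x1, (totalDeg ![x2, x3, x4] + s, ν ![x2, x3, x4])] :=
  circ_eq μ 2 ν ![x0, x1] ![x2, x3, x4]
    (by refine ⟨?_, ?_, ?_⟩ <;> (intro j; fin_cases j <;> rfl))

@[simp] theorem circ_four_zero_two (μ : Op L L' 4 r) (ν : Op L L 2 s) :
    μ.circ 0 ν ![x0, x1, x2, x3, x4] =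
      μ ![(totalDeg ![x0, x1] + s, ν ![x0, x1]), x2, x3, x4] :=
  circ_zero_eq μ ν ![x0, x1] (by refine ⟨?_, ?_⟩ <;> (intro j; fin_cases j <;> rfl))

@[simp] theorem circ_four_one_two (μ : Op L L' 4 r) (ν : Op L L 2 s) :
    μ.circ 1 ν ![x0, x1, x2, x3, x4] =
      (s * totalDeg ![x0]).negOnePow • μ ![x0, (totalDeg ![x1, x2] + s, ν ![x1, x2]), x3, x4] :=
  circ_eq μ 1 ν ![x0] ![x1, x2]
    (by refine ⟨?_, ?_, ?_⟩ <;> (intro j; fin_cases j <;> rfl))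

@[simp] theorem circ_four_two_two (μ : Op L L' 4 r) (ν : Op L L 2 s) :
    μ.circ 2 ν ![x0, x1, x2, x3, x4] =
      (s * totalDeg ![x0, x1]).negOnePow • μ ![x0, x1, (totalDeg ![x2, x3] + s, ν ![x2, x3]), x4] :=
  circ_eq μ 2 ν ![x0, x1] ![x2, x3]
    (by refine ⟨?_, ?_, ?_⟩ <;> (intro j; fin_cases j <;> rfl))

@[simp] theorem circ_four_three_two (μ : Op L L' 4 r) (ν : Op L L 2 s) :
    μ.circ 3 ν ![x0, x1, x2, x3, x4] =
      (s * totalDeg ![x0, x1, x2]).negOnePow •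
        μ ![x0, x1, x2, (totalDeg ![x3, x4] + s, ν ![x3, x4])] :=
  circ_eq μ 3 ν ![x0, x1, x2] ![x3, x4]
    (by refine ⟨?_, ?_, ?_⟩ <;> (intro j; fin_cases j <;> rfl))

omit [AddCommGroup L'] in
theorem comp2_apply {L'' : Type*} [AddCommGroup L''] {s' : ℤ} (μ : Op L' L'' 2 r)
    (ν : Op L L' m s) (ν' : Op L L' n s')
    {x : Fin (m + n) → ℤ × L} {y : Fin m → ℤ × L} {y' : Fin n → ℤ × L}
    (h : (∀ l : Fin m, x ⟨l, by omega⟩ = y l) ∧ ∀ l : Fin n, x ⟨m + l, by omega⟩ = y' l) :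
    μ.comp2 ν ν' x = (s' * totalDeg y).negOnePow •
      μ ![(totalDeg y + s, ν y), (totalDeg y' + s', ν' y')] := by
  obtain rfl := funext h.1
  obtain rfl := funext h.2
  rfl

omit [AddCommGroup L'] in
@[simp] theorem comp2_two_two {L'' : Type*} [AddCommGroup L''] {s' : ℤ} (μ : Op L' L'' 2 r)
    (ν : Op L L' 2 s) (ν' : Op L L' 2 s') :
    μ.comp2 ν ν' ![x0, x1, x2, x3] = (s' * totalDeg ![x0, x1]).negOnePow •
      μ ![(totalDeg ![x0, x1] + s, ν ![x0, x1]), (totalDeg ![x2, x3] + s', ν' ![x2, x3])] :=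
  comp2_apply μ ν ν' (by refine ⟨?_, ?_⟩ <;> (intro j; fin_cases j <;> rfl))

end eval

theorem comp2_two_two_eq_circ (μ : Op L L' 2 r) (ν : Op L L 2 s) :
    μ.comp2 ν ν = (μ.circ 0 ν).circ 2 ν := by
  funext x
  obtain ⟨a, b, c, d, rfl⟩ := exists_eq_vec_four x
  simp

/-- The signed sum of the insertions of `ν` into `μ` in the Leibniz identity for `∂λ₃`. Its degree
`t` is free, because `r + s` rarely reduces to the degree at hand. -/
def insert22 (μ : Op L L' 2 r) (ν : Op L L 2 s) : Op L L' 3 t := fun x =>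
  μ.circ 1 ν x - μ.circ 0 ν x - (μ.circ 1 ν).cyc [0, 1] x

/-- The signed sum of the insertions of a ternary `ν` into a binary `μ` in the Leibniz identity
for `∂λ₄`. -/
def insert23 (μ : Op L L' 2 r) (ν : Op L L 3 s) : Op L L' 4 t := fun x =>
  μ.circ 0 ν x + μ.circ 1 ν x - (μ.circ 1 ν).cyc [0, 1] x + (μ.circ 1 ν).cyc [0, 1, 2] x

/-- The signed sum of the insertions of a binary `ν` into a ternary `μ` in the Leibniz identity
for `∂λ₄`. -/
def insert32 (μ : Op L L' 3 r) (ν : Op L L 2 s) : Op L L' 4 t := fun x =>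
  - μ.circ 0 ν x + μ.circ 1 ν x - (μ.circ 1 ν).cyc [0, 1] x
    - μ.circ 2 ν x + (μ.circ 2 ν).cyc [1, 2] x - (μ.circ 2 ν).cyc [0, 2, 1] x

/-- The signed sum of the insertions of a quaternary `ν` into a binary `μ` in the Leibniz identity
in arity `5`. -/
def insert24 (μ : Op L L' 2 r) (ν : Op L L 4 s) : Op L L' 5 t := fun x =>
  μ.circ 0 ν x - μ.circ 1 ν x + (μ.circ 1 ν).cyc [0, 1] x
    - (μ.circ 1 ν).cyc [0, 1, 2] x + (μ.circ 1 ν).cyc [0, 1, 2, 3] x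

/-- The signed sum of the insertions of a ternary `ν` into a ternary `μ` in the Leibniz identity
in arity `5`. -/
def insert33 (μ : Op L L' 3 r) (ν : Op L L 3 s) : Op L L' 5 t := fun x =>
  μ.circ 0 ν x + μ.circ 1 ν x - (μ.circ 1 ν).cyc [0, 1] x
    + (μ.circ 1 ν).cyc [0, 1, 2] x + μ.circ 2 ν x
    - (μ.circ 2 ν).cyc [1, 2] x + (μ.circ 2 ν).cyc [0, 2, 1] x
    + (μ.circ 2 ν).cyc [1, 2, 3] x - (μ.circ 2 ν).cyc [0, 2, 3, 1] x
    + (μ.circ 2 ν).perm (Equiv.swap 0 2 * Equiv.swap 1 3) x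

/-- The signed sum of the insertions of a binary `ν` into a quaternary `μ` in the Leibniz identity
in arity `5`. -/
def insert42 (μ : Op L L' 4 r) (ν : Op L L 2 s) : Op L L' 5 t := fun x =>
  μ.circ 0 ν x - μ.circ 1 ν x + (μ.circ 1 ν).cyc [0, 1] x
    + μ.circ 2 ν x - (μ.circ 2 ν).cyc [1, 2] x
    + (μ.circ 2 ν).cyc [0, 2, 1] x - μ.circ 3 ν x
    + (μ.circ 3 ν).cyc [2, 3] x - (μ.circ 3 ν).cyc [1, 3, 2] x
    + (μ.circ 3 ν).cyc [0, 3, 2, 1] x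

end Op

section

variable {k : Type*} [CommRing k] {L L' : Type*} [AddCommGroup L] [Module k L]
  [AddCommGroup L'] [Module k L'] {C : ThreeTermComplex k L} {C' : ThreeTermComplex k L'}

variable (k) in
/-- Linearity of `μ` in every argument, the degrees attached to the arguments being fixed. The
Koszul signs make most operations depend on these degrees. -/
structure Op.IsMultilinear {n : ℕ} {r : ℤ} (μ : Op L L' n r) : Prop where
  map_update_add : ∀ x j a (u v : L), μ (Function.update x j (a, u + v)) =
    μ (Function.update x j (a, u)) + μ (Function.update x j (a, v))
  map_update_smul : ∀ x j a (c : k) (v : L), μ (Function.update x j (a, c • v)) =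
    c • μ (Function.update x j (a, v))

namespace Op.IsMultilinear

variable {L'' : Type*} [AddCommGroup L''] [Module k L''] {m n : ℕ} {r s : ℤ} {μ ν : Op L L' n r}

/-- `μ` as a linear map of its `j`-th argument, taken in degree `a`. -/
def toLinearMap (hμ : μ.IsMultilinear k) (x : Fin n → ℤ × L) (j : Fin n) (a : ℤ) : L →ₗ[k] L' where
  toFun v := μ (Function.update x j (a, v))
  map_add' := hμ.map_update_add x j a
  map_smul' := hμ.map_update_smul x j a

theorem toLinearMap_apply (hμ : μ.IsMultilinear k) (x : Fin n → ℤ × L) (j : Fin n) (a : ℤ)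
    (v : L) : hμ.toLinearMap x j a v = μ (Function.update x j (a, v)) := rfl

theorem map_eq_zero (hμ : μ.IsMultilinear k) {x : Fin n → ℤ × L} {j : Fin n} (hj : (x j).2 = 0) :
    μ x = 0 := by
  rw [← Function.update_eq_self j x, ← Prod.mk.eta (p := x j), hj]
  exact (hμ.toLinearMap x j (x j).1).map_zero

theorem map_outerArgs {μ : Op L L' m r} (hμ : μ.IsMultilinear k) (i : Fin m)
    (x : Fin (m + n - 1) → ℤ × L) (w : ℤ × L) (a : ℤ) (v : L) :
    μ (outerArgs i x (a, v)) = hμ.toLinearMap (outerArgs i x w) i a v := by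
  rw [toLinearMap_apply, update_outerArgs_self]

protected theorem circ {μ : Op L L' m r} {ν : Op L L n s} (hμ : μ.IsMultilinear k)
    (hν : ν.IsMultilinear k) (i : Fin m) : (μ.circ i ν).IsMultilinear k := by
  constructor <;> intro x p a <;> obtain ⟨j, rfl⟩ | ⟨l, rfl⟩ := exists_pos i p
  · intro u v
    rw [circ_update_outerPos _ _ _ _ (0, 0), circ_update_outerPos _ _ _ _ (0, 0),
      circ_update_outerPos _ _ _ _ (0, 0)]
    simp only [degBefore_update, hμ.map_update_add, smul_add]
  · intro u v
    rw [circ_update_innerPos _ _ _ _ (0, 0), circ_update_innerPos _ _ _ _ (0, 0),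
      circ_update_innerPos _ _ _ _ (0, 0)]
    simp only [totalDeg_update, hν.map_update_add, hμ.map_outerArgs i x (0, 0), map_add, smul_add]
  · intro c v
    rw [circ_update_outerPos _ _ _ _ (0, 0), circ_update_outerPos _ _ _ _ (0, 0),
      degBefore_update, degBefore_update, hμ.map_update_smul, smul_comm]
  · intro c v
    rw [circ_update_innerPos _ _ _ _ (0, 0), circ_update_innerPos _ _ _ _ (0, 0), smul_comm]
    simp only [totalDeg_update, hν.map_update_smul, hμ.map_outerArgs i x (0, 0), map_smul]

protected theorem add (hμ : μ.IsMultilinear k) (hν : ν.IsMultilinear k) :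
    (μ + ν).IsMultilinear k where
  map_update_add x j a u v := by
    simp only [add_apply, hμ.map_update_add, hν.map_update_add, add_add_add_comm]
  map_update_smul x j a c v := by
    simp only [add_apply, hμ.map_update_smul, hν.map_update_smul, smul_add]

protected theorem sub (hμ : μ.IsMultilinear k) (hν : ν.IsMultilinear k) :
    (μ - ν).IsMultilinear k where
  map_update_add x j a u v := by
    simp only [sub_apply, hμ.map_update_add, hν.map_update_add, add_sub_add_comm]
  map_update_smul x j a c v := by
    simp only [sub_apply, hμ.map_update_smul, hν.map_update_smul, smul_sub]

protected theorem post (hμ : μ.IsMultilinear k) (g : L' →ₗ[k] L'') (s : ℤ) :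
    (μ.post s g).IsMultilinear k where
  map_update_add x j a u v := by simp only [post, hμ.map_update_add, map_add]
  map_update_smul x j a c v := by simp only [post, hμ.map_update_smul, map_smul]

protected theorem perm (hμ : μ.IsMultilinear k) (σ : Equiv.Perm (Fin n)) :
    (μ.perm σ).IsMultilinear k where
  map_update_add x j a u v := by
    simp only [perm_apply, koszul_update, update_comp_symm, hμ.map_update_add, smul_add]
  map_update_smul x j a c v := by
    simp only [perm_apply, koszul_update, update_comp_symm, hμ.map_update_smul, smul_comm _ c]

theorem lin2 (r : ℤ) (f : L →ₗ[k] L →ₗ[k] L') : (Op.lin2 r f).IsMultilinear k := by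
  constructor <;> intro x j <;> fin_cases j <;> simp [Op.lin2]

theorem lin3 (r : ℤ) (f : L →ₗ[k] L →ₗ[k] L →ₗ[k] L') : (Op.lin3 r f).IsMultilinear k := by
  constructor <;> intro x j <;> fin_cases j <;> simp [Op.lin3]

theorem lin4 (r : ℤ) (f : L →ₗ[k] L →ₗ[k] L →ₗ[k] L →ₗ[k] L') :
    (Op.lin4 r f).IsMultilinear k := by
  constructor <;> intro x j <;> fin_cases j <;> simp [Op.lin4]

theorem circ_neg {μ : Op L L' m r} (hμ : μ.IsMultilinear k) (i : Fin m) (ν : Op L L n s) :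
    μ.circ i (-ν) = -μ.circ i ν := by
  funext x
  rw [neg_apply, circ_apply _ _ _ _ (0, 0), circ_apply _ _ _ _ (0, 0), neg_apply,
    hμ.map_outerArgs i x (0, 0), hμ.map_outerArgs i x (0, 0), map_neg, smul_neg]

end Op.IsMultilinear

namespace ThreeTermComplex

variable {m n : ℕ} {r s t r' s' : ℤ}

theorem bdry_apply (μ : Op L L' n r) (x : Fin n → ℤ × L) :
    C.bdry C' μ x = C'.d (μ x) - r.negOnePow • ∑ j, (Op.degBefore x j).negOnePow •
      μ (Function.update x j ((x j).1 - 1, C.d (x j).2)) := by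
  simp only [bdry, Op.sum_fin_eq_degBefore]

open Op in
theorem bdry_circ {μ : Op L L' m r} (hμ : μ.IsMultilinear k) (i : Fin m) (ν : Op L L n s)
    (x : Fin (m + n - 1) → ℤ × L) :
    C.bdry C' (μ.circ i ν) x =
      (C.bdry C' μ).circ i ν x + r.negOnePow • μ.circ i (C.bdry C ν) x := by
  set y : Fin n → ℤ × L := innerArgs i x
  set z := outerArgs i x (totalDeg y + s, ν y) with hz
  set D := degBefore z i
  set F := hμ.toLinearMap z i (totalDeg y + (s - 1))
  have hF (v : L) : μ (outerArgs i x (totalDeg y + (s - 1), v)) = F v :=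
    hμ.map_outerArgs i x _ _ v
  have value : μ.circ i ν x = (s * D).negOnePow • μ z := circ_apply ..
  have left : (C.bdry C' μ).circ i ν x = (s * D).negOnePow • C.bdry C' μ z := circ_apply ..
  have right : μ.circ i (C.bdry C ν) x = (s * D + D).negOnePow • F (C.bdry C ν y) := by
    rw [← hF, show (s * D + D).negOnePow = ((s - 1) * D).negOnePow from
      (Int.negOnePow_eq_iff _ _).2 ⟨D, by ring⟩]
    exact circ_apply ..
  have self : μ (Function.update z i ((z i).1 - 1, C.d (z i).2)) = F (C.d (ν y)) := by
    rw [← hF, hz, update_outerArgs_self, outerArgs_self, add_sub_assoc]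
  have inner (l : Fin n) : (degBefore x (innerPos i l)).negOnePow •
      μ.circ i ν (Function.update x (innerPos i l)
        ((x (innerPos i l)).1 - 1, C.d (x (innerPos i l)).2)) =
      (s * D).negOnePow • D.negOnePow • (degBefore y l).negOnePow •
        F (ν (Function.update y l ((y l).1 - 1, C.d (y l).2))) := by
    rw [← hF, ← mul_smul, ← Int.negOnePow_add]
    exact degBefore_smul_circ_update_innerPos μ i ν x (totalDeg y + s, ν y) l _
  have outer (j : {j // j ≠ i}) : s.negOnePow • (degBefore x (outerPos n i j)).negOnePow •
      μ.circ i ν (Function.update x (outerPos n i j)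
        ((x (outerPos n i j)).1 - 1, C.d (x (outerPos n i j)).2)) =
      (s * D).negOnePow • (degBefore z j).negOnePow •
        μ (Function.update z j ((z j).1 - 1, C.d (z j).2)) := by
    rw [show z j = x (outerPos n i j) from outerArgs_coe ..,
      smul_degBefore_smul_circ_update_outerPos μ i ν x j _ hz,
      show z j = x (outerPos n i j) from outerArgs_coe ..]
  rw [left, right, bdry_apply, bdry_apply, bdry_apply, sum_pos i, value,
    Fintype.sum_eq_add_sum_subtype_ne _ i, self]
  simp only [map_sub, map_sum, LinearMap.map_smul_of_tower, smul_sub, smul_add, Finset.smul_sum,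
    Int.negOnePow_add, mul_smul, inner, outer]
  simp only [smul_comm r.negOnePow, smul_comm s.negOnePow D.negOnePow,
    smul_comm s.negOnePow (s * D).negOnePow]
  abel

theorem bdry_perm (μ : Op L L' n r) (σ : Equiv.Perm (Fin n)) (x) :
    C.bdry C' (μ.perm σ) x = (C.bdry C' μ).perm σ x := by
  have sum_eq : ∑ j, (Op.degBefore x j).negOnePow •
      μ.perm σ (Function.update x j ((x j).1 - 1, C.d (x j).2)) =
      ∑ j, (Op.koszul σ x).negOnePow • (Op.degBefore (x ∘ σ.symm) j).negOnePow •
        μ (Function.update (x ∘ σ.symm) j ((x (σ.symm j)).1 - 1, C.d (x (σ.symm j)).2)) :=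
    Fintype.sum_equiv σ _ _ fun j => by
      rw [Op.perm_apply, smul_smul, smul_smul, Op.negOnePow_koszul_update, Op.update_comp_symm,
        Equiv.symm_apply_apply]
  rw [bdry_apply, Op.perm_apply, Op.perm_apply, bdry_apply, sum_eq, ← Finset.smul_sum, smul_sub,
    LinearMap.map_smul_of_tower, smul_comm r.negOnePow]
  rfl

theorem isMultilinear_bdry {μ : Op L L' n r} (hμ : μ.IsMultilinear k) :
    (C.bdry C' μ).IsMultilinear k := by
  constructor <;> intro x j a <;> [intro u v; intro c v]
  · have term (i) : μ (Function.update (Function.update x j (a, u + v)) i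
        ((Function.update x j (a, u + v) i).1 - 1, C.d (Function.update x j (a, u + v) i).2)) =
      μ (Function.update (Function.update x j (a, u)) i
        ((Function.update x j (a, u) i).1 - 1, C.d (Function.update x j (a, u) i).2)) +
      μ (Function.update (Function.update x j (a, v)) i
        ((Function.update x j (a, v) i).1 - 1, C.d (Function.update x j (a, v) i).2)) := by
      obtain rfl | h := eq_or_ne i j
      · simp only [Function.update_idem, Function.update_self, map_add, hμ.map_update_add]
      · simp only [Function.update_comm h.symm, Function.update_of_ne h, hμ.map_update_add]
    simp only [bdry_apply, Op.degBefore_update, term, hμ.map_update_add, map_add,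
      smul_add, Finset.sum_add_distrib]
    abel
  · have term (i) : μ (Function.update (Function.update x j (a, c • v)) i
        ((Function.update x j (a, c • v) i).1 - 1, C.d (Function.update x j (a, c • v) i).2)) =
      c • μ (Function.update (Function.update x j (a, v)) i
        ((Function.update x j (a, v) i).1 - 1, C.d (Function.update x j (a, v) i).2)) := by
      obtain rfl | h := eq_or_ne i j
      · simp only [Function.update_idem, Function.update_self, map_smul, hμ.map_update_smul]
      · simp only [Function.update_comm h.symm, Function.update_of_ne h, hμ.map_update_smul]
    simp only [bdry_apply, Op.degBefore_update, term, hμ.map_update_smul, map_smul,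
      smul_comm _ c, ← Finset.smul_sum, smul_sub]

variable (C C') in
/-- `μ` is a multilinear operation of degree `r` on the complexes. -/
structure IsOp {n : ℕ} {r : ℤ} (μ : Op L L' n r) : Prop where
  isMultilinear : μ.IsMultilinear k
  hasDegree : C.HasDegree C' μ

theorem Homog.update {x : Fin n → ℤ × L} (hx : C.Homog x) (j : Fin n) {w : ℤ × L}
    (hw : w.2 ∈ C.gr w.1) : C.Homog (Function.update x j w) := by
  intro q
  obtain rfl | h := eq_or_ne q j
  · rwa [Function.update_self]
  · rw [Function.update_of_ne h]
    exact hx q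

theorem Homog.update_d {x : Fin n → ℤ × L} (hx : C.Homog x) (j : Fin n) :
    C.Homog (Function.update x j ((x j).1 - 1, C.d (x j).2)) :=
  hx.update j (C.d_mem _ _ (hx j))

theorem Homog.outerArgs {x : Fin (m + n - 1) → ℤ × L} (hx : C.Homog x) (i : Fin m) {w : ℤ × L}
    (hw : w.2 ∈ C.gr w.1) : C.Homog (Op.outerArgs i x w) := by
  intro j
  obtain rfl | h := eq_or_ne j i
  · rwa [Op.outerArgs_self]
  · rw [Op.outerArgs_coe i x _ ⟨j, h⟩]
    exact hx _

namespace IsOp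

variable {μ ν : Op L L' n r}

protected theorem zero : C.IsOp C' (0 : Op L L' n r) :=
  ⟨⟨by simp, by simp⟩, fun _ _ => zero_mem _⟩

protected theorem add (hμ : C.IsOp C' μ) (hν : C.IsOp C' ν) : C.IsOp C' (μ + ν) :=
  ⟨hμ.isMultilinear.add hν.isMultilinear,
    fun x hx => add_mem (hμ.hasDegree x hx) (hν.hasDegree x hx)⟩

protected theorem sub (hμ : C.IsOp C' μ) (hν : C.IsOp C' ν) : C.IsOp C' (μ - ν) :=
  ⟨hμ.isMultilinear.sub hν.isMultilinear,
    fun x hx => sub_mem (hμ.hasDegree x hx) (hν.hasDegree x hx)⟩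

protected theorem neg (hμ : C.IsOp C' μ) : C.IsOp C' (-μ) := by
  simpa using (hμ.sub hμ).sub hμ

protected theorem perm (hμ : C.IsOp C' μ) (σ : Equiv.Perm (Fin n)) : C.IsOp C' (μ.perm σ) where
  isMultilinear := hμ.isMultilinear.perm σ
  hasDegree x hx := by
    rw [Op.perm_apply]
    refine Submodule.smul_of_tower_mem _ _ ?_
    rw [show totalDeg x = totalDeg (x ∘ σ.symm) from (Equiv.sum_comp σ.symm fun j => (x j).1).symm]
    exact hμ.hasDegree _ fun j => hx (σ.symm j)

protected theorem cyc (hμ : C.IsOp C' μ) (c : List (Fin n)) : C.IsOp C' (μ.cyc c) :=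
  hμ.perm _

protected theorem circ {μ : Op L L' m r} {ν : Op L L n s} (hμ : C.IsOp C' μ) (hν : C.IsOp C ν)
    (i : Fin m) : C.IsOp C' (μ.circ i ν) where
  isMultilinear := hμ.isMultilinear.circ hν.isMultilinear i
  hasDegree x hx := by
    rw [Op.circ_apply _ _ _ _ (0, 0), add_comm r s, ← add_assoc]
    refine Submodule.smul_of_tower_mem _ _ ?_
    rw [← Op.totalDeg_outerArgs i x (ν (Op.innerArgs i x))]
    exact hμ.hasDegree _ (hx.outerArgs i (hν.hasDegree _ fun l => hx _))

protected theorem bdry (hμ : C.IsOp C' μ) : C.IsOp C' (C.bdry C' μ) where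
  isMultilinear := isMultilinear_bdry hμ.isMultilinear
  hasDegree x hx := by
    rw [bdry_apply, ← add_sub_assoc]
    refine sub_mem (C'.d_mem _ _ (hμ.hasDegree x hx)) (Submodule.smul_of_tower_mem _ _
      (sum_mem fun j _ => Submodule.smul_of_tower_mem _ _ ?_))
    rw [show totalDeg x + r - 1 = totalDeg (Function.update x j ((x j).1 - 1, C.d (x j).2)) + r by
      rw [Op.totalDeg_update]; ring]
    exact hμ.hasDegree _ (hx.update_d j)

theorem eq_zero_of_degree_neg (hμ : C.IsOp C' μ) {x : Fin n → ℤ × L} (hx : C.Homog x) {j : Fin n}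
    (hj : (x j).1 < 0) : μ x = 0 := by
  refine hμ.isMultilinear.map_eq_zero (j := j) ?_
  have h := hx j
  rwa [C.gr_eq_bot _ (.inl hj)] at h

theorem eq_zero_of_two_lt (hμ : C.IsOp C' μ) {x : Fin n → ℤ × L} (hx : C.Homog x)
    (hr : 2 < totalDeg x + r) : μ x = 0 := by
  have h := hμ.hasDegree x hx
  rwa [C'.gr_eq_bot _ (.inr hr)] at h

theorem ext_homog (hμ : C.IsOp C' μ) (hν : C.IsOp C' ν)
    (h : ∀ x, C.Homog x → (∀ j, 0 ≤ (x j).1) → totalDeg x + r ≤ 2 → μ x = ν x) (x)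
    (hx : C.Homog x) : μ x = ν x := by
  by_cases hneg : ∃ j, (x j).1 < 0
  · obtain ⟨j, hj⟩ := hneg
    rw [hμ.eq_zero_of_degree_neg hx hj, hν.eq_zero_of_degree_neg hx hj]
  · push Not at hneg
    obtain hr | hr := le_or_gt (totalDeg x + r) 2
    · exact h x hx hneg hr
    · rw [hμ.eq_zero_of_two_lt hx hr, hν.eq_zero_of_two_lt hx hr]

theorem ext_degree_zero {μ ν : Op L L' n 2} (hμ : C.IsOp C' μ) (hν : C.IsOp C' ν)
    (h : ∀ x, C.Homog x → (∀ j, (x j).1 = 0) → μ x = ν x) (x) (hx : C.Homog x) : μ x = ν x := by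
  refine hμ.ext_homog hν (fun x hx hneg hdeg => h x hx fun j => ?_) x hx
  have hsum : ∑ j, (x j).1 = 0 := le_antisymm (by simpa [totalDeg] using hdeg)
    (Finset.sum_nonneg fun j _ => hneg j)
  exact (Finset.sum_eq_zero_iff_of_nonneg fun j _ => hneg j).1 hsum j (Finset.mem_univ j)

protected theorem insert23 {μ : Op L L' 2 r} {ν : Op L L 3 s} (hμ : C.IsOp C' μ)
    (hν : C.IsOp C ν) (ht : r + s = t) : C.IsOp C' (μ.insert23 ν : Op L L' 4 t) := by
  subst ht
  have h := hμ.circ hν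
  exact (((h 0).add (h 1)).sub ((h 1).cyc _)).add ((h 1).cyc _)

protected theorem insert32 {μ : Op L L' 3 r} {ν : Op L L 2 s} (hμ : C.IsOp C' μ)
    (hν : C.IsOp C ν) (ht : r + s = t) : C.IsOp C' (μ.insert32 ν : Op L L' 4 t) := by
  subst ht
  have h := hμ.circ hν
  exact (((((h 0).neg.add (h 1)).sub ((h 1).cyc _)).sub (h 2)).add ((h 2).cyc _)).sub
    ((h 2).cyc _)

protected theorem insert24 {μ : Op L L' 2 r} {ν : Op L L 4 s} (hμ : C.IsOp C' μ)
    (hν : C.IsOp C ν) (ht : r + s = t) : C.IsOp C' (μ.insert24 ν : Op L L' 5 t) := by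
  subst ht
  have h := hμ.circ hν
  exact ((((h 0).sub (h 1)).add ((h 1).cyc _)).sub ((h 1).cyc _)).add ((h 1).cyc _)

protected theorem insert33 {μ : Op L L' 3 r} {ν : Op L L 3 s} (hμ : C.IsOp C' μ)
    (hν : C.IsOp C ν) (ht : r + s = t) : C.IsOp C' (μ.insert33 ν : Op L L' 5 t) := by
  subst ht
  have h := hμ.circ hν
  exact (((((((((h 0).add (h 1)).sub ((h 1).cyc _)).add ((h 1).cyc _)).add (h 2)).sub
    ((h 2).cyc _)).add ((h 2).cyc _)).add ((h 2).cyc _)).sub ((h 2).cyc _)).add ((h 2).perm _)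

protected theorem insert42 {μ : Op L L' 4 r} {ν : Op L L 2 s} (hμ : C.IsOp C' μ)
    (hν : C.IsOp C ν) (ht : r + s = t) : C.IsOp C' (μ.insert42 ν : Op L L' 5 t) := by
  subst ht
  have h := hμ.circ hν
  exact (((((((((h 0).sub (h 1)).add ((h 1).cyc _)).add (h 2)).sub ((h 2).cyc _)).add
    ((h 2).cyc _)).sub (h 3)).add ((h 3).cyc _)).sub ((h 3).cyc _)).add ((h 3).cyc _)

end IsOp

/-- `μ` is a multilinear operation with differential `μ'`. The degree of `μ'` is kept independent
of that of `μ` because `r - 1` rarely reduces to the degree at hand. -/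
structure HasBdry (C : ThreeTermComplex k L) (C' : ThreeTermComplex k L') (μ : Op L L' n r)
    (μ' : Op L L' n r') : Prop extends C.IsOp C' μ where
  bdry_eq : ∀ x, C.Homog x → C.bdry C' μ x = μ' x

namespace HasBdry

variable {μ ν : Op L L' n r} {μ' : Op L L' n r'} {ν' : Op L L' n s'}

theorem congr {μ'' : Op L L' n s} (hμ : C.HasBdry C' μ μ')
    (h : ∀ x, C.Homog x → μ' x = μ'' x) : C.HasBdry C' μ μ'' :=
  ⟨hμ.toIsOp, fun x hx => (hμ.bdry_eq x hx).trans (h x hx)⟩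

theorem congr_left (hμ : C.HasBdry C' μ μ') (hν : C.IsOp C' ν)
    (h : ∀ x, C.Homog x → ν x = μ x) : C.HasBdry C' ν μ' where
  toIsOp := hν
  bdry_eq x hx := by
    rw [← hμ.bdry_eq x hx, bdry_apply, bdry_apply, h x hx]
    simp only [h _ (hx.update_d _)]

protected theorem add (hμ : C.HasBdry C' μ μ') (hν : C.HasBdry C' ν ν') :
    C.HasBdry C' (μ + ν) (μ' + ν'.castDeg r') where
  toIsOp := hμ.toIsOp.add hν.toIsOp
  bdry_eq x hx := by
    rw [Op.add_apply, Op.castDeg_apply, ← hμ.bdry_eq x hx, ← hν.bdry_eq x hx]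
    simp only [bdry_apply, Op.add_apply, map_add, smul_add, Finset.sum_add_distrib]
    abel

protected theorem sub (hμ : C.HasBdry C' μ μ') (hν : C.HasBdry C' ν ν') :
    C.HasBdry C' (μ - ν) (μ' - ν'.castDeg r') where
  toIsOp := hμ.toIsOp.sub hν.toIsOp
  bdry_eq x hx := by
    rw [Op.sub_apply, Op.castDeg_apply, ← hμ.bdry_eq x hx, ← hν.bdry_eq x hx]
    simp only [bdry_apply, Op.sub_apply, map_sub, smul_sub, Finset.sum_sub_distrib]
    abel

protected theorem perm (hμ : C.HasBdry C' μ μ') (σ : Equiv.Perm (Fin n)) :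
    C.HasBdry C' (μ.perm σ) (μ'.perm σ) where
  toIsOp := hμ.toIsOp.perm σ
  bdry_eq x hx := by
    rw [bdry_perm, Op.perm_apply, Op.perm_apply]
    exact congrArg _ (hμ.bdry_eq _ fun j => hx (σ.symm j))

protected theorem cyc (hμ : C.HasBdry C' μ μ') (c : List (Fin n)) :
    C.HasBdry C' (μ.cyc c) (μ'.cyc c) :=
  hμ.perm _

protected theorem circ {μ : Op L L' m r} {μ' : Op L L' m r'} {ν : Op L L n s} {ν' : Op L L n s'}
    (hμ : C.HasBdry C' μ μ') (hν : C.HasBdry C ν ν') (i : Fin m) :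
    C.HasBdry C' (μ.circ i ν) ((μ'.circ i ν).castDeg (r + s - 1) +
      r.negOnePow • (μ.circ i (ν'.castDeg (s - 1))).castDeg (r + s - 1)) where
  toIsOp := hμ.toIsOp.circ hν.toIsOp i
  bdry_eq x hx := by
    rw [bdry_circ hμ.isMultilinear]
    refine congrArg₂ (· + r.negOnePow • ·) ?_ ?_
    · rw [Op.circ_apply _ _ _ _ (0, 0), hμ.bdry_eq, ← Op.circ_apply]
      · rfl
      · exact hx.outerArgs i (hν.hasDegree _ fun l => hx _)
    · rw [Op.castDeg_apply, Op.circ_apply _ _ _ _ (0, 0), Op.circ_apply _ _ _ _ (0, 0),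
        hν.bdry_eq (Op.innerArgs i x) fun l => hx _, Op.castDeg_apply]

theorem eq_zero (hμ : C.HasBdry C' μ μ') (hr : 2 < r) (x) (hx : C.Homog x) : μ' x = 0 := by
  have h0 (y) (hy : C.Homog y) : μ y = 0 :=
    hμ.toIsOp.ext_homog .zero (fun y _ hneg hdeg => by
      have : 0 ≤ totalDeg y := Finset.sum_nonneg fun j _ => hneg j
      omega) y hy
  rw [← hμ.bdry_eq x hx, bdry_apply, h0 x hx]
  simp [h0 _ (hx.update_d _)]

theorem congr_homog {μ'' : Op L L' n (r - 1)} (hμ : C.HasBdry C' μ μ') (h'' : C.IsOp C' μ'')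
    (h : ∀ x, C.Homog x → (∀ j, 0 ≤ (x j).1) → totalDeg x + (r - 1) ≤ 2 → μ' x = μ'' x) :
    C.HasBdry C' μ μ'' :=
  ⟨hμ.toIsOp, hμ.toIsOp.bdry.ext_homog h'' fun x hx h0 h2 =>
    (hμ.bdry_eq x hx).trans (h x hx h0 h2)⟩

protected theorem neg (hμ : C.HasBdry C' μ μ') : C.HasBdry C' (-μ) (-μ') := by
  have h := (hμ.sub hμ).sub hμ
  rw [sub_self, zero_sub] at h
  exact h.congr fun x _ => by simp

protected theorem insert23 {μ : Op L L' 2 r} {μ' : Op L L' 2 r'} {ν : Op L L 3 s}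
    {ν' : Op L L 3 s'} (hμ : C.HasBdry C' μ μ') (hν : C.HasBdry C ν ν') (ht : r + s = t) :
    C.HasBdry C' (μ.insert23 ν : Op L L' 4 t)
      (μ'.insert23 ν + r.negOnePow • μ.insert23 (ν'.castDeg (s - 1)) : Op L L' 4 (t - 1)) := by
  subst ht
  have h := hμ.circ hν
  refine ((((h 0).add (h 1)).sub ((h 1).cyc _)).add ((h 1).cyc _)).congr fun x _ => ?_
  simp only [Op.insert23, Op.add_apply, Op.sub_apply, Op.smul_apply, Op.castDeg_apply, Op.cyc,
    Op.perm, smul_add, smul_sub, smul_comm r.negOnePow]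
  abel

protected theorem insert32 {μ : Op L L' 3 r} {μ' : Op L L' 3 r'} {ν : Op L L 2 s}
    {ν' : Op L L 2 s'} (hμ : C.HasBdry C' μ μ') (hν : C.HasBdry C ν ν') (ht : r + s = t) :
    C.HasBdry C' (μ.insert32 ν : Op L L' 4 t)
      (μ'.insert32 ν + r.negOnePow • μ.insert32 (ν'.castDeg (s - 1)) : Op L L' 4 (t - 1)) := by
  subst ht
  have h := hμ.circ hν
  refine ((((((h 0).neg.add (h 1)).sub ((h 1).cyc _)).sub (h 2)).add ((h 2).cyc _)).sub
    ((h 2).cyc _)).congr fun x _ => ?_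
  simp only [Op.insert32, Op.add_apply, Op.sub_apply, Op.neg_apply, Op.smul_apply,
    Op.castDeg_apply, Op.cyc, Op.perm, smul_add, smul_sub, smul_neg, smul_comm r.negOnePow]
  abel

protected theorem insert24 {μ : Op L L' 2 r} {μ' : Op L L' 2 r'} {ν : Op L L 4 s}
    {ν' : Op L L 4 s'} (hμ : C.HasBdry C' μ μ') (hν : C.HasBdry C ν ν') (ht : r + s = t) :
    C.HasBdry C' (μ.insert24 ν : Op L L' 5 t)
      (μ'.insert24 ν + r.negOnePow • μ.insert24 (ν'.castDeg (s - 1)) : Op L L' 5 (t - 1)) := by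
  subst ht
  have h := hμ.circ hν
  refine (((((h 0).sub (h 1)).add ((h 1).cyc _)).sub ((h 1).cyc _)).add
    ((h 1).cyc _)).congr fun x _ => ?_
  simp only [Op.insert24, Op.add_apply, Op.sub_apply, Op.smul_apply, Op.castDeg_apply, Op.cyc,
    Op.perm, smul_add, smul_sub, smul_comm r.negOnePow]
  abel

protected theorem insert33 {μ : Op L L' 3 r} {μ' : Op L L' 3 r'} {ν : Op L L 3 s}
    {ν' : Op L L 3 s'} (hμ : C.HasBdry C' μ μ') (hν : C.HasBdry C ν ν') (ht : r + s = t) :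
    C.HasBdry C' (μ.insert33 ν : Op L L' 5 t)
      (μ'.insert33 ν + r.negOnePow • μ.insert33 (ν'.castDeg (s - 1)) : Op L L' 5 (t - 1)) := by
  subst ht
  have h := hμ.circ hν
  refine ((((((((((h 0).add (h 1)).sub ((h 1).cyc _)).add ((h 1).cyc _)).add (h 2)).sub
    ((h 2).cyc _)).add ((h 2).cyc _)).add ((h 2).cyc _)).sub ((h 2).cyc _)).add
    ((h 2).perm _)).congr fun x _ => ?_
  simp only [Op.insert33, Op.add_apply, Op.sub_apply, Op.smul_apply, Op.castDeg_apply, Op.cyc,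
    Op.perm, smul_add, smul_sub, smul_comm r.negOnePow]
  abel

protected theorem insert42 {μ : Op L L' 4 r} {μ' : Op L L' 4 r'} {ν : Op L L 2 s}
    {ν' : Op L L 2 s'} (hμ : C.HasBdry C' μ μ') (hν : C.HasBdry C ν ν') (ht : r + s = t) :
    C.HasBdry C' (μ.insert42 ν : Op L L' 5 t)
      (μ'.insert42 ν + r.negOnePow • μ.insert42 (ν'.castDeg (s - 1)) : Op L L' 5 (t - 1)) := by
  subst ht
  have h := hμ.circ hν
  refine ((((((((((h 0).sub (h 1)).add ((h 1).cyc _)).add (h 2)).sub ((h 2).cyc _)).add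
    ((h 2).cyc _)).sub (h 3)).add ((h 3).cyc _)).sub ((h 3).cyc _)).add
    ((h 3).cyc _)).congr fun x _ => ?_
  simp only [Op.insert42, Op.add_apply, Op.sub_apply, Op.smul_apply, Op.castDeg_apply, Op.cyc,
    Op.perm, smul_add, smul_sub, smul_comm r.negOnePow]
  abel

end HasBdry

end ThreeTermComplex

namespace DeformationRetract

open ThreeTermComplex

variable (R : DeformationRetract C C') {n : ℕ} {r r' : ℤ}

/-- The operation `i p ν`. -/
def proj (ν : Op L L n r) : Op L L n r := fun x => R.i (R.p (ν x))

theorem isOp_proj {ν : Op L L n r} (hν : C.IsOp C ν) : C.IsOp C (R.proj ν) where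
  isMultilinear := by
    have h := (hν.isMultilinear.post R.p 0).post R.i 0
    exact ⟨h.map_update_add, h.map_update_smul⟩
  hasDegree x hx := R.i_mem _ _ (R.p_mem _ _ (hν.hasDegree x hx))

theorem isOp_post_h {ν : Op L L n r} (hν : C.IsOp C ν) : C.IsOp C (ν.post 1 R.h) where
  isMultilinear := hν.isMultilinear.post R.h 1
  hasDegree x hx := by
    rw [add_comm 1, ← add_assoc]
    exact R.h_mem _ _ (hν.hasDegree x hx)

theorem hasBdry_post_h {ν : Op L L n r} {ν' : Op L L n r'} (hν : C.HasBdry C ν ν') :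
    C.HasBdry C (ν.post 1 R.h) (ν - R.proj ν - (ν'.post 1 R.h).castDeg r) where
  toIsOp := R.isOp_post_h hν.toIsOp
  bdry_eq x hx := by
    have h := congrArg R.h (hν.bdry_eq x hx)
    rw [bdry_apply, map_sub, LinearMap.map_smul_of_tower, map_sum] at h
    simp only [LinearMap.map_smul_of_tower] at h
    rw [bdry_apply]
    change _ = ν x - R.i (R.p (ν x)) - R.h (ν' x)
    rw [R.homotopy, ← h, Int.negOnePow_add, Int.negOnePow_one]
    simp only [Op.post, neg_one_mul, Units.neg_smul]
    abel

end DeformationRetract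

@[simp] theorem negOnePow_two : (2 : ℤ).negOnePow = 1 := rfl

namespace Lie3Maps

variable (A : Lie3Maps k L)

@[simp] theorem o2_apply (a b : ℤ × L) : A.o2 ![a, b] = A.l2 a.2 b.2 := rfl
@[simp] theorem o3_apply (a b c : ℤ × L) : A.o3 ![a, b, c] = A.l3 a.2 b.2 c.2 := rfl
@[simp] theorem o4_apply (a b c d : ℤ × L) : A.o4 ![a, b, c, d] = A.l4 a.2 b.2 c.2 d.2 := rfl
@[simp] theorem o21_apply (a b : ℤ × L) : A.o21 ![a, b] = A.l21 a.2 b.2 := rfl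
@[simp] theorem o211_apply (a b : ℤ × L) : A.o211 ![a, b] = A.l211 a.2 b.2 := rfl
@[simp] theorem o31_apply (a b c : ℤ × L) : A.o31 ![a, b, c] = A.l31 a.2 b.2 c.2 := rfl
@[simp] theorem o32_apply (a b c : ℤ × L) : A.o32 ![a, b, c] = A.l32 a.2 b.2 c.2 := rfl

namespace IsLeibniz3

variable {A} (hA : A.IsLeibniz3 C)
include hA

theorem hasBdry_o2 : C.HasBdry C A.o2 (0 : Op L L 2 (0 - 1)) :=
  ⟨⟨.lin2 _ _, hA.deg2⟩, hA.eq2⟩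

theorem hasBdry_o3 : C.HasBdry C A.o3 (A.o2.insert22 A.o2 : Op L L 3 0) :=
  ⟨⟨.lin3 _ _, hA.deg3⟩, hA.eq3⟩

theorem hasBdry_o4 : C.HasBdry C A.o4
    (A.o2.insert23 A.o3 + A.o3.insert32 A.o2 : Op L L 4 1) where
  isMultilinear := .lin4 _ _
  hasDegree := hA.deg4
  bdry_eq x hx := by
    rw [hA.eq4 x hx, Op.add_apply, Op.insert23, Op.insert32]
    abel

end IsLeibniz3

namespace IsWeakLie3

variable {A} (hA : A.IsWeakLie3 C)
include hA

theorem hasBdry_o21 : C.HasBdry C A.o21 (A.o2 + A.o2.cyc [0, 1]) :=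
  ⟨⟨.lin2 _ _, hA.deg21⟩, hA.eq21⟩

theorem hasBdry_o211 : C.HasBdry C A.o211 (A.o21 - A.o21.cyc [0, 1]) :=
  ⟨⟨.lin2 _ _, hA.deg211⟩, hA.eq211⟩

theorem hasBdry_o31 : C.HasBdry C A.o31
    (A.o3 + A.o3.cyc [0, 1] + (A.o2.circ 0 A.o21).castDeg (n := 3) 1) :=
  ⟨⟨.lin3 _ _, hA.deg31⟩, hA.eq31⟩

theorem hasBdry_o32 : C.HasBdry C A.o32
    (A.o3 + A.o3.cyc [1, 2] - (A.o2.circ 1 A.o21).castDeg (n := 3) 1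
      + (A.o21.circ 0 A.o2).castDeg (n := 3) 1
      + ((A.o21.circ 1 A.o2).cyc [0, 1]).castDeg (n := 3) 1) :=
  ⟨⟨.lin3 _ _, hA.deg32⟩, hA.eq32⟩

end IsWeakLie3

end Lie3Maps

namespace DeformationRetract

open ThreeTermComplex

section

variable (R : DeformationRetract C C') (A : Lie3Maps k L) {n : ℕ} {r : ℤ}

@[simp] theorem proj_apply (ν : Op L L n r) (x) : R.proj ν x = R.i (R.p (ν x)) := rfl

@[simp] theorem post_apply (ν : Op L L n r) (x) : ν.post 1 R.h x = R.h (ν x) := rfl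

@[simp] theorem h2_apply (x) : R.h2 A x = R.h (A.o2 x) := rfl

@[simp] theorem h3_apply (x) : R.h3 A x = R.h (A.o3 x) := rfl

@[simp] theorem h21_apply (x) : R.h21 A x = R.h (A.o21 x) := rfl

/-- The operation `h θ₃`. -/
def ht3 : Op L L 3 2 := (R.t3 A).post 1 R.h

@[simp] theorem ht3_apply (x) : R.ht3 A x = R.h (R.t3 A x) := rfl

/-- The sum `λ₂ ∘ (h λ₂, h λ₂)^(1-(23)+(132))` of the trees with two incomparable internal
edges. -/
def fork : Op L L 4 2 := fun x =>
  (A.o2.circ 0 (R.h2 A)).circ 2 (R.h2 A) x - ((A.o2.circ 0 (R.h2 A)).circ 2 (R.h2 A)).cyc [1, 2] x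
    + ((A.o2.circ 0 (R.h2 A)).circ 2 (R.h2 A)).cyc [0, 2, 1] x

theorem t4_apply (a b c d : L) : R.t4 A ![(0, a), (0, b), (0, c), (0, d)] =
    A.o4 ![(0, a), (0, b), (0, c), (0, d)]
      - Op.insert23 (t := 2) A.o2 (R.ht3 A) ![(0, a), (0, b), (0, c), (0, d)]
      + Op.insert32 (t := 2) A.o3 (R.h2 A) ![(0, a), (0, b), (0, c), (0, d)]
      - R.fork A ![(0, a), (0, b), (0, c), (0, d)] := by
  simp [t4, Op.insert23, Op.insert32, fork, totalDeg, t3, Fin.sum_univ_three]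
  abel

end

section

variable (R : DeformationRetract C C') {A : Lie3Maps k L} (hA : A.IsLeibniz3 C)

theorem sub_proj_eq_h_bdry {n : ℕ} {r : ℤ} {μ : Op L L n 2} {ρ : Op L L n r}
    (hμ : C.HasBdry C μ ρ) {x} (hx : C.Homog x) : μ x - R.i (R.p (μ x)) = R.h (ρ x) :=
  sub_eq_zero.1 ((R.hasBdry_post_h hμ).eq_zero (by norm_num) x hx)

include hA

theorem hasBdry_h2 : C.HasBdry C (R.h2 A)
    (A.o2 - R.proj A.o2 - ((0 : Op L L 2 (0 - 1)).post 1 R.h).castDeg 0) :=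
  R.hasBdry_post_h hA.hasBdry_o2

theorem hasBdry_t3 : C.HasBdry C (R.t3 A) (A.o2.insert22 (R.proj A.o2) : Op L L 3 0) := by
  have h2 := hA.hasBdry_o2
  have hh := R.hasBdry_h2 hA
  refine (hA.hasBdry_o3.add ((h2.circ hh 0).sub ((h2.circ hh 1).sub
    ((h2.circ hh 1).cyc [0, 1])))).congr fun x _ => ?_
  obtain ⟨a, b, c, rfl⟩ := exists_eq_vec_three x
  simp [Op.insert22, smul_sub, totalDeg]
  abel

theorem hasBdry_ht3 : C.HasBdry C (R.ht3 A)
    (R.t3 A - R.proj (R.t3 A) - ((R.h2 A).insert22 (R.proj A.o2) : Op L L 3 1)) :=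
  (R.hasBdry_post_h (R.hasBdry_t3 hA)).congr fun x _ => by
    obtain ⟨a, b, c, rfl⟩ := exists_eq_vec_three x
    simp [Op.insert22]

theorem isOp_t4 : C.IsOp C (R.t4 A) := by
  have h2 := hA.hasBdry_o2.toIsOp
  have h3 := hA.hasBdry_o3.toIsOp
  have hh2 := R.isOp_post_h h2
  have hh3 := R.isOp_post_h h3
  have left := h2.circ hh2 0
  have right := h2.circ hh2 1
  have fork := left.circ hh2 2
  rw [← Op.comp2_two_two_eq_circ] at fork
  exact (hA.hasBdry_o4.toIsOp.sub (((((h2.circ hh3 0).add (((h2.circ hh3 1).sub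
    ((h2.circ hh3 1).cyc _)).add ((h2.circ hh3 1).cyc _))).add (h3.circ hh2 0)).sub
    ((h3.circ hh2 1).sub ((h3.circ hh2 1).cyc _))).add
    (((h3.circ hh2 2).sub ((h3.circ hh2 2).cyc _)).add ((h3.circ hh2 2).cyc _)))).sub
    (((((left.circ hh2 0).sub ((left.circ hh2 1).sub ((left.circ hh2 1).cyc _))).add
      ((fork.sub (fork.cyc _)).add (fork.cyc _))).add
      (((right.circ hh2 1).sub ((right.circ hh2 1).cyc _)).add ((right.circ hh2 1).cyc _))).sub
      ((((((right.circ hh2 2).sub ((right.circ hh2 2).cyc _)).add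
        ((right.circ hh2 2).cyc _)).sub ((right.circ hh2 2).cyc _)).add
        ((right.circ hh2 2).cyc _)).sub ((right.circ hh2 2).cyc _)))

theorem t4_eq (x : Fin 4 → ℤ × L) (hx : C.Homog x) : R.t4 A x =
    A.o4 x - A.o2.insert23 (t := 2) (R.ht3 A) x + A.o3.insert32 (t := 2) (R.h2 A) x
      - R.fork A x := by
  have h2 := hA.hasBdry_o2.toIsOp
  have hh2 := R.isOp_post_h h2
  have hfork := (h2.circ hh2 0).circ hh2 2
  refine (R.isOp_t4 hA).ext_degree_zero (((hA.hasBdry_o4.toIsOp.sub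
    (h2.insert23 (R.hasBdry_ht3 hA).toIsOp rfl)).add
    (hA.hasBdry_o3.toIsOp.insert32 hh2 rfl)).sub ((hfork.sub (hfork.cyc _)).add (hfork.cyc _)))
    (fun x _ h0 => ?_) x hx
  obtain ⟨a, b, c, d, rfl⟩ := exists_eq_vec_four_of_degree_zero x h0
  exact R.t4_apply A a b c d

set_option maxHeartbeats 1600000 in
-- every permutation of a grafting of trees becomes a separate term of the final linear identity
theorem hasBdry_t4 : C.HasBdry C (R.t4 A)
    (A.o2.insert23 (R.proj (R.t3 A)) + (R.t3 A).insert32 (R.proj A.o2) : Op L L 4 1) := by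
  have h2 := hA.hasBdry_o2
  have hh2 := R.hasBdry_h2 hA
  have ht3 := (R.hasBdry_t3 hA).toIsOp
  have hfork := (h2.circ hh2 0).circ hh2 2
  have trees := ((hA.hasBdry_o4.sub (h2.insert23 (R.hasBdry_ht3 hA) (zero_add 2))).add
    (hA.hasBdry_o3.insert32 hh2 one_add_one_eq_two)).sub
    ((hfork.sub (hfork.cyc [1, 2])).add (hfork.cyc [0, 2, 1]))
  refine (trees.congr_left (R.isOp_t4 hA) (R.t4_eq hA)).congr_homog
    ((h2.toIsOp.insert23 (R.isOp_proj ht3) rfl).add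
      (ht3.insert32 (R.isOp_proj h2.toIsOp) rfl)) fun x _ h0 hx => ?_
  obtain ⟨a, b, c, d, rfl | rfl | rfl | rfl | rfl⟩ :=
    exists_eq_vec_four_of_totalDeg_le_one x h0 (by omega)
  all_goals
    clear * -
    simp [Op.insert23, Op.insert32, Op.insert22, t3, smul_sub, totalDeg, Fin.sum_univ_three]
    abel

theorem hasBdry_ht4 : C.HasBdry C ((R.t4 A).post 1 R.h) (R.t4 A - R.proj (R.t4 A) -
    ((R.h2 A).insert23 (R.proj (R.t3 A)) + (R.ht3 A).insert32 (R.proj A.o2) : Op L L 4 2)) :=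
  (R.hasBdry_post_h (R.hasBdry_t4 hA)).congr fun x _ => by
    obtain ⟨a, b, c, d, rfl⟩ := exists_eq_vec_four x
    simp [Op.insert23, Op.insert32]

set_option maxRecDepth 100000 in
set_option maxHeartbeats 8000000 in
-- every permutation of a grafting of trees becomes a separate term of the final linear identity
theorem t4_leibniz (x : Fin 5 → ℤ × L) (hx : C.Homog x) :
    (A.o2.insert24 (R.proj (R.t4 A)) + (R.t3 A).insert33 (R.proj (R.t3 A))
      + (R.t4 A).insert42 (R.proj A.o2) : Op L L 5 2) x = 0 := by
  have h2 := hA.hasBdry_o2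
  have h3 := hA.hasBdry_o3
  have hh2 := R.hasBdry_h2 hA
  have ht3 := R.hasBdry_t3 hA
  have hht3 := R.hasBdry_ht3 hA
  have ht4 := R.hasBdry_t4 hA
  refine (((h2.toIsOp.insert24 (R.isOp_proj ht4.toIsOp) rfl).add
    (ht3.toIsOp.insert33 (R.isOp_proj ht3.toIsOp) rfl)).add
    (ht4.toIsOp.insert42 (R.isOp_proj h2.toIsOp) rfl)).ext_degree_zero
    .zero (fun x hx h0 => ?_) x hx
  have original := hA.eq5 x hx
  have trees₂₄ := (h2.insert24 (R.hasBdry_ht4 hA) (t := 3) rfl).eq_zero (by norm_num) x hx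
  have trees₃₃ := (h3.insert33 hht3 (t := 3) rfl).eq_zero (by norm_num) x hx
  have trees₄₂ := (hA.hasBdry_o4.insert42 hh2 (t := 3) rfl).eq_zero (by norm_num) x hx
  have h₂₃ := (h2.circ hh2 0).circ hht3 2
  have h₃₂ := (h2.circ hht3 0).circ hh2 3
  have h₀₂ := (h3.circ hh2 0).circ hh2 2
  have h₀₃ := (h3.circ hh2 0).circ hh2 3
  have h₁₃ := (h3.circ hh2 1).circ hh2 3
  have h₁₃' := h₁₃.sub (h₁₃.cyc [0, 1])
  have forks₂₃ := (((((h₂₃.sub (h₂₃.cyc [1, 2])).add (h₂₃.cyc [0, 2, 1])).add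
    (h₂₃.cyc [1, 2, 3])).sub (h₂₃.cyc [0, 2, 3, 1])).add
    (h₂₃.perm (Equiv.swap 0 2 * Equiv.swap 1 3))).eq_zero (by norm_num) x hx
  have forks₃₂ := (((h₃₂.sub (h₃₂.cyc [2, 3])).add (h₃₂.cyc [1, 3, 2])).sub
    (h₃₂.cyc [0, 3, 2, 1])).eq_zero (by norm_num) x hx
  have forks₀₂ := ((h₀₂.sub (h₀₂.cyc [1, 2])).add (h₀₂.cyc [0, 2, 1])).eq_zero (by norm_num) x hx
  have forks₀₃ := (((h₀₃.sub (h₀₃.cyc [2, 3])).add (h₀₃.cyc [1, 3, 2])).sub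
    (h₀₃.cyc [0, 3, 2, 1])).eq_zero (by norm_num) x hx
  have forks₁₃ := (((h₁₃'.sub (h₁₃'.cyc [2, 3])).add (h₁₃'.cyc [1, 3, 2])).sub
    (h₁₃'.cyc [0, 3, 2, 1])).eq_zero (by norm_num) x hx
  obtain ⟨a, b, c, d, e, rfl⟩ := exists_eq_vec_five_of_degree_zero x h0
  clear * - original trees₂₄ trees₃₃ trees₄₂ forks₂₃ forks₃₂ forks₀₂ forks₀₃ forks₁₃
  simp [t4_apply, t3, Op.insert22, Op.insert23, Op.insert32, fork, Op.insert24, Op.insert33,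
    Op.insert42, totalDeg, Fin.sum_univ_three, Fin.sum_univ_four, smul_sub, smul_add,
    -proj_apply, -ht3_apply, -h2_apply] at *
  linear_combination (norm := abel) -original - trees₂₄ + trees₃₃ - trees₄₂
    + forks₂₃ - forks₃₂ + forks₀₂ - forks₀₃ + forks₁₃

end

section

variable (R : DeformationRetract C C') {A : Lie3Maps k L} (hA : A.IsWeakLie3 C)
include hA

theorem hasBdry_h21 : C.HasBdry C (R.h21 A) (A.o21 - R.proj A.o21 -
    ((A.o2 + A.o2.cyc [0, 1] : Op L L 2 0).post 1 R.h).castDeg 1) :=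
  R.hasBdry_post_h hA.hasBdry_o21

theorem hasBdry_t31 : C.HasBdry C (R.t31 A)
    (R.t3 A + (R.t3 A).cyc [0, 1] + (A.o2.circ 0 (R.proj A.o21)).castDeg (n := 3) 1) := by
  have h2 := hA.hasBdry_o2
  have h21 := hA.hasBdry_o21.toIsOp
  have ht3 := (R.hasBdry_t3 hA.toIsLeibniz3).toIsOp
  refine (hA.hasBdry_o31.sub (h2.circ (R.hasBdry_h21 hA) 0)).congr_homog
    ((ht3.add (ht3.perm _)).add (h2.toIsOp.circ (R.isOp_proj h21) 0)) fun x _ h0 hx => ?_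
  obtain ⟨a, b, c, rfl | rfl | rfl | rfl⟩ :=
    exists_eq_vec_three_of_totalDeg_le_one x h0 (by omega)
  all_goals
    clear * -
    simp [t3, smul_sub, totalDeg]
    abel

theorem hasBdry_t32 : C.HasBdry C (R.t32 A)
    (R.t3 A + (R.t3 A).cyc [1, 2] - (A.o2.circ 1 (R.proj A.o21)).castDeg (n := 3) 1
      + (A.o21.circ 0 (R.proj A.o2)).castDeg (n := 3) 1
      + ((A.o21.circ 1 (R.proj A.o2)).cyc [0, 1]).castDeg (n := 3) 1) := by
  have h2 := hA.hasBdry_o2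
  have hh2 := R.hasBdry_h2 hA.toIsLeibniz3
  have h21 := hA.hasBdry_o21
  have ht3 := (R.hasBdry_t3 hA.toIsLeibniz3).toIsOp
  refine (hA.hasBdry_o32.add (((h21.circ hh2 0).add (h2.circ (R.hasBdry_h21 hA) 1)).add
    ((h21.circ hh2 1).cyc [0, 1]))).congr_homog ((((ht3.add (ht3.perm _)).sub
    (h2.toIsOp.circ (R.isOp_proj h21.toIsOp) 1)).add
    (h21.toIsOp.circ (R.isOp_proj h2.toIsOp) 0)).add
    ((h21.toIsOp.circ (R.isOp_proj h2.toIsOp) 1).perm _)) fun x _ h0 hx => ?_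
  obtain ⟨a, b, c, rfl | rfl | rfl | rfl⟩ :=
    exists_eq_vec_three_of_totalDeg_le_one x h0 (by omega)
  all_goals
    clear * -
    simp [t3, smul_sub, smul_add, totalDeg]
    abel

theorem hasBdry_h211 : C.HasBdry C (A.o211.post 1 R.h) (A.o211 - R.proj A.o211 -
    ((A.o21 - A.o21.cyc [0, 1] : Op L L 2 1).post 1 R.h).castDeg 2) :=
  R.hasBdry_post_h hA.hasBdry_o211

theorem t31_sub_cyc (x : Fin 3 → ℤ × L) (hx : C.Homog x) :
    R.t31 A x - (R.t31 A).cyc [0, 1] x = A.o2.circ 0 (R.proj A.o211) x := by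
  have h2 := hA.hasBdry_o2
  have ht31 := (R.hasBdry_t31 hA).toIsOp
  refine (ht31.sub (ht31.cyc _)).ext_degree_zero
    (h2.toIsOp.circ (R.isOp_proj hA.hasBdry_o211.toIsOp) 0) (fun x hx h0 => ?_) x hx
  have trees := (h2.circ (R.hasBdry_h211 hA) 0).eq_zero (by norm_num) x hx
  have original := hA.eq311 x hx
  obtain ⟨a, b, c, rfl⟩ := exists_eq_vec_three_of_degree_zero x h0
  simp [t31, totalDeg] at trees original ⊢
  linear_combination (norm := abel) original + trees

theorem t31_t32_cyclic (x : Fin 3 → ℤ × L) (hx : C.Homog x) :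
    R.t31 A x - (R.t32 A).cyc [0, 1] x + (R.t31 A).cyc [0, 2, 1] x
      - R.t32 A x + (R.t31 A).cyc [1, 2] x - (R.t32 A).cyc [0, 1, 2] x =
    A.o21.circ 1 (R.proj A.o21) x + A.o21.circ 0 (R.proj A.o21) x
      + (A.o21.circ 1 (R.proj A.o21)).cyc [0, 1] x
      + (A.o211.circ 1 (R.proj A.o2)).cyc [0, 2, 1] x := by
  have h2 := hA.hasBdry_o2.toIsOp
  have h21 := hA.hasBdry_o21
  have h211 := hA.hasBdry_o211
  have hh21 := R.hasBdry_h21 hA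
  have ht31 := (R.hasBdry_t31 hA).toIsOp
  have ht32 := (R.hasBdry_t32 hA).toIsOp
  have insert := h21.toIsOp.circ (R.isOp_proj h21.toIsOp)
  refine (((((ht31.sub (ht32.cyc _)).add (ht31.cyc _)).sub ht32).add (ht31.cyc _)).sub
    (ht32.cyc _)).ext_degree_zero ((((insert 1).add (insert 0)).add ((insert 1).cyc _)).add
    ((h211.toIsOp.circ (R.isOp_proj h2) 1).cyc _)) (fun x hx h0 => ?_) x hx
  have trees := ((((h21.circ hh21 0).add (h21.circ hh21 1)).add ((h21.circ hh21 1).cyc [0, 1])).sub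
    ((h211.circ (R.hasBdry_h2 hA.toIsLeibniz3) 1).cyc [0, 2, 1])).eq_zero (by norm_num) x hx
  have original := hA.eq312 x hx
  obtain ⟨a, b, c, rfl⟩ := exists_eq_vec_three_of_degree_zero x h0
  simp [t31, t32, totalDeg, smul_sub, smul_add] at trees original ⊢
  linear_combination (norm := abel) original - trees

theorem t32_sub_cyc (x : Fin 3 → ℤ × L) (hx : C.Homog x) :
    R.t32 A x - (R.t32 A).cyc [1, 2] x = -A.o2.circ 1 (R.proj A.o211) x
      + A.o211.circ 0 (R.proj A.o2) x + (A.o211.circ 1 (R.proj A.o2)).cyc [0, 1] x := by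
  have h2 := hA.hasBdry_o2
  have h211 := hA.hasBdry_o211
  have hh2 := R.hasBdry_h2 hA.toIsLeibniz3
  have ht32 := (R.hasBdry_t32 hA).toIsOp
  have insert := h211.toIsOp.circ (R.isOp_proj h2.toIsOp)
  refine (ht32.sub (ht32.cyc _)).ext_degree_zero (((h2.toIsOp.circ (R.isOp_proj h211.toIsOp)
    1).neg.add (insert 0)).add ((insert 1).cyc _)) (fun x hx h0 => ?_) x hx
  have trees := (((h211.circ hh2 0).sub (h2.circ (R.hasBdry_h211 hA) 1)).add
    ((h211.circ hh2 1).cyc [0, 1])).eq_zero (by norm_num) x hx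
  have original := hA.eq322 x hx
  obtain ⟨a, b, c, rfl⟩ := exists_eq_vec_three_of_degree_zero x h0
  simp [t32, totalDeg, smul_sub, smul_add] at trees original ⊢
  linear_combination (norm := abel) original + trees

theorem t4_add_cyc_zero_one (x : Fin 4 → ℤ × L) (hx : C.Homog x) :
    R.t4 A x + (R.t4 A).cyc [0, 1] x =
      A.o2.circ 0 (R.proj (R.t31 A)) x - (R.t31 A).circ 2 (R.proj A.o2) x
      + (A.o2.circ 1 (R.proj (R.t31 A))).cyc [0, 1, 2] x + (R.t3 A).circ 0 (R.proj A.o21) x := by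
  have h2 := hA.hasBdry_o2
  have h3 := hA.hasBdry_o3
  have hh2 := R.hasBdry_h2 hA.toIsLeibniz3
  have hh21 := R.hasBdry_h21 hA
  have ht3 := (R.hasBdry_t3 hA.toIsLeibniz3).toIsOp
  have ht31 := R.hasBdry_t31 hA
  have hht31 := R.hasBdry_post_h ht31
  have ht4 := R.isOp_t4 hA.toIsLeibniz3
  have insert := h2.toIsOp.circ (R.isOp_proj ht31.toIsOp)
  refine (ht4.add (ht4.cyc _)).ext_degree_zero ((((insert 0).sub
    (ht31.toIsOp.circ (R.isOp_proj h2.toIsOp) 2)).add ((insert 1).cyc _)).add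
    (ht3.circ (R.isOp_proj hA.hasBdry_o21.toIsOp) 0)) (fun x hx h0 => ?_) x hx
  have trees := (((((((h2.circ hh21 0).circ hh2 2).add (h2.circ hht31 0)).add
    ((h2.circ hht31 1).cyc [0, 1, 2])).sub (h3.circ hh21 0)).sub
    (hA.hasBdry_o31.circ hh2 2))).eq_zero (by norm_num) x hx
  have original := hA.eq41 x hx
  obtain ⟨a, b, c, d, rfl⟩ := exists_eq_vec_four_of_degree_zero x h0
  simp [t4, t31, t3, Op.insert22, totalDeg, Fin.sum_univ_three, smul_sub, smul_add]
    at trees original ⊢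
  linear_combination (norm := abel) original + trees

theorem t4_add_cyc_one_two (x : Fin 4 → ℤ × L) (hx : C.Homog x) :
    R.t4 A x + (R.t4 A).cyc [1, 2] x =
      A.o2.circ 0 (R.proj (R.t32 A)) x - (R.t3 A).circ 1 (R.proj A.o21) x
      + A.o2.circ 1 (R.proj (R.t31 A)) x - (R.t31 A).circ 0 (R.proj A.o2) x
      - ((R.t31 A).circ 1 (R.proj A.o2)).cyc [0, 1] x
      - ((R.t31 A).circ 2 (R.proj A.o2)).cyc [0, 2, 1] x := by
  have h2 := hA.hasBdry_o2
  have hh2 := R.hasBdry_h2 hA.toIsLeibniz3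
  have h31 := hA.hasBdry_o31
  have hh21 := R.hasBdry_h21 hA
  have ht3 := (R.hasBdry_t3 hA.toIsLeibniz3).toIsOp
  have ht31 := R.hasBdry_t31 hA
  have ht32 := R.hasBdry_t32 hA
  have ht4 := R.isOp_t4 hA.toIsLeibniz3
  have insert := ht31.toIsOp.circ (R.isOp_proj h2.toIsOp)
  refine (ht4.add (ht4.cyc _)).ext_degree_zero
    ((((((h2.toIsOp.circ (R.isOp_proj ht32.toIsOp) 0).sub
    (ht3.circ (R.isOp_proj hA.hasBdry_o21.toIsOp) 1)).add
    (h2.toIsOp.circ (R.isOp_proj ht31.toIsOp) 1)).sub (insert 0)).sub ((insert 1).cyc _)).sub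
    ((insert 2).cyc _)) (fun x hx h0 => ?_) x hx
  have trees := (((((((((h2.circ hh21 0).circ hh2 2).cyc [0, 2, 1]).add
    (h2.circ (R.hasBdry_post_h ht32) 0)).add (h2.circ (R.hasBdry_post_h ht31) 1)).add
    (hA.hasBdry_o3.circ hh21 1)).sub (h31.circ hh2 0)).sub ((h31.circ hh2 1).cyc [0, 1])).sub
    ((h31.circ hh2 2).cyc [0, 2, 1])).eq_zero (by norm_num) x hx
  have original := hA.eq42 x hx
  obtain ⟨a, b, c, d, rfl⟩ := exists_eq_vec_four_of_degree_zero x h0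
  simp [t4, t31, t32, t3, Op.insert22, totalDeg, Fin.sum_univ_three, smul_sub, smul_add]
    at trees original ⊢
  linear_combination (norm := abel) original + trees

theorem t4_add_cyc_two_three (x : Fin 4 → ℤ × L) (hx : C.Homog x) :
    R.t4 A x + (R.t4 A).cyc [2, 3] x =
      A.o21.circ 0 (R.proj (R.t3 A)) x - (R.t32 A).circ 0 (R.proj A.o2) x
      + (R.t32 A).circ 1 (R.proj A.o2) x - ((R.t32 A).circ 1 (R.proj A.o2)).cyc [0, 1] x
      + (R.t3 A).circ 2 (R.proj A.o21) x + ((R.t32 A).circ 2 (R.proj A.o2)).cyc [1, 2] x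
      - ((R.t32 A).circ 2 (R.proj A.o2)).cyc [0, 2, 1] x
      + A.o2.circ 1 (R.proj (R.t32 A)) x - (A.o2.circ 1 (R.proj (R.t32 A))).cyc [0, 1] x
      + (A.o21.circ 1 (R.proj (R.t3 A))).cyc [0, 1, 2] x := by
  have h2 := hA.hasBdry_o2
  have hh2 := R.hasBdry_h2 hA.toIsLeibniz3
  have h21 := hA.hasBdry_o21
  have h32 := hA.hasBdry_o32
  have hh21 := R.hasBdry_h21 hA
  have ht3 := R.hasBdry_t3 hA.toIsLeibniz3
  have hht3 := R.hasBdry_ht3 hA.toIsLeibniz3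
  have ht32 := R.hasBdry_t32 hA
  have hht32 := R.hasBdry_post_h ht32
  have ht4 := R.isOp_t4 hA.toIsLeibniz3
  have insert := ht32.toIsOp.circ (R.isOp_proj h2.toIsOp)
  have insert' := h2.toIsOp.circ (R.isOp_proj ht32.toIsOp) 1
  have insert'' := h21.toIsOp.circ (R.isOp_proj ht3.toIsOp)
  refine (ht4.add (ht4.cyc _)).ext_degree_zero
    ((((((((((insert'' 0).sub (insert 0)).add (insert 1)).sub ((insert 1).cyc _)).add
    (ht3.toIsOp.circ (R.isOp_proj h21.toIsOp) 2)).add ((insert 2).cyc _)).sub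
    ((insert 2).cyc _)).add insert').sub (insert'.cyc _)).add ((insert'' 1).cyc _))
    (fun x hx h0 => ?_) x hx
  have fork := (h21.circ hh2 0).circ hh2 2
  have trees := (((((((((((((fork.cyc [1, 2]).sub (fork.cyc [0, 2, 1])).sub
    ((h2.circ hh2 0).circ hh21 2)).add (h2.circ hht32 1)).sub
    ((h2.circ hht32 1).cyc [0, 1])).sub (h21.circ hht3 0)).sub
    ((h21.circ hht3 1).cyc [0, 1, 2])).sub (hA.hasBdry_o3.circ hh21 2)).sub
    (h32.circ hh2 0)).add (h32.circ hh2 1)).sub ((h32.circ hh2 1).cyc [0, 1])).add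
    ((h32.circ hh2 2).cyc [1, 2])).sub ((h32.circ hh2 2).cyc [0, 2, 1])).eq_zero (by norm_num) x hx
  have original := hA.eq43 x hx
  obtain ⟨a, b, c, d, rfl⟩ := exists_eq_vec_four_of_degree_zero x h0
  simp [t4, t32, t3, Op.insert22, totalDeg, Fin.sum_univ_three, smul_sub, smul_add]
    at trees original ⊢
  linear_combination (norm := abel) original + trees

end

end DeformationRetract

namespace ThreeTermComplex

/-- The projection of `L` onto its summand of degree `a`, as an endomorphism of `L`. -/
noncomputable def component (C : ThreeTermComplex k L) (a : ℤ) : L →ₗ[k] L :=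
  letI := C.isInternal.chooseDecomposition
  (C.gr a).subtype ∘ₗ DirectSum.component k ℤ (fun b => C.gr b) a ∘ₗ
    (DirectSum.decomposeLinearEquiv C.gr).toLinearMap

theorem component_of_mem (C : ThreeTermComplex k L) {a b : ℤ} {v : L} (hv : v ∈ C.gr b) :
    C.component a v = if a = b then v else 0 := by
  let _ := C.isInternal.chooseDecomposition
  split_ifs with h
  · subst h
    exact DirectSum.decompose_of_mem_same C.gr hv
  · exact DirectSum.decompose_of_mem_ne C.gr hv (Ne.symm h)

end ThreeTermComplex

namespace Op

variable {n : ℕ}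

theorem pair_update {α β : Type*} (a : Fin n → α) (v : Fin n → β) (j : Fin n) (u : β) :
    (fun l => (a l, Function.update v j u l)) =
      Function.update (fun l => (a l, v l)) j (a j, u) := by
  funext l
  obtain rfl | h := eq_or_ne l j <;> simp [*]

/-- A multilinear map of no arguments, as its value: the base case of the iterated currying
`currySucc (… (currySucc curry0))`. -/
def curry0 : MultilinearMap k (fun _ : Fin 0 => L) L' →ₗ[k] L' :=
  (MultilinearMap.constLinearEquivOfIsEmpty k k (fun _ : Fin 0 => L) L').symm.toLinearMap

/-- Extends a currying `g` of `n`-ary multilinear maps to `n + 1` arguments. -/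
def currySucc {N : Type*} [AddCommGroup N] [Module k N]
    (g : MultilinearMap k (fun _ : Fin n => L) L' →ₗ[k] N) :
    MultilinearMap k (fun _ : Fin (n + 1) => L) L' →ₗ[k] L →ₗ[k] N :=
  g.compRight k ∘ₗ (multilinearCurryLeftEquiv k (fun _ : Fin (n + 1) => L) L').toLinearMap

namespace IsMultilinear

variable {r : ℤ} {μ : Op L L' n r}

/-- `μ` as a multilinear map of arguments taken in the degrees `a`. -/
def toMultilinearMap (hμ : μ.IsMultilinear k) (a : Fin n → ℤ) :
    MultilinearMap k (fun _ : Fin n => L) L' :=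
  .mk' (fun v => μ fun j => (a j, v j))
    (fun v j u w => by simp only [pair_update, hμ.map_update_add])
    (fun v j c u => by simp only [pair_update, hμ.map_update_smul])

/-- The multilinear map that agrees with `μ` on homogeneous arguments: apply `μ` to all
homogeneous components of the arguments, each in its own degree. -/
noncomputable def totalize (hμ : μ.IsMultilinear k) (C : ThreeTermComplex k L) :
    MultilinearMap k (fun _ : Fin n => L) L' :=
  ∑ a ∈ Fintype.piFinset fun _ => Finset.Icc (0 : ℤ) 2,
    (hμ.toMultilinearMap a).compLinearMap fun j => C.component (a j)

theorem totalize_apply (hμ : μ.IsMultilinear k) {x : Fin n → ℤ × L} (hx : C.Homog x) :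
    hμ.totalize C (fun j => (x j).2) = μ x := by
  have term (a : Fin n → ℤ) : (hμ.toMultilinearMap a).compLinearMap (fun j => C.component (a j))
      (fun j => (x j).2) = if a = fun j => (x j).1 then μ x else 0 := by
    split_ifs with ha
    · subst ha
      simp [toMultilinearMap, C.component_of_mem (hx _)]
    · obtain ⟨j, hj⟩ := Function.ne_iff.1 ha
      exact (hμ.toMultilinearMap a).map_coord_zero j ((C.component_of_mem (hx j)).trans (if_neg hj))
  simp only [totalize, sum_apply, term, Finset.sum_ite_eq', Fintype.mem_piFinset,
    Finset.mem_Icc]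
  split_ifs with h
  · rfl
  · obtain ⟨j, hj⟩ := not_forall.1 h
    refine (hμ.map_eq_zero (j := j) ?_).symm
    have := hx j
    rwa [C.gr_eq_bot _ (by omega), Submodule.mem_bot] at this

theorem exists_lin2 {μ : Op L L' 2 r} (hμ : μ.IsMultilinear k) (C : ThreeTermComplex k L) :
    ∃ f : L →ₗ[k] L →ₗ[k] L', ∀ x, C.Homog x → Op.lin2 r f x = μ x := by
  refine ⟨currySucc (currySucc curry0) (hμ.totalize C), fun x hx => ?_⟩
  rw [← hμ.totalize_apply hx]
  refine congrArg (hμ.totalize C) (funext fun j => ?_)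
  fin_cases j <;> rfl

theorem exists_lin3 {μ : Op L L' 3 r} (hμ : μ.IsMultilinear k) (C : ThreeTermComplex k L) :
    ∃ f : L →ₗ[k] L →ₗ[k] L →ₗ[k] L', ∀ x, C.Homog x → Op.lin3 r f x = μ x := by
  refine ⟨currySucc (currySucc (currySucc curry0)) (hμ.totalize C), fun x hx => ?_⟩
  rw [← hμ.totalize_apply hx]
  refine congrArg (hμ.totalize C) (funext fun j => ?_)
  fin_cases j <;> rfl

theorem exists_lin4 {μ : Op L L' 4 r} (hμ : μ.IsMultilinear k) (C : ThreeTermComplex k L) :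
    ∃ f : L →ₗ[k] L →ₗ[k] L →ₗ[k] L →ₗ[k] L', ∀ x, C.Homog x → Op.lin4 r f x = μ x := by
  refine ⟨currySucc (currySucc (currySucc (currySucc curry0))) (hμ.totalize C), fun x hx => ?_⟩
  rw [← hμ.totalize_apply hx]
  refine congrArg (hμ.totalize C) (funext fun j => ?_)
  fin_cases j <;> rfl

end IsMultilinear

end Op

omit [AddCommGroup L] [AddCommGroup L'] in
theorem mapArgs_update (f : L → L') {n : ℕ} (x : Fin n → ℤ × L) (j : Fin n) (v : ℤ × L) :
    mapArgs f (Function.update x j v) = Function.update (mapArgs f x) j (v.1, f v.2) := by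
  funext l
  obtain rfl | h := eq_or_ne l j <;> simp [mapArgs, *]

omit [AddCommGroup L] [AddCommGroup L'] in
theorem mapArgs_outerArgs (f : L → L') {m n : ℕ} (i : Fin m) (x : Fin (m + n - 1) → ℤ × L)
    (w : ℤ × L) :
    mapArgs f (Op.outerArgs i x w) = Op.outerArgs i (mapArgs f x) (w.1, f w.2) := by
  funext j
  obtain rfl | h := eq_or_ne j i <;> simp [mapArgs, Op.outerArgs, *]

theorem Op.IsMultilinear.mapArgs {N : Type*} [AddCommGroup N] [Module k N] {n : ℕ} {r : ℤ}
    {μ : Op L N n r} (hμ : μ.IsMultilinear k) (f : L' →ₗ[k] L) :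
    Op.IsMultilinear k (r := r) fun x : Fin n → ℤ × L' => μ (mapArgs f x) where
  map_update_add x j a v w := by
    simp only [mapArgs_update, map_add, hμ.map_update_add]
  map_update_smul x j a c v := by
    simp only [mapArgs_update, map_smul, hμ.map_update_smul]

namespace DeformationRetract

open ThreeTermComplex

variable {N : Type*} [AddCommGroup N] [Module k N] (R : DeformationRetract C C')
  {m n : ℕ} {r r' s t t' : ℤ}

/-- The operation `μ'` on `L'` is `g ∘ μ ∘ (i, …, i)`; only homogeneous arguments count, as for all
identities between operations. The degrees of `μ` and `μ'` are independent since `g`, which is one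
of `p`, `id` and `-h` below, may shift degrees. -/
def Induces (g : L →ₗ[k] N) (μ : Op L L n r) (μ' : Op L' N n r') : Prop :=
  ∀ x, C'.Homog x → μ' x = g (μ (mapArgs R.i x))

theorem homog_mapArgs_i {x : Fin n → ℤ × L'} (hx : C'.Homog x) : C.Homog (mapArgs R.i x) :=
  fun j => R.i_mem _ _ (hx j)

namespace Induces

variable {R} {g : L →ₗ[k] N} {μ : Op L L m r} {μ' : Op L' N m r'}

theorem hasDegree {D : ThreeTermComplex k N} {μ' : Op L' N m r} (h : R.Induces g μ μ')
    (hμ : C.IsOp C μ) (hg : ∀ a, ∀ v ∈ C.gr a, g v ∈ D.gr a) : C'.HasDegree D μ' := fun x hx => by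
  rw [h x hx]
  exact hg _ _ (hμ.hasDegree _ (R.homog_mapArgs_i hx))

theorem bdry_eq {D : ThreeTermComplex k N} {μ' : Op L' N m r} (h : R.Induces g μ μ')
    (hg : ∀ v, g (C.d v) = D.d (g v)) {x} (hx : C'.Homog x) :
    C'.bdry D μ' x = g (C.bdry C μ (mapArgs R.i x)) := by
  simp only [bdry_apply, map_sub, map_sum, LinearMap.map_smul_of_tower, hg, h x hx,
    h _ (hx.update_d _), mapArgs_update, R.i_d]
  rfl

theorem perm (h : R.Induces g μ μ') (σ : Equiv.Perm (Fin m)) :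
    R.Induces g (μ.perm σ) (μ'.perm σ) := fun x hx => by
  rw [Op.perm_apply, Op.perm_apply, LinearMap.map_smul_of_tower]
  exact congrArg _ (h _ fun j => hx (σ.symm j))

theorem cyc (h : R.Induces g μ μ') (c : List (Fin m)) : R.Induces g (μ.cyc c) (μ'.cyc c) :=
  h.perm _

theorem circ {ν : Op L L n s} {ν' : Op L' L' n s} (h : R.Induces g μ μ') (hν : C.IsOp C ν)
    (h' : R.Induces R.p ν ν') (i : Fin m) :
    R.Induces g (μ.circ i (R.proj ν)) (μ'.circ i ν') := fun x hx => by
  have hinner : C'.Homog (Op.innerArgs i x) := fun l => hx _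
  have houter :
      C'.Homog (Op.outerArgs i x (totalDeg (Op.innerArgs i x) + s, ν' (Op.innerArgs i x))) := by
    refine hx.outerArgs i ?_
    rw [h' _ hinner]
    exact R.p_mem _ _ (hν.hasDegree _ (R.homog_mapArgs_i hinner))
  rw [Op.circ_apply _ _ _ _ (0, 0), Op.circ_apply _ _ _ _ (0, R.i 0), h _ houter,
    LinearMap.map_smul_of_tower, mapArgs_outerArgs, h' _ hinner, ← mapArgs_outerArgs R.i i x (0, 0)]
  rfl

theorem circ_cyc {ν : Op L L n s} {ν' : Op L' L' n s} (h : R.Induces g μ μ')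
    (hν : C.IsOp C ν) (h' : R.Induces R.p ν ν') (i : Fin m) (c : List (Fin (m + n - 1))) :
    R.Induces g ((μ.circ i (R.proj ν)).cyc c) ((μ'.circ i ν').cyc c) :=
  (h.circ hν h' i).cyc c

theorem insert22 {μ : Op L L 2 r} {μ' : Op L' N 2 r'} {ν : Op L L 2 s} {ν' : Op L' L' 2 s}
    (h : R.Induces g μ μ') (hν : C.IsOp C ν) (h' : R.Induces R.p ν ν') :
    R.Induces g (μ.insert22 (R.proj ν) : Op L L 3 t) (μ'.insert22 ν' : Op L' N 3 t') :=
  fun x hx => by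
    simp only [Op.insert22, map_sub, ← h.circ hν h' _ x hx, ← h.circ_cyc hν h' _ _ x hx]

theorem insert23 {μ : Op L L 2 r} {μ' : Op L' N 2 r'} {ν : Op L L 3 s} {ν' : Op L' L' 3 s}
    (h : R.Induces g μ μ') (hν : C.IsOp C ν) (h' : R.Induces R.p ν ν') :
    R.Induces g (μ.insert23 (R.proj ν) : Op L L 4 t) (μ'.insert23 ν' : Op L' N 4 t') :=
  fun x hx => by
    simp only [Op.insert23, map_sub, map_add, ← h.circ hν h' _ x hx, ← h.circ_cyc hν h' _ _ x hx]

theorem insert32 {μ : Op L L 3 r} {μ' : Op L' N 3 r'} {ν : Op L L 2 s} {ν' : Op L' L' 2 s}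
    (h : R.Induces g μ μ') (hν : C.IsOp C ν) (h' : R.Induces R.p ν ν') :
    R.Induces g (μ.insert32 (R.proj ν) : Op L L 4 t) (μ'.insert32 ν' : Op L' N 4 t') :=
  fun x hx => by
    simp only [Op.insert32, map_sub, map_add, map_neg, ← h.circ hν h' _ x hx,
      ← h.circ_cyc hν h' _ _ x hx]

theorem insert24 {μ : Op L L 2 r} {μ' : Op L' N 2 r'} {ν : Op L L 4 s} {ν' : Op L' L' 4 s}
    (h : R.Induces g μ μ') (hν : C.IsOp C ν) (h' : R.Induces R.p ν ν') :
    R.Induces g (μ.insert24 (R.proj ν) : Op L L 5 t) (μ'.insert24 ν' : Op L' N 5 t') :=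
  fun x hx => by
    simp only [Op.insert24, map_sub, map_add, ← h.circ hν h' _ x hx, ← h.circ_cyc hν h' _ _ x hx]

theorem insert42 {μ : Op L L 4 r} {μ' : Op L' N 4 r'} {ν : Op L L 2 s} {ν' : Op L' L' 2 s}
    (h : R.Induces g μ μ') (hν : C.IsOp C ν) (h' : R.Induces R.p ν ν') :
    R.Induces g (μ.insert42 (R.proj ν) : Op L L 5 t) (μ'.insert42 ν' : Op L' N 5 t') :=
  fun x hx => by
    simp only [Op.insert42, map_sub, map_add, ← h.circ hν h' _ x hx, ← h.circ_cyc hν h' _ _ x hx]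

theorem insert33 {μ : Op L L 3 r} {μ' : Op L' N 3 r'} {ν : Op L L 3 s} {ν' : Op L' L' 3 s}
    (h : R.Induces g μ μ') (hν : C.IsOp C ν) (h' : R.Induces R.p ν ν') :
    R.Induces g (μ.insert33 (R.proj ν) : Op L L 5 t) (μ'.insert33 ν' : Op L' N 5 t') :=
  fun x hx => by
    simp only [Op.insert33, map_sub, map_add, ← h.circ hν h' _ x hx, ← h.circ_cyc hν h' _ _ x hx,
      ← (h.circ hν h' _).perm _ x hx]

end Induces

end DeformationRetract

namespace DeformationRetract

open ThreeTermComplex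

variable {R : DeformationRetract C C'} {A : Lie3Maps k L} {A' : Lie3Maps k L'}

theorem Induces.bdry_proj {m : ℕ} {r r' : ℤ} {μ : Op L L m r} {μ' : Op L' L' m r}
    {ρ : Op L L m r'} (h : R.Induces R.p μ μ') (hμ : C.HasBdry C μ ρ) {x : Fin m → ℤ × L'}
    (hx : C'.Homog x) : C'.bdry C' μ' x = R.p (ρ (mapArgs R.i x)) := by
  rw [h.bdry_eq R.p_d hx, hμ.bdry_eq _ (R.homog_mapArgs_i hx)]

namespace IsTransferred

section

variable (h : R.IsTransferred A A')
include h

theorem o2 : R.Induces R.p A.o2 A'.o2 := h.l2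
theorem o3 : R.Induces R.p (R.t3 A) A'.o3 := h.l3
theorem o4 : R.Induces R.p (R.t4 A) A'.o4 := h.l4
theorem o21 : R.Induces R.p A.o21 A'.o21 := h.l21
theorem o211 : R.Induces R.p A.o211 A'.o211 := h.l211
theorem o31 : R.Induces R.p (R.t31 A) A'.o31 := h.l31
theorem o32 : R.Induces R.p (R.t32 A) A'.o32 := h.l32

end

theorem isLeibniz3 (h : R.IsTransferred A A') (hA : A.IsLeibniz3 C) : A'.IsLeibniz3 C' where
  deg2 := h.o2.hasDegree hA.hasBdry_o2.toIsOp R.p_mem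
  deg3 := h.o3.hasDegree (R.hasBdry_t3 hA).toIsOp R.p_mem
  deg4 := h.o4.hasDegree (R.isOp_t4 hA) R.p_mem
  eq2 x hx := (h.o2.bdry_proj hA.hasBdry_o2 hx).trans (map_zero _)
  eq3 x hx := (h.o3.bdry_proj (R.hasBdry_t3 hA) hx).trans
    (h.o2.insert22 (t := 0) (t' := 0) hA.hasBdry_o2.toIsOp h.o2 x hx).symm
  eq4 x hx := by
    have inserted_o3 := h.o2.insert23 (t := 1) (t' := 1) (R.hasBdry_t3 hA).toIsOp h.o3 x hx
    have inserted_o2 := h.o3.insert32 (t := 1) (t' := 1) hA.hasBdry_o2.toIsOp h.o2 x hx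
    rw [h.o4.bdry_proj (R.hasBdry_t4 hA) hx, Op.add_apply, map_add, ← inserted_o3, ← inserted_o2]
    simp only [Op.insert23, Op.insert32]
    abel
  eq5 x hx := by
    have inserted_o4 := h.o2.insert24 (t := 2) (t' := 2) (R.isOp_t4 hA) h.o4 x hx
    have inserted_o3 := h.o3.insert33 (t := 2) (t' := 2) (R.hasBdry_t3 hA).toIsOp h.o3 x hx
    have inserted_o2 := h.o4.insert42 (t := 2) (t' := 2) hA.hasBdry_o2.toIsOp h.o2 x hx
    have total := congrArg R.p (R.t4_leibniz hA _ (R.homog_mapArgs_i hx))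
    simp only [Op.add_apply, map_add, map_zero] at total
    rw [← inserted_o4, ← inserted_o3, ← inserted_o2] at total
    rw [← total]
    simp only [Op.insert24, Op.insert33, Op.insert42]
    abel

section

variable (h : R.IsTransferred A A') (hA : A.IsWeakLie3 C) {x : Fin 3 → ℤ × L'} (hx : C'.Homog x)
include h hA hx

theorem bdry_o31 : C'.bdry C' A'.o31 x =
    A'.o3 x + A'.o3.cyc [0, 1] x + A'.o2.circ 0 A'.o21 x := by
  rw [h.o31.bdry_proj (R.hasBdry_t31 hA) hx, h.o3 x hx, h.o3.cyc _ x hx,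
    h.o2.circ hA.hasBdry_o21.toIsOp h.o21 _ x hx]
  simp only [← map_add]
  rfl

theorem bdry_o32 : C'.bdry C' A'.o32 x =
    A'.o3 x + A'.o3.cyc [1, 2] x - A'.o2.circ 1 A'.o21 x
      + A'.o21.circ 0 A'.o2 x + (A'.o21.circ 1 A'.o2).cyc [0, 1] x := by
  have isOp_o2 := hA.hasBdry_o2.toIsOp
  rw [h.o32.bdry_proj (R.hasBdry_t32 hA) hx, h.o3 x hx, h.o3.cyc _ x hx,
    h.o2.circ hA.hasBdry_o21.toIsOp h.o21 _ x hx, h.o21.circ isOp_o2 h.o2 _ x hx,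
    h.o21.circ_cyc isOp_o2 h.o2 _ _ x hx]
  simp only [← map_add, ← map_sub]
  rfl

theorem o31_sub_cyc : A'.o31 x - A'.o31.cyc [0, 1] x = A'.o2.circ 0 A'.o211 x := by
  rw [h.o31 x hx, h.o31.cyc _ x hx, h.o2.circ hA.hasBdry_o211.toIsOp h.o211 _ x hx, ← map_sub,
    R.t31_sub_cyc hA _ (R.homog_mapArgs_i hx)]

theorem o31_o32_cyclic :
    A'.o31 x - A'.o32.cyc [0, 1] x + A'.o31.cyc [0, 2, 1] x
      - A'.o32 x + A'.o31.cyc [1, 2] x - A'.o32.cyc [0, 1, 2] x =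
    A'.o21.circ 1 A'.o21 x + A'.o21.circ 0 A'.o21 x
      + (A'.o21.circ 1 A'.o21).cyc [0, 1] x + (A'.o211.circ 1 A'.o2).cyc [0, 2, 1] x := by
  have isOp_o21 := hA.hasBdry_o21.toIsOp
  rw [h.o21.circ isOp_o21 h.o21 _ x hx, h.o21.circ isOp_o21 h.o21 _ x hx,
    h.o21.circ_cyc isOp_o21 h.o21 _ _ x hx,
    h.o211.circ_cyc hA.hasBdry_o2.toIsOp h.o2 _ _ x hx]
  simp only [h.o31 x hx, h.o31.cyc _ x hx, h.o32 x hx, h.o32.cyc _ x hx, ← map_add, ← map_sub,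
    R.t31_t32_cyclic hA _ (R.homog_mapArgs_i hx)]

theorem o32_sub_cyc : A'.o32 x - A'.o32.cyc [1, 2] x =
    -A'.o2.circ 1 A'.o211 x + A'.o211.circ 0 A'.o2 x
      + (A'.o211.circ 1 A'.o2).cyc [0, 1] x := by
  have isOp_o2 := hA.hasBdry_o2.toIsOp
  rw [h.o2.circ hA.hasBdry_o211.toIsOp h.o211 _ x hx]
  simp only [h.o32 x hx, h.o32.cyc _ x hx, ← map_add, ← map_sub, ← map_neg,
    h.o211.circ isOp_o2 h.o2 _ x hx, h.o211.circ_cyc isOp_o2 h.o2 _ _ x hx,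
    R.t32_sub_cyc hA _ (R.homog_mapArgs_i hx)]

end

section

variable (h : R.IsTransferred A A') (hA : A.IsWeakLie3 C) {x : Fin 4 → ℤ × L'} (hx : C'.Homog x)
include h hA hx

theorem o4_add_cyc_zero_one : A'.o4 x + A'.o4.cyc [0, 1] x =
    A'.o2.circ 0 A'.o31 x - A'.o31.circ 2 A'.o2 x
      + (A'.o2.circ 1 A'.o31).cyc [0, 1, 2] x + A'.o3.circ 0 A'.o21 x := by
  have isOp_t31 := (R.hasBdry_t31 hA).toIsOp
  simp only [h.o4 x hx, h.o4.cyc _ x hx, ← map_add, ← map_sub, h.o2.circ isOp_t31 h.o31 _ x hx,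
    h.o31.circ hA.hasBdry_o2.toIsOp h.o2 _ x hx, h.o2.circ_cyc isOp_t31 h.o31 _ _ x hx,
    h.o3.circ hA.hasBdry_o21.toIsOp h.o21 _ x hx,
    R.t4_add_cyc_zero_one hA _ (R.homog_mapArgs_i hx)]

theorem o4_add_cyc_one_two : A'.o4 x + A'.o4.cyc [1, 2] x =
    A'.o2.circ 0 A'.o32 x - A'.o3.circ 1 A'.o21 x + A'.o2.circ 1 A'.o31 x
      - A'.o31.circ 0 A'.o2 x - (A'.o31.circ 1 A'.o2).cyc [0, 1] x
      - (A'.o31.circ 2 A'.o2).cyc [0, 2, 1] x := by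
  have isOp_o2 := hA.hasBdry_o2.toIsOp
  simp only [h.o4 x hx, h.o4.cyc _ x hx, ← map_add, ← map_sub,
    h.o2.circ (R.hasBdry_t31 hA).toIsOp h.o31 _ x hx, h.o31.circ isOp_o2 h.o2 _ x hx,
    h.o2.circ (R.hasBdry_t32 hA).toIsOp h.o32 _ x hx, h.o31.circ_cyc isOp_o2 h.o2 _ _ x hx,
    h.o3.circ hA.hasBdry_o21.toIsOp h.o21 _ x hx,
    R.t4_add_cyc_one_two hA _ (R.homog_mapArgs_i hx)]

theorem o4_add_cyc_two_three : A'.o4 x + A'.o4.cyc [2, 3] x =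
    A'.o21.circ 0 A'.o3 x - A'.o32.circ 0 A'.o2 x
      + A'.o32.circ 1 A'.o2 x - (A'.o32.circ 1 A'.o2).cyc [0, 1] x
      + A'.o3.circ 2 A'.o21 x + (A'.o32.circ 2 A'.o2).cyc [1, 2] x
      - (A'.o32.circ 2 A'.o2).cyc [0, 2, 1] x
      + A'.o2.circ 1 A'.o32 x - (A'.o2.circ 1 A'.o32).cyc [0, 1] x
      + (A'.o21.circ 1 A'.o3).cyc [0, 1, 2] x := by
  have isOp_o2 := hA.hasBdry_o2.toIsOp
  have isOp_t3 := (R.hasBdry_t3 hA.toIsLeibniz3).toIsOp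
  have isOp_t32 := (R.hasBdry_t32 hA).toIsOp
  simp only [h.o4 x hx, h.o4.cyc _ x hx, ← map_add, ← map_sub,
    h.o2.circ isOp_t32 h.o32 _ x hx, h.o2.circ_cyc isOp_t32 h.o32 _ _ x hx,
    h.o32.circ isOp_o2 h.o2 _ x hx, h.o32.circ_cyc isOp_o2 h.o2 _ _ x hx,
    h.o21.circ isOp_t3 h.o3 _ x hx, h.o21.circ_cyc isOp_t3 h.o3 _ _ x hx,
    h.o3.circ hA.hasBdry_o21.toIsOp h.o21 _ x hx,
    R.t4_add_cyc_two_three hA _ (R.homog_mapArgs_i hx)]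

end

theorem isWeakLie3 (h : R.IsTransferred A A') (hA : A.IsWeakLie3 C) : A'.IsWeakLie3 C' where
  toIsLeibniz3 := h.isLeibniz3 hA.toIsLeibniz3
  deg21 := h.o21.hasDegree hA.hasBdry_o21.toIsOp R.p_mem
  deg211 := h.o211.hasDegree hA.hasBdry_o211.toIsOp R.p_mem
  deg31 := h.o31.hasDegree (R.hasBdry_t31 hA).toIsOp R.p_mem
  deg32 := h.o32.hasDegree (R.hasBdry_t32 hA).toIsOp R.p_mem
  eq21 x hx := by
    rw [h.o21.bdry_proj hA.hasBdry_o21 hx, h.o2 x hx, h.o2.cyc _ x hx, ← map_add]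
    rfl
  eq211 x hx := by
    rw [h.o211.bdry_proj hA.hasBdry_o211 hx, h.o21 x hx, h.o21.cyc _ x hx, ← map_sub]
    rfl
  eq31 _ := h.bdry_o31 hA
  eq32 _ := h.bdry_o32 hA
  eq2111 x hx := by
    rw [h.o211 x hx, h.o211.cyc _ x hx, ← map_add, hA.eq2111 _ (R.homog_mapArgs_i hx), map_zero]
  eq311 _ := h.o31_sub_cyc hA
  eq312 _ := h.o31_o32_cyclic hA
  eq322 _ := h.o32_sub_cyc hA
  eq41 _ := h.o4_add_cyc_zero_one hA
  eq42 _ := h.o4_add_cyc_one_two hA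
  eq43 _ := h.o4_add_cyc_two_three hA

end IsTransferred

section

variable (R : DeformationRetract C C') {A : Lie3Maps k L} (hA : A.IsWeakLie3 C)
include hA

theorem exists_isTransferred : ∃ A', R.IsTransferred A A' := by
  have isMultilinear {n : ℕ} {r : ℤ} {μ : Op L L n r} (hμ : C.IsOp C μ) :
      Op.IsMultilinear k (r := 0 + r) fun x => R.p (μ (mapArgs R.i x)) :=
    (hμ.isMultilinear.mapArgs R.i).post R.p 0
  obtain ⟨l2, h2⟩ := (isMultilinear hA.hasBdry_o2.toIsOp).exists_lin2 C'
  obtain ⟨l3, h3⟩ := (isMultilinear (R.hasBdry_t3 hA.toIsLeibniz3).toIsOp).exists_lin3 C'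
  obtain ⟨l4, h4⟩ := (isMultilinear (R.isOp_t4 hA.toIsLeibniz3)).exists_lin4 C'
  obtain ⟨l21, h21⟩ := (isMultilinear hA.hasBdry_o21.toIsOp).exists_lin2 C'
  obtain ⟨l211, h211⟩ := (isMultilinear hA.hasBdry_o211.toIsOp).exists_lin2 C'
  obtain ⟨l31, h31⟩ := (isMultilinear (R.hasBdry_t31 hA).toIsOp).exists_lin3 C'
  obtain ⟨l32, h32⟩ := (isMultilinear (R.hasBdry_t32 hA).toIsOp).exists_lin3 C'
  exact ⟨⟨l2, l3, l4, l21, l211, l31, l32⟩, ⟨h2, h3, h4, h21, h211, h31, h32⟩⟩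

theorem exists_isExtendedInclusion : ∃ f, R.IsExtendedInclusion A f := by
  have isMultilinear {n : ℕ} {r : ℤ} {μ : Op L L n r} (hμ : C.IsOp C μ) :
      Op.IsMultilinear k (r := 1 + r) fun x => -R.h (μ (mapArgs R.i x)) :=
    (hμ.isMultilinear.mapArgs R.i).post (-R.h) 1
  obtain ⟨f2, h2⟩ := (isMultilinear hA.hasBdry_o2.toIsOp).exists_lin2 C'
  obtain ⟨f3, h3⟩ := (isMultilinear (R.hasBdry_t3 hA.toIsLeibniz3).toIsOp).exists_lin3 C'
  obtain ⟨f21, h21⟩ := (isMultilinear hA.hasBdry_o21.toIsOp).exists_lin2 C'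
  exact ⟨⟨R.i, f2, f3, f21⟩, ⟨rfl, h2, h3, h21⟩⟩

end

end DeformationRetract

namespace DeformationRetract.Induces

variable {R : DeformationRetract C C'} {r s : ℤ} {μ : Op L L 2 r} {κ : Op L L 3 r}
  {ν : Op L L 2 s} {ν' : Op L' L 2 s} {ξ : Op L L 3 s} {ξ' : Op L' L 3 s}

theorem comp2_incl_two (h : R.Induces .id ν ν') :
    R.Induces .id (μ.circ 1 ν) (μ.comp2 (.lin1 0 R.i) ν') := fun x hx => by
  have e : ν' (fun l => x ⟨1 + l, by omega⟩) = ν (fun l => mapArgs R.i x ⟨1 + l, by omega⟩) :=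
    h _ fun l => hx _
  refine congrArg₂ (fun (a : ℤ) y => a.negOnePow • μ y) ?_ (funext fun j => ?_)
  · simp [mapArgs, totalDeg]
  · fin_cases j <;> simp [e, Op.lin1, mapArgs, totalDeg]

theorem comp2_incl_three (h : R.Induces .id ξ ξ') :
    R.Induces .id (μ.circ 1 ξ) (μ.comp2 (.lin1 0 R.i) ξ') := fun x hx => by
  have e : ξ' (fun l => x ⟨1 + l, by omega⟩) = ξ (fun l => mapArgs R.i x ⟨1 + l, by omega⟩) :=
    h _ fun l => hx _
  refine congrArg₂ (fun (a : ℤ) y => a.negOnePow • μ y) ?_ (funext fun j => ?_)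
  · simp [mapArgs, totalDeg]
  · fin_cases j <;> simp [e, Op.lin1, mapArgs, totalDeg]

theorem comp2_two_incl (h : R.Induces .id ν ν') :
    R.Induces .id (μ.circ 0 ν) (μ.comp2 ν' (.lin1 0 R.i)) := fun x hx => by
  have e : ν' (fun l => x ⟨l, by omega⟩) = ν (fun l => mapArgs R.i x ⟨0 + l, by omega⟩) :=
    (h _ fun l => hx ⟨l, by omega⟩).trans (congrArg ν (funext fun l => by simp [mapArgs]))
  refine congrArg₂ (fun (a : ℤ) y => a.negOnePow • μ y) ?_ (funext fun j => ?_)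
  · simp [mapArgs, totalDeg]
  · fin_cases j <;> simp [e, Op.lin1, mapArgs, totalDeg]

theorem comp2_three_incl (h : R.Induces .id ξ ξ') :
    R.Induces .id (μ.circ 0 ξ) (μ.comp2 ξ' (.lin1 0 R.i)) := fun x hx => by
  have e : ξ' (fun l => x ⟨l, by omega⟩) = ξ (fun l => mapArgs R.i x ⟨0 + l, by omega⟩) :=
    (h _ fun l => hx ⟨l, by omega⟩).trans (congrArg ξ (funext fun l => by simp [mapArgs]))
  refine congrArg₂ (fun (a : ℤ) y => a.negOnePow • μ y) ?_ (funext fun j => ?_)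
  · simp [mapArgs, totalDeg]
  · fin_cases j <;> simp [e, Op.lin1, mapArgs, totalDeg]

theorem comp2_two_two (h : R.Induces .id ν ν') :
    R.Induces .id (μ.comp2 ν ν) (μ.comp2 ν' ν') := fun x hx => by
  have e₁ : ν' (fun l => x ⟨l, by omega⟩) = ν (fun l => mapArgs R.i x ⟨l, by omega⟩) :=
    h _ fun l => hx _
  have e₂ : ν' (fun l => x ⟨2 + l, by omega⟩) = ν (fun l => mapArgs R.i x ⟨2 + l, by omega⟩) :=
    h _ fun l => hx _
  refine congrArg₂ (fun (a : ℤ) y => a.negOnePow • μ y) ?_ (funext fun j => ?_)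
  · simp [mapArgs, totalDeg]
  · fin_cases j <;> simp [e₁, e₂, mapArgs, totalDeg]

theorem comp3_two_incl_incl (h : R.Induces .id ν ν') :
    R.Induces .id (κ.circ 0 ν) (κ.comp3 ν' (.lin1 0 R.i) (.lin1 0 R.i)) := fun x hx => by
  have e : ν' (fun l => x ⟨l, by omega⟩) = ν (fun l => mapArgs R.i x ⟨0 + l, by omega⟩) :=
    (h _ fun l => hx ⟨l, by omega⟩).trans (congrArg ν (funext fun l => by simp [mapArgs]))
  refine congrArg₂ (fun (a : ℤ) y => a.negOnePow • κ y) ?_ (funext fun j => ?_)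
  · simp [mapArgs, totalDeg]
  · fin_cases j <;> simp [e, Op.lin1, mapArgs, totalDeg]

theorem comp3_incl_two_incl (h : R.Induces .id ν ν') :
    R.Induces .id (κ.circ 1 ν) (κ.comp3 (.lin1 0 R.i) ν' (.lin1 0 R.i)) := fun x hx => by
  have e : ν' (fun l => x ⟨1 + l, by omega⟩) = ν (fun l => mapArgs R.i x ⟨1 + l, by omega⟩) :=
    h _ fun l => hx _
  refine congrArg₂ (fun (a : ℤ) y => a.negOnePow • κ y) ?_ (funext fun j => ?_)
  · simp [mapArgs, totalDeg]
  · fin_cases j <;> simp [e, Op.lin1, mapArgs, totalDeg]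

theorem comp3_incl_incl_two (h : R.Induces .id ν ν') :
    R.Induces .id (κ.circ 2 ν) (κ.comp3 (.lin1 0 R.i) (.lin1 0 R.i) ν') := fun x hx => by
  have e : ν' (fun l => x ⟨2 + l, by omega⟩) = ν (fun l => mapArgs R.i x ⟨2 + l, by omega⟩) :=
    h _ fun l => hx _
  refine congrArg₂ (fun (a : ℤ) y => a.negOnePow • κ y) ?_ (funext fun j => ?_)
  · simp [mapArgs, totalDeg, Fin.sum_univ_two]
  · fin_cases j <;> simp [e, Op.lin1, mapArgs, totalDeg]

end DeformationRetract.Induces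

namespace DeformationRetract

open ThreeTermComplex

variable {R : DeformationRetract C C'}

theorem Induces.bdry_neg_h {n : ℕ} {r r' : ℤ} {μ : Op L L n r} {μ' : Op L' L n (1 + r)}
    {ρ : Op L L n r'} (h : R.Induces (-R.h) μ μ') (hμ : C.HasBdry C μ ρ) {x} (hx : C'.Homog x) :
    C'.bdry C μ' x = R.i (R.p (μ (mapArgs R.i x))) - μ (mapArgs R.i x)
      + R.h (ρ (mapArgs R.i x)) := by
  have hμ' : R.Induces .id (-μ.post 1 R.h) μ' := h
  rw [hμ'.bdry_eq (fun _ => rfl) hx]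
  refine ((R.hasBdry_post_h hμ).neg.bdry_eq _ (R.homog_mapArgs_i hx)).trans ?_
  simp only [Op.neg_apply, Op.sub_apply, Op.castDeg_apply, proj_apply, post_apply]
  abel

namespace IsExtendedInclusion

variable {A : Lie3Maps k L} {A' : Lie3Maps k L'} {f : Lie3MorMaps k L' L}

section

variable (hf : R.IsExtendedInclusion A f)
include hf

theorem o1 : f.o1 = .lin1 0 R.i := by rw [← hf.f1]; rfl
theorem o2 : R.Induces (-R.h) A.o2 f.o2 := hf.f2
theorem o3 : R.Induces (-R.h) (R.t3 A) f.o3 := hf.f3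
theorem o21 : R.Induces (-R.h) A.o21 f.o21 := hf.f21
theorem o2_id : R.Induces .id (-R.h2 A) f.o2 := hf.f2
theorem o3_id : R.Induces .id (-R.ht3 A) f.o3 := hf.f3
theorem o21_id : R.Induces .id (-R.h21 A) f.o21 := hf.f21

end

section

variable (hf : R.IsExtendedInclusion A f) (hA' : R.IsTransferred A A')
include hf hA'

theorem bdry_o3 (hA : A.IsLeibniz3 C) {x} (hx : C'.Homog x) : C'.bdry C f.o3 x =
    R.i (A'.o3 x) - f.o2.circ 1 A'.o2 x + f.o2.circ 0 A'.o2 x + (f.o2.circ 1 A'.o2).cyc [0, 1] x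
      - A.o3 (mapArgs R.i x) - A.o2.comp2 f.o1 f.o2 x + A.o2.comp2 f.o2 f.o1 x
      + (A.o2.comp2 f.o1 f.o2).cyc [0, 1] x := by
  have mul_o2 := hA.hasBdry_o2.isMultilinear
  have isOp_o2 := hA.hasBdry_o2.toIsOp
  have inserted_o2 := hf.o2.insert22 (t := 0) (t' := 1) isOp_o2 hA'.o2 x hx
  rw [hf.o3.bdry_neg_h (R.hasBdry_t3 hA) hx, hA'.o3 x hx, hf.o1,
    hf.o2_id.comp2_incl_two x hx, hf.o2_id.comp2_two_incl x hx,
    (hf.o2_id.comp2_incl_two (μ := A.o2)).cyc _ x hx, mul_o2.circ_neg, mul_o2.circ_neg]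
  rw [LinearMap.neg_apply, ← neg_eq_iff_eq_neg] at inserted_o2
  rw [← inserted_o2]
  simp only [Op.insert22, t3, LinearMap.id_apply, Op.neg_cyc, Op.neg_apply]
  abel

theorem i_o4_sub (hA : A.IsLeibniz3 C) {x} (hx : C'.Homog x) :
    R.i (A'.o4 x) - A.o4 (mapArgs R.i x) =
      f.o2.circ 0 A'.o3 x + f.o2.circ 1 A'.o3 x - (f.o2.circ 1 A'.o3).cyc [0, 1] x
      + (f.o2.circ 1 A'.o3).cyc [0, 1, 2] x - f.o3.circ 0 A'.o2 x
      + f.o3.circ 1 A'.o2 x - (f.o3.circ 1 A'.o2).cyc [0, 1] x - f.o3.circ 2 A'.o2 x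
      + (f.o3.circ 2 A'.o2).cyc [1, 2] x - (f.o3.circ 2 A'.o2).cyc [0, 2, 1] x
      + A.o2.comp2 f.o3 f.o1 x + A.o2.comp2 f.o1 f.o3 x
      - (A.o2.comp2 f.o1 f.o3).cyc [0, 1] x + (A.o2.comp2 f.o1 f.o3).cyc [0, 1, 2] x
      - A.o2.comp2 f.o2 f.o2 x + (A.o2.comp2 f.o2 f.o2).cyc [1, 2] x
      - (A.o2.comp2 f.o2 f.o2).cyc [0, 2, 1] x
      + A.o3.comp3 f.o2 f.o1 f.o1 x
      - A.o3.comp3 f.o1 f.o2 f.o1 x + (A.o3.comp3 f.o1 f.o2 f.o1).cyc [0, 1] x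
      + A.o3.comp3 f.o1 f.o1 f.o2 x
      - (A.o3.comp3 f.o1 f.o1 f.o2).cyc [1, 2] x
      + (A.o3.comp3 f.o1 f.o1 f.o2).cyc [0, 2, 1] x := by
  have hy := R.homog_mapArgs_i hx
  have mul_o2 := hA.hasBdry_o2.isMultilinear
  have mul_o3 := hA.hasBdry_o3.isMultilinear
  have isOp_t3 := (R.hasBdry_t3 hA).toIsOp
  have inserted_o3 := hf.o2.insert23 (t := 1) (t' := 2) isOp_t3 hA'.o3 x hx
  have inserted_o2 := hf.o3.insert32 (t := 1) (t' := 2) hA.hasBdry_o2.toIsOp hA'.o2 x hx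
  have key := R.sub_proj_eq_h_bdry (R.hasBdry_t4 hA) hy
  rw [Op.add_apply, map_add, ← hA'.o4 x hx] at key
  rw [LinearMap.neg_apply, ← neg_eq_iff_eq_neg] at inserted_o3 inserted_o2
  rw [← inserted_o3, ← inserted_o2, R.t4_eq hA _ hy, sub_eq_iff_eq_add] at key
  rw [hf.o1]
  simp only [hf.o3_id.comp2_incl_three x hx, hf.o3_id.comp2_incl_three.cyc _ x hx,
    hf.o3_id.comp2_three_incl x hx, hf.o2_id.comp2_two_two x hx, hf.o2_id.comp2_two_two.cyc _ x hx,
    hf.o2_id.comp3_two_incl_incl x hx, hf.o2_id.comp3_incl_two_incl x hx,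
    hf.o2_id.comp3_incl_two_incl.cyc _ x hx, hf.o2_id.comp3_incl_incl_two x hx,
    hf.o2_id.comp3_incl_incl_two.cyc _ x hx]
  have mul_tree : (A.o2.circ 0 (R.h2 A)).IsMultilinear k :=
    mul_o2.circ (R.isOp_post_h hA.hasBdry_o2.toIsOp).isMultilinear 0
  simp only [Op.comp2_two_two_eq_circ, mul_o2.circ_neg, Op.neg_circ, mul_tree.circ_neg,
    mul_o3.circ_neg, neg_neg, LinearMap.id_apply, Op.neg_cyc, Op.neg_apply, Op.insert23,
    Op.insert32, fork] at key ⊢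
  linear_combination (norm := abel) -key

theorem bdry_o21 (hA : A.IsWeakLie3 C) {x} (hx : C'.Homog x) : C'.bdry C f.o21 x =
    -f.o2 x - f.o2.cyc [0, 1] x + R.i (A'.o21 x) - A.o21 (mapArgs R.i x) := by
  rw [hf.o21.bdry_neg_h hA.hasBdry_o21 hx, hA'.o21 x hx, hf.o2 x hx, hf.o2.cyc _ x hx]
  simp only [Op.add_apply, map_add, LinearMap.neg_apply]
  abel

theorem i_o211_sub (hA : A.IsWeakLie3 C) {x} (hx : C'.Homog x) :
    R.i (A'.o211 x) - A.o211 (mapArgs R.i x) = f.o21 x - f.o21.cyc [0, 1] x := by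
  rw [hA'.o211 x hx, hf.o21 x hx, hf.o21.cyc _ x hx, ← map_sub, ← neg_sub,
    R.sub_proj_eq_h_bdry hA.hasBdry_o211 (R.homog_mapArgs_i hx)]
  rfl

theorem i_o31_sub (hA : A.IsWeakLie3 C) {x} (hx : C'.Homog x) :
    R.i (A'.o31 x) - A.o31 (mapArgs R.i x) =
      f.o3 x + f.o3.cyc [0, 1] x + f.o2.circ 0 A'.o21 x + A.o2.comp2 f.o21 f.o1 x := by
  have key := R.sub_proj_eq_h_bdry (R.hasBdry_t31 hA) (R.homog_mapArgs_i hx)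
  rw [← hA'.o31 x hx, Op.add_apply, Op.add_apply, Op.castDeg_apply, t31, sub_eq_iff_eq_add] at key
  rw [hf.o3 x hx, hf.o3.cyc _ x hx, hf.o2.circ hA.hasBdry_o21.toIsOp hA'.o21 _ x hx, hf.o1,
    hf.o21_id.comp2_two_incl x hx, hA.hasBdry_o2.isMultilinear.circ_neg]
  simp only [map_add, LinearMap.neg_apply, LinearMap.id_apply, Op.neg_apply] at key ⊢
  linear_combination (norm := abel) -key

theorem i_o32_sub (hA : A.IsWeakLie3 C) {x} (hx : C'.Homog x) :
    R.i (A'.o32 x) - A.o32 (mapArgs R.i x) = f.o3 x + f.o3.cyc [1, 2] x - f.o2.circ 1 A'.o21 x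
      + f.o21.circ 0 A'.o2 x + (f.o21.circ 1 A'.o2).cyc [0, 1] x
      - A.o2.comp2 f.o1 f.o21 x - A.o21.comp2 f.o2 f.o1 x
      - (A.o21.comp2 f.o1 f.o2).cyc [0, 1] x := by
  have mul_o2 := hA.hasBdry_o2.isMultilinear
  have mul_o21 := hA.hasBdry_o21.isMultilinear
  have isOp_o2 := hA.hasBdry_o2.toIsOp
  have key := R.sub_proj_eq_h_bdry (R.hasBdry_t32 hA) (R.homog_mapArgs_i hx)
  rw [← hA'.o32 x hx, t32, sub_eq_iff_eq_add] at key
  rw [hf.o3 x hx, hf.o3.cyc _ x hx, hf.o2.circ hA.hasBdry_o21.toIsOp hA'.o21 _ x hx,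
    hf.o21.circ isOp_o2 hA'.o2 _ x hx, hf.o21.circ_cyc isOp_o2 hA'.o2 _ _ x hx, hf.o1,
    hf.o21_id.comp2_incl_two x hx, hf.o2_id.comp2_two_incl x hx,
    (hf.o2_id.comp2_incl_two (μ := A.o21)).cyc _ x hx, mul_o2.circ_neg, mul_o21.circ_neg,
    mul_o21.circ_neg]
  simp only [Op.add_apply, Op.sub_apply, Op.castDeg_apply, map_add, map_sub, LinearMap.neg_apply,
    LinearMap.id_apply, Op.neg_cyc, Op.neg_apply] at key ⊢
  linear_combination (norm := abel) -key

theorem isLeibniz3Mor (hA : A.IsLeibniz3 C) : f.IsLeibniz3Mor C' C A' A where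
  deg1 x hx := by
    rw [hf.o1, totalDeg, Fin.sum_univ_one, add_zero]
    exact R.i_mem _ _ (hx 0)
  deg2 := hf.o2_id.hasDegree (R.hasBdry_h2 hA).neg.toIsOp fun _ _ hv => hv
  deg3 := hf.o3_id.hasDegree (R.hasBdry_ht3 hA).neg.toIsOp fun _ _ hv => hv
  eq1 x _ := by
    simp [hf.o1, bdry_apply, Op.lin1, R.i_d, Op.degBefore]
  eq2 x hx := by
    rw [hf.f1, hf.o2.bdry_neg_h hA.hasBdry_o2 hx, hA'.o2 x hx]
    exact add_eq_left.2 (map_zero R.h)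
  eq3 x hx := by
    rw [hf.f1]
    exact hf.bdry_o3 hA' hA hx
  eq4 x hx := by
    rw [hf.f1]
    exact hf.i_o4_sub hA' hA hx

theorem isWeakLie3Mor (hA : A.IsWeakLie3 C) : f.IsWeakLie3Mor C' C A' A where
  toIsLeibniz3Mor := hf.isLeibniz3Mor hA' hA.toIsLeibniz3
  deg21 := hf.o21_id.hasDegree (R.isOp_post_h hA.hasBdry_o21.toIsOp).neg fun _ _ hv => hv
  eq21 x hx := by
    rw [hf.f1]
    exact hf.bdry_o21 hA' hA hx
  eq211 x hx := by
    rw [hf.f1]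
    exact hf.i_o211_sub hA' hA hx
  eq31 x hx := by
    rw [hf.f1]
    exact hf.i_o31_sub hA' hA hx
  eq32 x hx := by
    rw [hf.f1]
    exact hf.i_o32_sub hA' hA hx

end

end IsExtendedInclusion

end DeformationRetract

end

/-- Homotopy transfer for weak Lie `3`-algebras: a deformation retract `(L', d')` of the complex
underlying a weak Lie `3`-algebra `(L, d, λ)` carries the transferred weak Lie `3`-algebra
structure, and the inclusion `i` extends to a weak morphism `(L', d', λ') → (L, d, λ)`. -/
theorem mainTheorem1 {k : Type*} [CommRing k] {L L' : Type*} [AddCommGroup L] [Module k L]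
    [AddCommGroup L'] [Module k L'] (C : ThreeTermComplex k L) (C' : ThreeTermComplex k L')
    (A : WeakLie3Algebra C) (R : DeformationRetract C C') :
    ∃ (A' : WeakLie3Algebra C') (f : WeakLie3Mor A' A),
      R.IsTransferred A.toLie3Maps A'.toLie3Maps ∧
      f.f1 = R.i ∧ R.IsExtendedInclusion A.toLie3Maps f.toLie3MorMaps := by
  obtain ⟨A', hA'⟩ := R.exists_isTransferred A.isWeakLie3
  obtain ⟨f, hf⟩ := R.exists_isExtendedInclusion A.isWeakLie3
  exact ⟨⟨A', hA'.isWeakLie3 A.isWeakLie3⟩, ⟨f, hf.isWeakLie3Mor hA' A.isWeakLie3⟩, hA', hf.f1, hf⟩
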